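/- **Setting.** Let $\mathcal S,\mathcal A$ be finite nonempty sets, $0\le\gamma<1$, $r_{max}>0$. A task $\tau\in\Gamma$ is an MDP $(\mathcal S,\mathcal A,\gamma,\rho_\tau,P_\tau,r_\tau)$ with rewards $r_\tau(s,a,s')\in[0,r_{max}]$, depending measurably on $\tau$; $\mathbb P(\Gamma)$ is a probability distribution on $\Gamma$. For a policy $\pi$ let $V^\pi_\tau(s)=\mathbb E[\sum_{t\ge0}\gamma^t r_\tau(s_t,a_t,s_{t+1})\mid s_0=s,\pi]$, let $Q^\pi_\tau(s,a)$ be the same expectation given $s_0=s,a_0=a$, and put $A^\pi_\tau=Q^\pi_\tau-V^\pi_\tau$, $J_\tau(\pi)=\mathbb E_{s\sim\rho_\tau}[V^\pi_\tau(s)]$, $\nu^\pi_\tau(s)=(1-\gamma)\sum_{t\ge0}\gamma^t\,\mathbb P(s_t=s\mid s_0\sim\rho_\tau,\pi)$. For $\theta\in\mathbb R^{\mathcal S\times\mathcal A}$ let $\hat\pi_\theta(a|s)=e^{\theta(s,a)}/\sum_{a'}e^{\theta(s,a')}$. For probability vectors let $d_1^2(p,q)=D_{KL}(p\|q)$, $d_2^2(p,q)=D_{KL}(q\|p)$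 (values in $[0,\infty]$), and for $i\in\{1,2\}$ let $D_{\tau,i}^2(\pi,\pi')=\mathbb E_{s\sim\nu^\pi_\tau}[d_i^2(\pi(\cdot|s),\pi'(\cdot|s))]$. For $\lambda>0$ let $$Alg^{(i)}(\hat\pi_\phi,\lambda,\tau)(\cdot|s)=\operatorname*{argmax}_{p}\ \sum_{a}p(a)\,Q^{\hat\pi_\phi}_\tau(s,a)-\lambda\,d_i^2(\hat\pi_\phi(\cdot|s),p),$$ the maximum being over all probability distributions $p$ on $\mathcal A$, and let $F^{(i)}(\phi)=\mathbb E_{\tau\sim\mathbb P(\Gamma)}[J_\tau(Alg^{(i)}(\hat\pi_\phi,\lambda,\tau))]$. Let $\Theta\subseteq\mathbb R^{\mathcal S\times\mathcal A}$ be a set of admissible parameters (for instance a compact set, or the whole space). Let $\Pi_\Theta$ be the closure of $\{\hat\pi_\theta:\theta\in\Theta\}$ in the space of policies, and call $\pi^*$ optimal for $\tau$ if it maximizes $J_\tau$ over $\Pi_\Theta$. Put $$\mathcal Var_i(\mathbb P(\Gamma))=\inf_{\theta\in\Theta}\ \inf_{(\pi^*_\tau)}\ \mathbb E_{\tau\sim\mathbb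 P(\Gamma)}\big[D_{\tau,i}^2(\hat\pi_\theta,\pi^*_\tau)\big]\in[0,\infty],$$ the second infimum being over the measurable choices of an optimal policy $\pi^*_\tau$ for every task $\tau$. **Assumptions.** Let $i\in\{1,2\}$, $A_{max}>0$ and $\epsilon>0$, put $\lambda=\frac{2A_{max}}{(1-\gamma)\epsilon}$, and suppose: (1) $|A^{\hat\pi_\theta}_\tau(s,a)|\le A_{max}$ for all $\tau,\theta,s,a$; (2) $\nu^{\hat\pi_\phi}_\tau(s)\ge\epsilon$ for all $\tau$, all $\phi\in\Theta$ and all $s$; (3) $h_i:[0,\infty)\to[0,\infty)$ is concave and non-decreasing, and $\sup_{\phi'\in\Theta}F^{(i)}(\phi')-F^{(i)}(\phi)\le h_i(\|\nabla F^{(i)}(\phi)\|^2)$ for every $\phi\in\mathbb R^{\mathcal S\times\mathcal A}$. **Constants.** $B_1=\frac{16r_{max}}{\lambda(1-\gamma)^3}+\frac{24}{1-\gamma}+\frac{12}{\lambda}$, $C_1=\frac{6}{1-\gamma}$, $G_1=\frac{4A_{max}}{(1-\gamma)^2}$; $B_2=\frac{16r_{max}}{\lambda(1-\gamma)^3}+\frac{18}{(1-\gamma)^2}$,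 $C_2=\frac{4}{1-\gamma}$, $G_2=\frac{2A_{max}}{(1-\gamma)^2}$; $K_i=\frac{2(B_i+2C_i^2)r_{max}^2}{(1-\gamma)^4}$, $M_i=\frac{(B_i+2C_i^2)G_ir_{max}}{(1-\gamma)^4}$. **Algorithm.** Let $T\ge1$ and $$\alpha=\min\Big\{\Big(\tfrac{r_{max}B_i}{(1-\gamma)^2}+\tfrac{2\gamma r_{max}C_i^2}{(1-\gamma)^3}\Big)^{-1},\ \tfrac{1}{G_i\sqrt T}\Big\}.$$ Let $\tau_0,\tau_1,\dots$ be i.i.d. with law $\mathbb P(\Gamma)$, let $\phi_0\in\mathbb R^{\mathcal S\times\mathcal A}$, and let $\phi_{t+1}=\phi_t+\alpha\,\nabla_\phi J_{\tau_t}(Alg^{(i)}(\hat\pi_\phi,\lambda,\tau_t))\big|_{\phi=\phi_t}$. **Theorem.** Let $\pi^*_\tau$ be an optimal policy for each task $\tau$. Then $$\frac1T\sum_{t=1}^T\mathbb E\Big[\mathbb E_{\tau\sim\mathbb P(\Gamma)}\big[J_\tau(\pi^*_\tau)-J_\tau(Alg^{(i)}(\hat\pi_{\phi_t},\lambda,\tau))\big]\Big]\le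 h_i\Big(\frac{K_i}{T}+\frac{M_i}{\sqrt T}\Big)+\frac{2(1+\gamma)A_{max}}{(1-\gamma)^2\epsilon}\,\mathcal Var_i(\mathbb P(\Gamma)),$$ where the outer expectation is over the sampled tasks. -/

import Mathlib

open MeasureTheory ProbabilityTheory
open scoped ENNReal

noncomputable section

namespace MetaRL

/-- The task-dependent data of a Markov decision process on the finite state space `S` and the
finite action space `A`: initial distribution, transition probabilities, and a reward function
with values in `[0, rmax]`. -/
structure MDP (S A : Type*) [Fintype S] (rmax : ℝ) where
  ρ : S → ℝ
  ρ_mem : ρ ∈ stdSimplex ℝ S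
  P : S → A → S → ℝ
  P_mem : ∀ s a, P s a ∈ stdSimplex ℝ S
  r : S → A → S → ℝ
  r_nonneg : ∀ s a s', 0 ≤ r s a s'
  r_le : ∀ s a s', r s a s' ≤ rmax

/-- The two orders of the Kullback-Leibler divergence: `one` is
`d₁²(π, π') = KL(π ‖ π')`, `two` is `d₂²(π, π') = KL(π' ‖ π)`. -/
inductive Order
  | one
  | two

section MDPDefs

variable {S A : Type*} [Fintype S] [Fintype A] {rmax : ℝ}

/-- The law of `(s_t, a_t)` when `(s_0, a_0)` has law `μ₀`, the states follow the transition
probabilities of `M`, and `a_t` is drawn from `π (· | s_t)` for `t ≥ 1`. -/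
def pairLaw (M : MDP S A rmax) (π : S → A → ℝ) (μ₀ : S → A → ℝ) : ℕ → S → A → ℝ
  | 0 => μ₀
  | t + 1 => fun s' a' => (∑ s, ∑ a, pairLaw M π μ₀ t s a * M.P s a s') * π s' a'

/-- The expected discounted return `∑_t γ^t E[r(s_t, a_t, s_{t+1})]` when `(s_0, a_0)` has
law `μ₀`. -/
def discountedReturn (γ : ℝ) (M : MDP S A rmax) (π : S → A → ℝ) (μ₀ : S → A → ℝ) : ℝ :=
  ∑' t : ℕ, γ ^ t * ∑ s, ∑ a, ∑ s', pairLaw M π μ₀ t s a * M.P s a s' * M.r s a s'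

open Classical in
/-- The value function `V^π(s)`: `s_0 = s`, `a_0 ∼ π (· | s)`. -/
def V (γ : ℝ) (M : MDP S A rmax) (π : S → A → ℝ) (s : S) : ℝ :=
  discountedReturn γ M π (fun s₀ a₀ => if s₀ = s then π s₀ a₀ else 0)

open Classical in
/-- The action-value function `Q^π(s, a)`: `s_0 = s`, `a_0 = a`. -/
def Q (γ : ℝ) (M : MDP S A rmax) (π : S → A → ℝ) (s : S) (a : A) : ℝ :=
  discountedReturn γ M π (fun s₀ a₀ => if s₀ = s ∧ a₀ = a then 1 else 0)

/-- The advantage function `A^π(s, a) = Q^π(s, a) - V^π(s)`. -/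
def advantage (γ : ℝ) (M : MDP S A rmax) (π : S → A → ℝ) (s : S) (a : A) : ℝ :=
  Q γ M π s a - V γ M π s

/-- The accumulated reward `J(π) = E_{s ∼ ρ}[V^π(s)]`. -/
def J (γ : ℝ) (M : MDP S A rmax) (π : S → A → ℝ) : ℝ :=
  ∑ s, M.ρ s * V γ M π s

/-- The discounted state visitation distribution
`ν^π(s) = (1 - γ) ∑_t γ^t ℙ(s_t = s | s_0 ∼ ρ, π)`. -/
def visitation (γ : ℝ) (M : MDP S A rmax) (π : S → A → ℝ) (s : S) : ℝ :=
  (1 - γ) * ∑' t : ℕ, γ ^ t * ∑ a, pairLaw M π (fun s₀ a₀ => M.ρ s₀ * π s₀ a₀) t s a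

/-- The tabular softmax policy with parameter `θ ∈ ℝ^{S × A}` (with its Euclidean norm). -/
def softmaxPolicy (θ : EuclideanSpace ℝ (S × A)) (s : S) (a : A) : ℝ :=
  Real.exp (θ (s, a)) / ∑ a', Real.exp (θ (s, a'))

open Classical in
/-- Kullback-Leibler divergence `KL(p ‖ q) ∈ [0, ∞]` of probability vectors: it is infinite
when `p` is not absolutely continuous with respect to `q`. -/
def kl (p q : A → ℝ) : ℝ≥0∞ :=
  if ∀ a, q a = 0 → p a = 0 then ENNReal.ofReal (∑ a, p a * Real.log (p a / q a)) else ⊤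

/-- The squared distance `d_i²(p, q)` of two action distributions. -/
def sqDistAction (i : Order) (p q : A → ℝ) : ℝ≥0∞ :=
  match i with
  | .one => kl p q
  | .two => kl q p

/-- The squared distance `D_{τ,i}²(π, π') = E_{s ∼ ν^π}[d_i²(π(·|s), π'(·|s))]`. -/
def sqDist (i : Order) (γ : ℝ) (M : MDP S A rmax) (π π' : S → A → ℝ) : ℝ≥0∞ :=
  ∑ s, ENNReal.ofReal (visitation γ M π s) * sqDistAction i (π s) (π' s)

/-- The objective of the within-task problem at the state `s`, for the meta-policy `π` and a
candidate action distribution `p`: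
`∑_a p(a) Q^π(s, a) - lam * d_i²(π(·|s), p)`. -/
def withinTaskObjective (i : Order) (γ lam : ℝ) (M : MDP S A rmax) (π : S → A → ℝ) (s : S)
    (p : A → ℝ) : EReal :=
  ((∑ a, p a * Q γ M π s a : ℝ) : EReal) - (lam : EReal) * (sqDistAction i (π s) p : EReal)

/-- The within-task algorithm `Alg^{(i)}(π, lam, τ)`: at every state, the maximizer of the
within-task objective over the probability distributions on `A`. (For a softmax policy `π` and
`lam > 0` this maximizer exists and is unique.) -/
def alg (i : Order) (γ lam : ℝ) (M : MDP S A rmax) (π : S → A → ℝ) (s : S) : A → ℝ :=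
  Classical.epsilon fun p : A → ℝ =>
    p ∈ stdSimplex ℝ A ∧ IsMaxOn (withinTaskObjective i γ lam M π s) (stdSimplex ℝ A) p

/-- `J_τ(Alg^{(i)}(π̂_φ, lam, τ))`: the reward after adaptation from the meta-parameter `φ`. -/
def adaptedReward (i : Order) (γ lam : ℝ) (M : MDP S A rmax)
    (φ : EuclideanSpace ℝ (S × A)) : ℝ :=
  J γ M (alg i γ lam M (softmaxPolicy φ))

/-- The softmax policies with parameter in `Θ`, together with their limits. If `Θ` is compact,
these are exactly the policies `π̂_θ`, `θ ∈ Θ`; if `Θ` is the whole parameter space, these are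
all the policies. -/
def policyClass (Θ : Set (EuclideanSpace ℝ (S × A))) : Set (S → A → ℝ) :=
  closure (softmaxPolicy '' Θ)

/-- `π` is an optimal softmax policy for the task `M`: it maximizes `J` over the policy class. -/
def IsOptimal (γ : ℝ) (M : MDP S A rmax) (Θ : Set (EuclideanSpace ℝ (S × A)))
    (π : S → A → ℝ) : Prop :=
  π ∈ policyClass Θ ∧ IsMaxOn (J γ M) (policyClass Θ) π

section Tasks

variable {Γ : Type*} [MeasurableSpace Γ]

/-- The meta-objective `F^{(i)}(φ) = E_τ[J_τ(Alg^{(i)}(π̂_φ, lam, τ))]`. -/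
def metaObjective (i : Order) (γ lam : ℝ) (M : Γ → MDP S A rmax) (μ : Measure Γ)
    (φ : EuclideanSpace ℝ (S × A)) : ℝ :=
  ∫ τ, adaptedReward i γ lam (M τ) φ ∂μ

/-- The task variance: the infimum, over `θ ∈ Θ` and over the (measurable) choices `τ ↦ π*_τ` of
an optimal policy for every task, of `E_τ[D_{τ,i}²(π̂_θ, π*_τ)]`. -/
def taskVariance (i : Order) (γ : ℝ) (M : Γ → MDP S A rmax) (μ : Measure Γ)
    (Θ : Set (EuclideanSpace ℝ (S × A))) : ℝ≥0∞ :=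
  ⨅ θ ∈ Θ, ⨅ πstar ∈ {f : Γ → S → A → ℝ | Measurable f ∧ ∀ τ, IsOptimal γ (M τ) Θ (f τ)},
    ∫⁻ τ, sqDist i γ (M τ) (softmaxPolicy θ) (πstar τ) ∂μ

/-- The meta-parameters produced by the meta-training algorithm from `φ₀` with step size `α`,
when `τs t` is the task sampled at iteration `t`:
`φ_{t+1} = φ_t + α ∇_φ J_{τ_t}(Alg^{(i)}(π̂_{φ_t}, lam, τ_t))`. -/
def metaIterate (i : Order) (γ lam α : ℝ) (M : Γ → MDP S A rmax)
    (φ₀ : EuclideanSpace ℝ (S × A)) (τs : ℕ → Γ) : ℕ → EuclideanSpace ℝ (S × A)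
  | 0 => φ₀
  | t + 1 =>
      metaIterate i γ lam α M φ₀ τs t +
        α • gradient (adaptedReward i γ lam (M (τs t))) (metaIterate i γ lam α M φ₀ τs t)

end Tasks

end MDPDefs

/-- The constant `B_i`. -/
def constB (i : Order) (γ rmax lam : ℝ) : ℝ :=
  match i with
  | .one => 16 * rmax / (lam * (1 - γ) ^ 3) + 24 / (1 - γ) + 12 / lam
  | .two => 16 * rmax / (lam * (1 - γ) ^ 3) + 18 / (1 - γ) ^ 2

/-- The constant `C_i`. -/
def constC (i : Order) (γ : ℝ) : ℝ :=
  match i with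
  | .one => 6 / (1 - γ)
  | .two => 4 / (1 - γ)

/-- The constant `G_i`. -/
def constG (i : Order) (γ Amax : ℝ) : ℝ :=
  match i with
  | .one => 4 * Amax / (1 - γ) ^ 2
  | .two => 2 * Amax / (1 - γ) ^ 2

/-- The constant `K_i`. -/
def constK (i : Order) (γ rmax lam : ℝ) : ℝ :=
  2 * (constB i γ rmax lam + 2 * constC i γ ^ 2) * rmax ^ 2 / (1 - γ) ^ 4

/-- The constant `M_i`. -/
def constM (i : Order) (γ rmax Amax lam : ℝ) : ℝ :=
  (constB i γ rmax lam + 2 * constC i γ ^ 2) * constG i γ Amax * rmax / (1 - γ) ^ 4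

/-- The step size of the meta-training algorithm. -/
def stepSize (i : Order) (γ rmax Amax lam : ℝ) (T : ℕ) : ℝ :=
  min ((rmax * constB i γ rmax lam / (1 - γ) ^ 2
      + 2 * γ * rmax * constC i γ ^ 2 / (1 - γ) ^ 3)⁻¹)
    (1 / (constG i γ Amax * Real.sqrt T))

/-- The regularization weight `λ = 2 A_max / ((1 - γ) ε)`. -/
def regWeight (γ Amax ε : ℝ) : ℝ := 2 * Amax / ((1 - γ) * ε)

end MetaRL

end

/-!
The proof compares the gap of the meta-parameter `φ_t` with the gap of an arbitrary admissible `θ`: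
the excess over the gap of `θ` is a difference of values of the meta-objective `F`, which `h` bounds
through the gradient of `F` at `φ_t`, and the gap of `θ` is bounded by the task variance.

*The gap of `θ`.* The performance difference lemma expresses the return of a policy `π'` through
the advantages of `π = π̂_θ` and the visitation distribution of `π'`. Replacing the latter with the
visitation distribution `ν` of `π` costs a product of two total variation distances. As `ν ≥ ε`, the
supremum over the states is at most `1 / ε` times the `ν`-mean, so by Pinsker's inequality the cost
is at most `γ λ D_i²(π, π')`, for this choice of `λ` (`abs_J_sub_surrogate_le`). Applied to an
optimal policy and to the adapted policy, and combined with the optimality of the latter in the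
within-task problem, this bounds the loss by `(1 + γ) / (1 - γ) * λ * D_i²(π, π*)`
(`J_sub_J_response_le`).

*The gradient of `F`.* The adapted policy is a smooth function of the meta-parameter. For
`KL(· ‖ π)` it is the softmax of `φ + Q / λ`. For `KL(π ‖ ·)` it is `λ π / (η - Q)`, where the
Lagrange multiplier `η` is smooth by the implicit function theorem (`contDiff_multiplier`).
Differentiating twice along lines bounds the first two derivatives of the adapted policy in total
variation (`alg_line_bounds`). The advantage bound makes `Q / λ` nearly constant in the actions,
which keeps the denominators `η - Q` above `λ / 2`. The Bellman equation transports these bounds to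
the return, so the adapted rewards have gradients of norm at most `G_i` and Taylor remainders with
constant `smoothnessConst` (`isSmoothFamily_adaptedReward`). The iterate `φ_t` is independent of
the task `τ_t`, so the stochastic gradients are unbiased, and the ascent inequality telescopes to a
bound for the averaged squared norm of the gradient (`sum_integral_sq_norm_gradient_le`), which for
the given step size is `K_i / T + M_i / √T` (`average_le_of_ascent`).

The concave monotone function `h` lies below an affine function touching it at that rate, and an
affine function commutes with the averages (`exists_affine_majorant`, `average_gap_le`). It remains
to take the infimum over `θ` and over the choices of optimal policies, which all have the same
return.
-/

namespace MetaRL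

set_option linter.unusedSectionVars false

variable {S A : Type*} [Fintype S] [Fintype A] {rmax : ℝ}

/-! ### Discounted Markov decision processes -/

/-- A stationary stochastic policy: an action distribution at every state. -/
def IsPolicy (π : S → A → ℝ) : Prop := ∀ s, π s ∈ stdSimplex ℝ A

lemma IsPolicy.nonneg {π : S → A → ℝ} (hπ : IsPolicy π) (s : S) (a : A) : 0 ≤ π s a := (hπ s).1 a

lemma IsPolicy.sum_eq {π : S → A → ℝ} (hπ : IsPolicy π) (s : S) : ∑ a, π s a = 1 := (hπ s).2

/-- One step of the Markov chain of state-action pairs, acting on their laws. -/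
def stepLaw (M : MDP S A rmax) (π μ : S → A → ℝ) (s' : S) (a' : A) : ℝ :=
  (∑ s, ∑ a, μ s a * M.P s a s') * π s' a'

lemma pairLaw_succ' (M : MDP S A rmax) (π μ : S → A → ℝ) (t : ℕ) :
    pairLaw M π μ (t + 1) = pairLaw M π (stepLaw M π μ) t := by
  induction t with
  | zero => rfl
  | succ t ih => funext s a; rw [pairLaw, ih]; rfl

lemma pairLaw_nonneg (M : MDP S A rmax) {π μ : S → A → ℝ} (hπ : IsPolicy π)
    (hμ : ∀ s a, 0 ≤ μ s a) (t : ℕ) (s : S) (a : A) : 0 ≤ pairLaw M π μ t s a := by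
  induction t generalizing s a with
  | zero => exact hμ s a
  | succ t ih =>
    exact mul_nonneg (Finset.sum_nonneg fun s _ => Finset.sum_nonneg fun a _ =>
      mul_nonneg (ih s a) ((M.P_mem _ _).1 _)) (hπ.nonneg _ _)

lemma sum_stepLaw (M : MDP S A rmax) {π : S → A → ℝ} (hπ : IsPolicy π) (μ : S → A → ℝ) :
    ∑ s, ∑ a, stepLaw M π μ s a = ∑ s, ∑ a, μ s a := by
  simp only [stepLaw, ← Finset.mul_sum, hπ.sum_eq, mul_one]
  rw [Finset.sum_comm]
  refine Finset.sum_congr rfl fun s _ => ?_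
  rw [Finset.sum_comm]
  simp only [← Finset.mul_sum, (M.P_mem _ _).2, mul_one]

lemma sum_pairLaw (M : MDP S A rmax) {π : S → A → ℝ} (hπ : IsPolicy π) (μ : S → A → ℝ) (t : ℕ) :
    ∑ s, ∑ a, pairLaw M π μ t s a = ∑ s, ∑ a, μ s a := by
  induction t with
  | zero => rfl
  | succ t ih => rw [← ih, ← sum_stepLaw M hπ (pairLaw M π μ t)]; rfl

open Classical in
/-- The law concentrated at one state-action pair. -/
noncomputable def pointLaw (s : S) (a : A) : S → A → ℝ :=
  fun s₀ a₀ => if s₀ = s ∧ a₀ = a then 1 else 0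

lemma sum_sum_mul_pointLaw (μ : S → A → ℝ) (s : S) (a : A) :
    ∑ s₀, ∑ a₀, μ s₀ a₀ * pointLaw s₀ a₀ s a = μ s a := by
  classical
  rw [Finset.sum_eq_single s, Finset.sum_eq_single a]
  · simp [pointLaw]
  · intro b _ hb; simp [pointLaw, Ne.symm hb]
  · simp
  · intro b _ hb; simp [pointLaw, Ne.symm hb]
  · simp

lemma sum_pointLaw (s : S) (a : A) : ∑ s₀, ∑ a₀, (pointLaw s a s₀ a₀ : ℝ) = 1 := by
  classical
  rw [Finset.sum_eq_single s, Finset.sum_eq_single a]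
  · simp [pointLaw]
  · intro b _ hb; simp [pointLaw, hb]
  · simp
  · intro b _ hb; simp [pointLaw, hb]
  · simp

lemma pointLaw_nonneg (s s₀ : S) (a a₀ : A) : 0 ≤ pointLaw s a s₀ a₀ := by
  unfold pointLaw; split_ifs <;> norm_num

lemma pairLaw_eq_sum (M : MDP S A rmax) (π μ : S → A → ℝ) (t : ℕ) (s : S) (a : A) :
    pairLaw M π μ t s a = ∑ s₀, ∑ a₀, μ s₀ a₀ * pairLaw M π (pointLaw s₀ a₀) t s a := by
  induction t generalizing s a with
  | zero => simp only [pairLaw, sum_sum_mul_pointLaw]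
  | succ t ih =>
    simp only [pairLaw]
    simp only [ih, Finset.sum_mul, Finset.mul_sum]
    -- both sides are the same sum over `(s₁, a₁, s₀, a₀)`, in a different order
    calc _ = ∑ s₁, ∑ s₀, ∑ a₁, ∑ a₀, μ s₀ a₀ * pairLaw M π (pointLaw s₀ a₀) t s₁ a₁
              * M.P s₁ a₁ s * π s a := by
          exact Finset.sum_congr rfl fun s₁ _ => Finset.sum_comm
      _ = ∑ s₀, ∑ s₁, ∑ a₀, ∑ a₁, μ s₀ a₀ * pairLaw M π (pointLaw s₀ a₀) t s₁ a₁
              * M.P s₁ a₁ s * π s a := by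
          rw [Finset.sum_comm]
          exact Finset.sum_congr rfl fun s₁ _ => Finset.sum_congr rfl fun s₂ _ => Finset.sum_comm
      _ = _ := by
          refine Finset.sum_congr rfl fun s₀ _ => ?_
          rw [Finset.sum_comm]
          refine Finset.sum_congr rfl fun a₀ _ => Finset.sum_congr rfl fun s₁ _ =>
            Finset.sum_congr rfl fun a₁ _ => by ring

/-- The expected immediate reward of a state-action pair. -/
def meanReward (M : MDP S A rmax) (s : S) (a : A) : ℝ := ∑ s', M.P s a s' * M.r s a s'

lemma meanReward_nonneg (M : MDP S A rmax) (s : S) (a : A) : 0 ≤ meanReward M s a :=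
  Finset.sum_nonneg fun _ _ => mul_nonneg ((M.P_mem _ _).1 _) (M.r_nonneg _ _ _)

lemma meanReward_le (M : MDP S A rmax) (s : S) (a : A) : meanReward M s a ≤ rmax := by
  calc meanReward M s a ≤ ∑ s', M.P s a s' * rmax :=
        Finset.sum_le_sum fun _ _ => mul_le_mul_of_nonneg_left (M.r_le _ _ _) ((M.P_mem _ _).1 _)
    _ = rmax := by rw [← Finset.sum_mul, (M.P_mem _ _).2, one_mul]

lemma discountedReturn_eq_tsum (γ : ℝ) (M : MDP S A rmax) (π μ : S → A → ℝ) :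
    discountedReturn γ M π μ =
      ∑' t : ℕ, γ ^ t * ∑ s, ∑ a, pairLaw M π μ t s a * meanReward M s a := by
  simp only [discountedReturn, meanReward, Finset.mul_sum, mul_assoc]

section Bellman

variable {γ : ℝ} (hγ0 : 0 ≤ γ) (hγ1 : γ < 1) (M : MDP S A rmax) {π : S → A → ℝ} (hπ : IsPolicy π)

include hγ0 hγ1

lemma summable_geometric_mul_of_bounded {f : ℕ → ℝ} {C : ℝ} (hf : ∀ t, |f t| ≤ C) :
    Summable fun t => γ ^ t * f t := by
  refine Summable.of_norm_bounded
    ((summable_geometric_of_lt_one hγ0 hγ1).mul_right C) fun t => ?_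
  rw [Real.norm_eq_abs, abs_mul, abs_of_nonneg (pow_nonneg hγ0 t)]
  exact mul_le_mul_of_nonneg_left (hf t) (pow_nonneg hγ0 t)

include hπ

lemma abs_sum_pairLaw_mul_le {μ : S → A → ℝ} (hμ : ∀ s a, 0 ≤ μ s a) {g : S → A → ℝ} {C : ℝ}
    (hg : ∀ s a, |g s a| ≤ C) (t : ℕ) :
    |∑ s, ∑ a, pairLaw M π μ t s a * g s a| ≤ (∑ s, ∑ a, μ s a) * C := by
  rw [← sum_pairLaw M hπ μ t, Finset.sum_mul]
  refine (Finset.abs_sum_le_sum_abs _ _).trans (Finset.sum_le_sum fun s _ => ?_)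
  rw [Finset.sum_mul]
  refine (Finset.abs_sum_le_sum_abs _ _).trans (Finset.sum_le_sum fun a _ => ?_)
  have h := pairLaw_nonneg M hπ hμ t s a
  rw [abs_mul, abs_of_nonneg h]
  exact mul_le_mul_of_nonneg_left (hg s a) h

lemma summable_pairLaw {μ : S → A → ℝ} (hμ : ∀ s a, 0 ≤ μ s a) (g : S → A → ℝ) :
    Summable fun t : ℕ => γ ^ t * ∑ s, ∑ a, pairLaw M π μ t s a * g s a := by
  refine summable_geometric_mul_of_bounded hγ0 hγ1 (abs_sum_pairLaw_mul_le hγ0 hγ1 M hπ hμ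
    (C := ∑ s, ∑ a, |g s a|) fun s a => ?_)
  calc |g s a| ≤ ∑ a, |g s a| :=
        Finset.single_le_sum (f := fun a => |g s a|) (fun _ _ => abs_nonneg _) (Finset.mem_univ a)
    _ ≤ _ := Finset.single_le_sum (f := fun s => ∑ a, |g s a|)
        (fun _ _ => Finset.sum_nonneg fun _ _ => abs_nonneg _) (Finset.mem_univ s)

/-- The return is linear in the initial law. -/
lemma discountedReturn_eq_sum_Q (μ : S → A → ℝ) :
    discountedReturn γ M π μ = ∑ s, ∑ a, μ s a * Q γ M π s a := by
  have hs (s a) := summable_pairLaw hγ0 hγ1 M hπ (pointLaw_nonneg s · a ·) (meanReward M)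
  have key : ∀ t : ℕ, γ ^ t * ∑ s, ∑ a, pairLaw M π μ t s a * meanReward M s a
      = ∑ s₀, ∑ a₀, μ s₀ a₀ *
        (γ ^ t * ∑ s, ∑ a, pairLaw M π (pointLaw s₀ a₀) t s a * meanReward M s a) := by
    intro t
    have : ∑ s, ∑ a, pairLaw M π μ t s a * meanReward M s a = ∑ s₀, ∑ a₀, μ s₀ a₀ *
        (∑ s, ∑ a, pairLaw M π (pointLaw s₀ a₀) t s a * meanReward M s a) := by
      simp only [pairLaw_eq_sum M π μ, Finset.sum_mul, Finset.mul_sum]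
      calc _ = ∑ s₁, ∑ s₀, ∑ a₁, ∑ a₀, μ s₀ a₀ * pairLaw M π (pointLaw s₀ a₀) t s₁ a₁
              * meanReward M s₁ a₁ :=
          Finset.sum_congr rfl fun s₁ _ => Finset.sum_comm
        _ = ∑ s₀, ∑ s₁, ∑ a₀, ∑ a₁, μ s₀ a₀ * pairLaw M π (pointLaw s₀ a₀) t s₁ a₁
              * meanReward M s₁ a₁ := by
          rw [Finset.sum_comm]
          exact Finset.sum_congr rfl fun s₁ _ => Finset.sum_congr rfl fun s₂ _ => Finset.sum_comm
        _ = _ := by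
          refine Finset.sum_congr rfl fun s₀ _ => ?_
          rw [Finset.sum_comm]
          refine Finset.sum_congr rfl fun a₀ _ => Finset.sum_congr rfl fun s₁ _ =>
            Finset.sum_congr rfl fun a₁ _ => by ring
    rw [this, Finset.mul_sum]
    refine Finset.sum_congr rfl fun s₀ _ => ?_
    rw [Finset.mul_sum]
    exact Finset.sum_congr rfl fun a₀ _ => by ring
  rw [discountedReturn_eq_tsum]
  simp only [key]
  rw [Summable.tsum_finsetSum fun s₀ _ => summable_sum fun a₀ _ => (hs s₀ a₀).mul_left _]
  refine Finset.sum_congr rfl fun s₀ _ => ?_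
  rw [Summable.tsum_finsetSum fun a₀ _ => (hs s₀ a₀).mul_left _]
  refine Finset.sum_congr rfl fun a₀ _ => ?_
  rw [tsum_mul_left, Q, discountedReturn_eq_tsum]
  rfl

lemma V_eq_sum_Q (s : S) : V γ M π s = ∑ a, π s a * Q γ M π s a := by
  classical
  rw [V, discountedReturn_eq_sum_Q hγ0 hγ1 M hπ, Finset.sum_eq_single s]
  · simp
  · intro b _ hb; simp [hb]
  · simp

lemma discountedReturn_step {μ : S → A → ℝ} (hμ : ∀ s a, 0 ≤ μ s a) :
    discountedReturn γ M π μ = ∑ s, ∑ a, μ s a * meanReward M s a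
      + γ * discountedReturn γ M π (stepLaw M π μ) := by
  rw [discountedReturn_eq_tsum, (summable_pairLaw hγ0 hγ1 M hπ hμ _).tsum_eq_zero_add,
    discountedReturn_eq_tsum, ← tsum_mul_left]
  simp only [pairLaw_succ', pow_succ', mul_assoc, pow_zero, one_mul]
  rfl

/-- The Bellman equation for `Q`. -/
lemma Q_eq (s : S) (a : A) :
    Q γ M π s a = meanReward M s a + γ * ∑ s', M.P s a s' * V γ M π s' := by
  have h1 : Q γ M π s a = discountedReturn γ M π (pointLaw s a) := rfl
  have h2 : ∀ f : S → A → ℝ, ∑ s₀, ∑ a₀, pointLaw s a s₀ a₀ * f s₀ a₀ = f s a := by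
    intro f
    rw [← sum_sum_mul_pointLaw f s a]
    refine Finset.sum_congr rfl fun s₀ _ => Finset.sum_congr rfl fun a₀ _ => ?_
    have : (s = s₀ ∧ a = a₀) ↔ (s₀ = s ∧ a₀ = a) := by rw [eq_comm, @eq_comm _ a]
    rw [mul_comm]
    congr 1
    unfold pointLaw
    by_cases h : s₀ = s ∧ a₀ = a
    · rw [if_pos h, if_pos (this.2 h)]
    · rw [if_neg h, if_neg (mt this.1 h)]
  rw [h1, discountedReturn_step hγ0 hγ1 M hπ (pointLaw_nonneg s · a ·), h2 (meanReward M),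
    discountedReturn_eq_sum_Q hγ0 hγ1 M hπ]
  congr 2
  refine Finset.sum_congr rfl fun s' _ => ?_
  rw [V_eq_sum_Q hγ0 hγ1 M hπ, Finset.mul_sum]
  refine Finset.sum_congr rfl fun a' _ => ?_
  rw [stepLaw, h2 (fun s a => M.P s a s')]
  ring

lemma Q_nonneg (s : S) (a : A) : 0 ≤ Q γ M π s a := by
  rw [Q, discountedReturn_eq_tsum]
  exact tsum_nonneg fun t => mul_nonneg (pow_nonneg hγ0 t) (Finset.sum_nonneg fun s₀ _ =>
    Finset.sum_nonneg fun a₀ _ => mul_nonneg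
      (pairLaw_nonneg M hπ (pointLaw_nonneg s · a ·) _ _ _) (meanReward_nonneg _ _ _))

lemma Q_le (s : S) (a : A) : Q γ M π s a ≤ rmax / (1 - γ) := by
  have h1 : Q γ M π s a = discountedReturn γ M π (pointLaw s a) := rfl
  rw [h1, discountedReturn_eq_tsum, div_eq_mul_inv, ← tsum_geometric_of_lt_one hγ0 hγ1,
    ← tsum_mul_left]
  refine Summable.tsum_le_tsum (fun t => ?_)
    (summable_pairLaw hγ0 hγ1 M hπ (pointLaw_nonneg s · a ·) _)
    ((summable_geometric_of_lt_one hγ0 hγ1).mul_left _)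
  rw [mul_comm]
  refine mul_le_mul_of_nonneg_right ?_ (pow_nonneg hγ0 t)
  have := abs_sum_pairLaw_mul_le hγ0 hγ1 M hπ (pointLaw_nonneg s · a ·)
    (g := meanReward M) (C := rmax)
    (fun s a => by rw [abs_of_nonneg (meanReward_nonneg _ _ _)]; exact meanReward_le _ _ _) t
  rw [sum_pointLaw, one_mul] at this
  exact (le_abs_self _).trans this

lemma V_nonneg (s : S) : 0 ≤ V γ M π s := by
  rw [V_eq_sum_Q hγ0 hγ1 M hπ]
  exact Finset.sum_nonneg fun a _ => mul_nonneg (hπ.nonneg _ _) (Q_nonneg hγ0 hγ1 M hπ _ _)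

lemma V_le (s : S) : V γ M π s ≤ rmax / (1 - γ) := by
  rw [V_eq_sum_Q hγ0 hγ1 M hπ]
  calc _ ≤ ∑ a, π s a * (rmax / (1 - γ)) := Finset.sum_le_sum fun a _ =>
        mul_le_mul_of_nonneg_left (Q_le hγ0 hγ1 M hπ _ _) (hπ.nonneg _ _)
    _ = _ := by rw [← Finset.sum_mul, hπ.sum_eq, one_mul]

lemma J_nonneg : 0 ≤ J γ M π :=
  Finset.sum_nonneg fun s _ => mul_nonneg (M.ρ_mem.1 s) (V_nonneg hγ0 hγ1 M hπ s)

lemma J_le : J γ M π ≤ rmax / (1 - γ) := by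
  calc _ ≤ ∑ s, M.ρ s * (rmax / (1 - γ)) := Finset.sum_le_sum fun s _ =>
        mul_le_mul_of_nonneg_left (V_le hγ0 hγ1 M hπ _) (M.ρ_mem.1 s)
    _ = _ := by rw [← Finset.sum_mul, M.ρ_mem.2, one_mul]

lemma sum_mul_advantage (s : S) : ∑ a, π s a * advantage γ M π s a = 0 := by
  simp only [advantage, mul_sub, Finset.sum_sub_distrib, ← Finset.sum_mul, hπ.sum_eq,
    V_eq_sum_Q hγ0 hγ1 M hπ, one_mul, sub_self]

/-! ### Visitation distributions -/

lemma visitation_nonneg (s : S) : 0 ≤ visitation γ M π s :=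
  mul_nonneg (by linarith) (tsum_nonneg fun t => mul_nonneg (pow_nonneg hγ0 t)
    (Finset.sum_nonneg fun a _ => pairLaw_nonneg M hπ
      (fun s a => mul_nonneg (M.ρ_mem.1 s) (hπ.nonneg s a)) _ _ _))

lemma summable_visitation (s : S) : Summable fun t : ℕ =>
    γ ^ t * ∑ a, pairLaw M π (fun s₀ a₀ => M.ρ s₀ * π s₀ a₀) t s a := by
  classical
  have := summable_pairLaw hγ0 hγ1 M hπ (μ := fun s₀ a₀ => M.ρ s₀ * π s₀ a₀)
    (fun s a => mul_nonneg (M.ρ_mem.1 s) (hπ.nonneg s a)) (fun s' _ => if s' = s then 1 else 0)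
  refine this.congr fun t => ?_
  congr 1
  rw [Finset.sum_eq_single s]
  · simp
  · intro b _ hb; simp [hb]
  · simp

/-- The discounted visitation distribution is the stationary law of the chain that restarts from
the initial distribution with probability `1 - γ` at every step. -/
lemma visitation_eq (s' : S) : visitation γ M π s' = (1 - γ) * M.ρ s'
    + γ * ∑ s, visitation γ M π s * ∑ a, π s a * M.P s a s' := by
  set μ : S → A → ℝ := fun s₀ a₀ => M.ρ s₀ * π s₀ a₀ with hμ
  have hfac : ∀ t s a, pairLaw M π μ t s a = (∑ a, pairLaw M π μ t s a) * π s a := by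
    intro t s a
    cases t with
    | zero => simp only [pairLaw, hμ, ← Finset.mul_sum, hπ.sum_eq, mul_one]
    | succ t => simp only [pairLaw, ← Finset.mul_sum, hπ.sum_eq, mul_one]
  have hsucc : ∀ t, ∑ a, pairLaw M π μ (t + 1) s' a
      = ∑ s, (∑ a, pairLaw M π μ t s a) * ∑ a, π s a * M.P s a s' := by
    intro t
    rw [pairLaw, ← Finset.mul_sum, hπ.sum_eq, mul_one]
    refine Finset.sum_congr rfl fun s _ => ?_
    rw [Finset.mul_sum]
    refine Finset.sum_congr rfl fun a _ => ?_
    rw [hfac t s a, mul_assoc]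
  have h : (∑' t : ℕ, γ ^ t * ∑ a, pairLaw M π μ t s' a) = _ :=
    (summable_visitation hγ0 hγ1 M hπ s').tsum_eq_zero_add
  simp only [← hμ, hsucc, pow_zero, one_mul] at h
  have h0 : ∑ a, pairLaw M π μ 0 s' a = M.ρ s' := by
    simp only [pairLaw, hμ, ← Finset.mul_sum, hπ.sum_eq, mul_one]
  have hs : ∀ s, Summable fun t : ℕ => γ ^ (t + 1) *
      ((∑ a, pairLaw M π μ t s a) * ∑ a, π s a * M.P s a s') := by
    intro s
    refine (((summable_visitation hγ0 hγ1 M hπ s).mul_right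
      (∑ a, π s a * M.P s a s')).mul_left γ).congr fun t => ?_
    rw [pow_succ']; ring
  rw [visitation, ← hμ, h, h0, mul_add]
  congr 1
  simp only [Finset.mul_sum (s := (Finset.univ : Finset S))]
  rw [Summable.tsum_finsetSum fun s _ => hs s, Finset.mul_sum]
  refine Finset.sum_congr rfl fun s _ => ?_
  have : ∀ t : ℕ, γ ^ (t + 1) * ((∑ a, pairLaw M π μ t s a) * ∑ a, π s a * M.P s a s')
      = (γ * ∑ a, π s a * M.P s a s') * (γ ^ t * ∑ a, pairLaw M π μ t s a) := fun t => by
    rw [pow_succ']; ring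
  rw [tsum_congr this, tsum_mul_left, visitation]
  ring

lemma sum_visitation : ∑ s, visitation γ M π s = 1 := by
  have h : ∑ s', visitation γ M π s' = (1 - γ) + γ * ∑ s, visitation γ M π s := by
    have h1 : ∀ s : S, ∑ s' : S, ∑ a : A, π s a * M.P s a s' = 1 := fun s => by
      rw [Finset.sum_comm]
      simp only [← Finset.mul_sum, (M.P_mem _ _).2, mul_one, hπ.sum_eq]
    calc ∑ s', visitation γ M π s' = ∑ s', ((1 - γ) * M.ρ s'
          + γ * ∑ s, visitation γ M π s * ∑ a, π s a * M.P s a s') :=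
          Finset.sum_congr rfl fun s' _ => visitation_eq hγ0 hγ1 M hπ s'
      _ = _ := by
          rw [Finset.sum_add_distrib, ← Finset.mul_sum, M.ρ_mem.2, mul_one, ← Finset.mul_sum,
            Finset.sum_comm]
          simp only [← Finset.mul_sum, h1, mul_one]
  have : (1 - γ) * (∑ s, visitation γ M π s - 1) = 0 := by linarith
  rcases mul_eq_zero.1 this with h | h <;> linarith

end Bellman

/-! ### Pinsker's inequality -/

/-- The derivative of `x * log x - x + 1 - 3 / 2 * (x - 1) ^ 2 / (x + 2)` is monotone: its own
derivative is `(x - 1) ^ 2 * (x + 8) / (x * (x + 2) ^ 3)`. -/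
lemma monotoneOn_log_add_inv_sq :
    MonotoneOn (fun x : ℝ => Real.log x - 3 / 2 + 27 / 2 * ((x + 2) ^ 2)⁻¹) (Set.Ioi 0) := by
  have hd : ∀ x ∈ Set.Ioi (0 : ℝ), HasDerivAt
      (fun x : ℝ => Real.log x - 3 / 2 + 27 / 2 * ((x + 2) ^ 2)⁻¹)
      (x⁻¹ + 27 / 2 * (-(2 * (x + 2)) / ((x + 2) ^ 2) ^ 2)) x := by
    intro x hx
    have hx : 0 < x := hx
    have h1 : HasDerivAt (fun x : ℝ => (x + 2) ^ 2) (2 * (x + 2)) x := by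
      simpa using! ((hasDerivAt_id x).add_const 2).pow 2
    exact ((Real.hasDerivAt_log hx.ne').sub_const _).add ((h1.inv (by positivity)).const_mul _)
  refine monotoneOn_of_deriv_nonneg (convex_Ioi 0)
    (fun x hx => (hd x hx).continuousAt.continuousWithinAt)
    (fun x hx => ?_) (fun x hx => ?_)
  · rw [interior_Ioi] at hx
    exact (hd x hx).differentiableAt.differentiableWithinAt
  · rw [interior_Ioi] at hx
    rw [(hd x hx).deriv]
    have hx : 0 < x := hx
    have : x⁻¹ + 27 / 2 * (-(2 * (x + 2)) / ((x + 2) ^ 2) ^ 2)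
        = ((x - 1) ^ 2 * (x + 8)) / (x * (x + 2) ^ 3) := by
      field_simp
      ring
    rw [this]
    positivity

/-- The pointwise inequality behind Pinsker's: the difference of the two sides is convex, with its
minimum `0` at `x = 1`. -/
lemma sq_div_le_mul_log_pos {x : ℝ} (hx : 0 < x) :
    3 / 2 * ((x - 1) ^ 2 / (x + 2)) ≤ x * Real.log x - x + 1 := by
  -- `x - 4 + 9 / (x + 2)` is `(x - 1) ^ 2 / (x + 2)`, in a form that is easy to differentiate
  set f : ℝ → ℝ := fun x => x * Real.log x - x + 1 - 3 / 2 * (x - 4 + 9 * (x + 2)⁻¹) with hf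
  have hd : ∀ x ∈ Set.Ioi (0 : ℝ), HasDerivAt f
      (Real.log x - 3 / 2 + 27 / 2 * ((x + 2) ^ 2)⁻¹) x := by
    intro x hx
    have hx : 0 < x := hx
    have h1 : HasDerivAt (fun x : ℝ => (x + 2)⁻¹) (-1 / (x + 2) ^ 2) x :=
      ((hasDerivAt_id x).add_const 2).inv (by positivity)
    have h2 := ((Real.hasDerivAt_mul_log hx.ne').sub (hasDerivAt_id x)).add_const 1
    have h3 := (((hasDerivAt_id x).sub_const 4).add (h1.const_mul 9)).const_mul (3 / 2)
    convert! h2.sub h3 using 1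
    field_simp
    ring
  have hcont : ContinuousOn f (Set.Ioi 0) := fun x hx =>
    (hd x hx).continuousAt.continuousWithinAt
  have hone : Real.log 1 - 3 / 2 + 27 / 2 * (((1 : ℝ) + 2) ^ 2)⁻¹ = 0 := by norm_num
  have hf1 : f 1 = 0 := by simp only [hf]; norm_num
  have key : 0 ≤ f x := by
    rw [← hf1]
    rcases le_total x 1 with h | h
    · have : AntitoneOn f (Set.Icc x 1) := by
        refine antitoneOn_of_deriv_nonpos (convex_Icc _ _)
          (hcont.mono fun y hy => hx.trans_le hy.1) (fun y hy => ?_) (fun y hy => ?_)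
        all_goals
          rw [interior_Icc] at hy
          have hy0 : y ∈ Set.Ioi (0 : ℝ) := hx.trans hy.1
        · exact (hd y hy0).differentiableAt.differentiableWithinAt
        · rw [(hd y hy0).deriv, ← hone]
          exact monotoneOn_log_add_inv_sq hy0 (Set.mem_Ioi.2 one_pos) hy.2.le
      exact this ⟨le_rfl, h⟩ ⟨h, le_rfl⟩ h
    · have : MonotoneOn f (Set.Icc 1 x) := by
        refine monotoneOn_of_deriv_nonneg (convex_Icc _ _)
          (hcont.mono fun y hy => zero_lt_one.trans_le hy.1) (fun y hy => ?_) (fun y hy => ?_)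
        all_goals
          rw [interior_Icc] at hy
          have hy0 : y ∈ Set.Ioi (0 : ℝ) := zero_lt_one.trans hy.1
        · exact (hd y hy0).differentiableAt.differentiableWithinAt
        · rw [(hd y hy0).deriv, ← hone]
          exact monotoneOn_log_add_inv_sq (Set.mem_Ioi.2 one_pos) hy0 hy.1.le
      exact this ⟨le_rfl, h⟩ ⟨h, le_rfl⟩ h
  have : (x - 1) ^ 2 / (x + 2) = x - 4 + 9 * (x + 2)⁻¹ := by field_simp; ring
  rw [this]
  simp only [hf] at key
  linarith

lemma sq_div_le_mul_log_div {p q : ℝ} (hp : 0 ≤ p) (hq : 0 < q) :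
    3 / 2 * ((p - q) ^ 2 / (p + 2 * q)) ≤ p * Real.log (p / q) - p + q := by
  rcases hp.eq_or_lt with rfl | hp
  · have : ((0 : ℝ) - q) ^ 2 / (0 + 2 * q) = q / 2 := by field_simp; ring
    rw [this]; simp; linarith
  · have h := mul_le_mul_of_nonneg_left (sq_div_le_mul_log_pos (div_pos hp hq)) hq.le
    have h1 : q * (3 / 2 * ((p / q - 1) ^ 2 / (p / q + 2)))
        = 3 / 2 * ((p - q) ^ 2 / (p + 2 * q)) := by field_simp
    have h2 : q * (p / q * Real.log (p / q) - p / q + 1) = p * Real.log (p / q) - p + q := by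
      field_simp
    rwa [h1, h2] at h

/-- **Pinsker's inequality** for finite distributions. -/
lemma sq_sum_abs_sub_le {p q : A → ℝ} (hp : p ∈ stdSimplex ℝ A) (hq : q ∈ stdSimplex ℝ A)
    (hac : ∀ a, q a = 0 → p a = 0) :
    (∑ a, |p a - q a|) ^ 2 ≤ 2 * ∑ a, p a * Real.log (p a / q a) := by
  have hpt : ∀ a, 3 / 2 * ((p a - q a) ^ 2 / (p a + 2 * q a))
      ≤ p a * Real.log (p a / q a) - p a + q a := by
    intro a
    rcases (hq.1 a).eq_or_lt with h | h
    · simp [← h, hac a h.symm]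
    · exact sq_div_le_mul_log_div (hp.1 a) h
  have hcs : (∑ a, |p a - q a|) ^ 2
      ≤ (∑ a, (p a - q a) ^ 2 / (p a + 2 * q a)) * ∑ a, (p a + 2 * q a) := by
    refine Finset.sum_sq_le_sum_mul_sum_of_sq_le_mul _ (fun a _ => ?_) (fun a _ => ?_)
      (fun a _ => ?_)
    · have := hp.1 a; have := hq.1 a; positivity
    · have := hp.1 a; have := hq.1 a; positivity
    · refine le_of_eq ?_
      rw [sq_abs]
      rcases (hq.1 a).eq_or_lt with h | h
      · simp [← h, hac a h.symm]
      · have := hp.1 a; field_simp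
  have h3 : ∑ a, (p a + 2 * q a) = 3 := by
    rw [Finset.sum_add_distrib, ← Finset.mul_sum, hp.2, hq.2]; norm_num
  have hsum := Finset.sum_le_sum fun a (_ : a ∈ Finset.univ) => hpt a
  rw [← Finset.mul_sum, Finset.sum_add_distrib, Finset.sum_sub_distrib, hp.2, hq.2] at hsum
  rw [h3] at hcs
  linarith

/-! ### The within-task problem -/

/-- The real-valued Kullback-Leibler divergence, meaningful when `p` is absolutely continuous
with respect to `q`. -/
noncomputable def klReal (p q : A → ℝ) : ℝ := ∑ a, p a * Real.log (p a / q a)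

/-- The real-valued squared distance of two action distributions. -/
noncomputable def sqDistReal (i : Order) (p q : A → ℝ) : ℝ :=
  match i with
  | .one => klReal p q
  | .two => klReal q p

/-- Absolute continuity as needed for `sqDistAction i p q` to be finite. -/
def FiniteDist (i : Order) (p q : A → ℝ) : Prop :=
  match i with
  | .one => ∀ a, q a = 0 → p a = 0
  | .two => ∀ a, p a = 0 → q a = 0

lemma sqDistAction_of_finite {i : Order} {p q : A → ℝ} (h : FiniteDist i p q) :
    sqDistAction i p q = ENNReal.ofReal (sqDistReal i p q) := by
  cases i <;> exact if_pos h

lemma sqDistAction_of_not_finite {i : Order} {p q : A → ℝ} (h : ¬ FiniteDist i p q) :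
    sqDistAction i p q = ⊤ := by
  cases i <;> exact if_neg h

lemma sq_sum_abs_sub_le_sqDistReal {i : Order} {p q : A → ℝ} (hp : p ∈ stdSimplex ℝ A)
    (hq : q ∈ stdSimplex ℝ A) (h : FiniteDist i p q) :
    (∑ a, |q a - p a|) ^ 2 ≤ 2 * sqDistReal i p q := by
  cases i
  · simp only [abs_sub_comm (q _)]; exact sq_sum_abs_sub_le hp hq h
  · exact sq_sum_abs_sub_le hq hp h

lemma sqDistReal_nonneg {i : Order} {p q : A → ℝ} (hp : p ∈ stdSimplex ℝ A)
    (hq : q ∈ stdSimplex ℝ A) (h : FiniteDist i p q) : 0 ≤ sqDistReal i p q := by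
  have := sq_sum_abs_sub_le_sqDistReal hp hq h
  nlinarith [sq_nonneg (∑ a, |q a - p a|)]

/-- The first-order optimality condition of the within-task problem
`max_p ∑ a, p a * q a - lam * d_i²(π, p)` over the simplex. -/
def IsResponse (i : Order) (lam : ℝ) (π q p : A → ℝ) : Prop :=
  p ∈ stdSimplex ℝ A ∧ (∀ a, 0 < p a) ∧
    match i with
    | .one => ∃ η, ∀ a, p a * (η - q a) = lam * π a
    | .two => ∃ c, ∀ a, q a = c + lam * Real.log (p a / π a)

lemma IsResponse.finiteDist {i : Order} {lam : ℝ} {π q p : A → ℝ} (hp : IsResponse i lam π q p)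
    (hπ : ∀ a, 0 < π a) : FiniteDist i π p := by
  cases i
  · exact fun a h => absurd h (hp.2.1 a).ne'
  · exact fun a h => absurd h (hπ a).ne'

/-- A solution of the first-order condition is the strict maximizer of the within-task problem. -/
lemma IsResponse.lt {i : Order} {lam : ℝ} {π q p p' : A → ℝ} (hlam : 0 < lam)
    (hπ : ∀ a, 0 < π a) (hp : IsResponse i lam π q p) (hp' : p' ∈ stdSimplex ℝ A)
    (hfin : FiniteDist i π p') (hne : p' ≠ p) :
    ∑ a, p' a * q a - lam * sqDistReal i π p' < ∑ a, p a * q a - lam * sqDistReal i π p := by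
  obtain ⟨hs, hpos, hopt⟩ := hp
  obtain ⟨a₀, ha₀⟩ : ∃ a, p' a ≠ p a := by
    by_contra! h; exact hne (funext h)
  cases i
  · obtain ⟨η, hη⟩ := hopt
    have hp'pos : ∀ a, 0 < p' a := fun a =>
      lt_of_le_of_ne (hp'.1 a) fun h => (hπ a).ne' (hfin a h.symm)
    -- concavity of the logarithm, with the gradient rewritten through the first-order condition
    have hlt : ∑ a, lam * (π a * (Real.log (p' a) - Real.log (p a)))
        < ∑ a, (η - q a) * (p' a - p a) := by
      have hpt : ∀ a, (η - q a) * (p' a - p a) = lam * (π a * (p' a / p a - 1)) := fun a => by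
        rw [← mul_assoc, ← hη a]; have := hpos a; field_simp
      have hpt2 : ∀ a, Real.log (p' a) - Real.log (p a) = Real.log (p' a / p a) := fun a =>
        (Real.log_div (hp'pos a).ne' (hpos a).ne').symm
      simp only [hpt, hpt2]
      refine Finset.sum_lt_sum (fun a _ => ?_) ⟨a₀, Finset.mem_univ _, ?_⟩
      · gcongr
        · exact (hπ a).le
        · exact Real.log_le_sub_one_of_pos (div_pos (hp'pos a) (hpos a))
      · have := hπ a₀
        gcongr
        refine Real.log_lt_sub_one_of_pos (div_pos (hp'pos a₀) (hpos a₀)) ?_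
        rw [Ne, div_eq_one_iff_eq (hpos a₀).ne']
        exact ha₀
    have h1 : ∑ a, (η - q a) * (p' a - p a) = ∑ a, p a * q a - ∑ a, p' a * q a := by
      have : ∀ a, (η - q a) * (p' a - p a) = η * p' a - η * p a + (p a * q a - p' a * q a) :=
        fun a => by ring
      simp only [this, Finset.sum_add_distrib, Finset.sum_sub_distrib, ← Finset.mul_sum, hs.2,
        hp'.2]
      ring
    have h2 : ∑ a, lam * (π a * (Real.log (p' a) - Real.log (p a)))
        = lam * klReal π p - lam * klReal π p' := by
      simp only [klReal, Finset.mul_sum, ← Finset.sum_sub_distrib]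
      refine Finset.sum_congr rfl fun a _ => ?_
      rw [Real.log_div (hπ a).ne' (hpos a).ne', Real.log_div (hπ a).ne' (hp'pos a).ne']
      ring
    simp only [sqDistReal]
    linarith
  · obtain ⟨c, hc⟩ := hopt
    -- up to a constant, the objective is `- lam * KL(r ‖ p)`
    have hval : ∀ r : A → ℝ, r ∈ stdSimplex ℝ A →
        ∑ a, r a * q a - lam * klReal r π = c - lam * klReal r p := by
      intro r hr
      have hpt : ∀ a, r a * q a = c * r a + lam * (r a * Real.log (r a / π a))
          - lam * (r a * Real.log (r a / p a)) := by
        intro a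
        rcases (hr.1 a).eq_or_lt with h | h
        · simp [← h]
        · rw [hc a, Real.log_div h.ne' (hπ a).ne', Real.log_div h.ne' (hpos a).ne',
            Real.log_div (hpos a).ne' (hπ a).ne']
          ring
      simp only [klReal]
      rw [Finset.sum_congr rfl fun a _ => hpt a, Finset.sum_sub_distrib, Finset.sum_add_distrib,
        ← Finset.mul_sum, ← Finset.mul_sum, ← Finset.mul_sum, hr.2]
      ring
    simp only [sqDistReal]
    rw [hval _ hp', hval _ hs]
    have h0 : klReal p p = 0 := by
      refine Finset.sum_eq_zero fun a _ => ?_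
      rw [div_self (hpos a).ne', Real.log_one, mul_zero]
    have hpin : (∑ a, |p' a - p a|) ^ 2 ≤ 2 * klReal p' p :=
      sq_sum_abs_sub_le hp' hs fun a h => absurd h (hpos a).ne'
    have hpos' : 0 < ∑ a, |p' a - p a| :=
      Finset.sum_pos' (fun _ _ => abs_nonneg _)
        ⟨a₀, Finset.mem_univ _, abs_pos.2 (sub_ne_zero.2 ha₀)⟩
    have : 0 < klReal p' p := by nlinarith
    rw [h0]
    nlinarith

lemma IsResponse.le {i : Order} {lam : ℝ} {π q p p' : A → ℝ} (hlam : 0 < lam)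
    (hπ : ∀ a, 0 < π a) (hp : IsResponse i lam π q p) (hp' : p' ∈ stdSimplex ℝ A)
    (hfin : FiniteDist i π p') :
    ∑ a, p' a * q a - lam * sqDistReal i π p' ≤ ∑ a, p a * q a - lam * sqDistReal i π p := by
  rcases eq_or_ne p' p with rfl | hne
  · exact le_rfl
  · exact (hp.lt hlam hπ hp' hfin hne).le

lemma withinTaskObjective_of_finite {i : Order} {γ lam : ℝ} {M : MDP S A rmax}
    {π : S → A → ℝ} {s : S} {p : A → ℝ} (hπ : π s ∈ stdSimplex ℝ A) (hp : p ∈ stdSimplex ℝ A)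
    (hfin : FiniteDist i (π s) p) :
    withinTaskObjective i γ lam M π s p
      = ((∑ a, p a * Q γ M π s a - lam * sqDistReal i (π s) p : ℝ) : EReal) := by
  rw [withinTaskObjective, sqDistAction_of_finite hfin, EReal.coe_ennreal_ofReal,
    max_eq_left (sqDistReal_nonneg hπ hp hfin)]
  norm_cast

lemma withinTaskObjective_of_not_finite {i : Order} {γ lam : ℝ} (hlam : 0 < lam)
    {M : MDP S A rmax} {π : S → A → ℝ} {s : S} {p : A → ℝ} (hfin : ¬ FiniteDist i (π s) p) :
    withinTaskObjective i γ lam M π s p = ⊥ := by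
  rw [withinTaskObjective, sqDistAction_of_not_finite hfin, EReal.coe_ennreal_top,
    EReal.coe_mul_top_of_pos hlam, EReal.sub_top]

/-- The within-task algorithm is characterized by the first-order optimality condition. -/
lemma alg_eq_of_isResponse {i : Order} {γ lam : ℝ} (hlam : 0 < lam) {M : MDP S A rmax}
    {π : S → A → ℝ} {s : S} {p : A → ℝ} (hπ : π s ∈ stdSimplex ℝ A) (hpos : ∀ a, 0 < π s a)
    (hp : IsResponse i lam (π s) (Q γ M π s) p) : alg i γ lam M π s = p := by
  have hfin := hp.finiteDist hpos
  have hlt : ∀ p' ∈ stdSimplex ℝ A, p' ≠ p →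
      withinTaskObjective i γ lam M π s p' < withinTaskObjective i γ lam M π s p := by
    intro p' hp' hne
    rw [withinTaskObjective_of_finite hπ hp.1 hfin]
    by_cases hf : FiniteDist i (π s) p'
    · rw [withinTaskObjective_of_finite hπ hp' hf, EReal.coe_lt_coe_iff]
      exact hp.lt hlam hpos hp' hf hne
    · rw [withinTaskObjective_of_not_finite hlam hf]
      exact EReal.bot_lt_coe _
  have hex : ∃ p' : A → ℝ, p' ∈ stdSimplex ℝ A ∧
      IsMaxOn (withinTaskObjective i γ lam M π s) (stdSimplex ℝ A) p' := by
    refine ⟨p, hp.1, fun p' hp' => ?_⟩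
    rcases eq_or_ne p' p with rfl | hne
    · exact le_refl (withinTaskObjective i γ lam M π s p')
    · exact (hlt p' hp' hne).le
  obtain ⟨h1, h2⟩ := Classical.epsilon_spec hex
  by_contra hne
  exact absurd (h2 hp.1) (not_le.2 (hlt _ h1 hne))

/-! ### Comparison of returns -/

section Comparison

variable {γ : ℝ} (hγ0 : 0 ≤ γ) (hγ1 : γ < 1) (M : MDP S A rmax) {π π' : S → A → ℝ}
  (hπ : IsPolicy π) (hπ' : IsPolicy π')

include hγ0 hγ1 hπ hπ'

/-- The performance difference lemma. -/
lemma J_sub_J : (1 - γ) * (J γ M π' - J γ M π)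
    = ∑ s, visitation γ M π' s * ∑ a, π' s a * advantage γ M π s a := by
  set Δ : S → ℝ := fun s => V γ M π' s - V γ M π s with hΔ
  have hrec : ∀ s, Δ s = ∑ a, π' s a * advantage γ M π s a
      + γ * ∑ s', (∑ a, π' s a * M.P s a s') * Δ s' := by
    intro s
    have h1 : γ * ∑ s', (∑ a, π' s a * M.P s a s') * Δ s'
        = ∑ a, π' s a * (Q γ M π' s a - Q γ M π s a) := by
      simp only [Q_eq hγ0 hγ1 M hπ, Q_eq hγ0 hγ1 M hπ', hΔ, Finset.sum_mul]
      rw [Finset.sum_comm, Finset.mul_sum]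
      refine Finset.sum_congr rfl fun a _ => ?_
      rw [add_sub_add_left_eq_sub, ← mul_sub, ← Finset.sum_sub_distrib, mul_left_comm,
        Finset.mul_sum (a := π' s a)]
      congr 1
      exact Finset.sum_congr rfl fun s' _ => by ring
    rw [h1]
    simp only [advantage, mul_sub, Finset.sum_sub_distrib, ← Finset.sum_mul, hπ'.sum_eq, one_mul]
    rw [← V_eq_sum_Q hγ0 hγ1 M hπ']
    simp only [hΔ]
    ring
  have h1 : ∑ s, visitation γ M π' s * Δ s = (1 - γ) * ∑ s, M.ρ s * Δ s
      + γ * ∑ s, visitation γ M π' s * ∑ s', (∑ a, π' s a * M.P s a s') * Δ s' := by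
    calc ∑ s', visitation γ M π' s' * Δ s' = ∑ s', ((1 - γ) * M.ρ s'
          + γ * ∑ s, visitation γ M π' s * ∑ a, π' s a * M.P s a s') * Δ s' :=
          Finset.sum_congr rfl fun s' _ => by rw [← visitation_eq hγ0 hγ1 M hπ']
      _ = _ := by
          simp only [add_mul, Finset.sum_add_distrib, mul_assoc, ← Finset.mul_sum, Finset.sum_mul]
          congr 2
          rw [Finset.sum_comm]
          refine Finset.sum_congr rfl fun s _ => ?_
          rw [Finset.mul_sum]
  have h2 : ∑ s, visitation γ M π' s * Δ s
      = ∑ s, visitation γ M π' s * ∑ a, π' s a * advantage γ M π s a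
      + γ * ∑ s, visitation γ M π' s * ∑ s', (∑ a, π' s a * M.P s a s') * Δ s' := by
    rw [Finset.mul_sum, ← Finset.sum_add_distrib]
    refine Finset.sum_congr rfl fun s _ => ?_
    conv_lhs => rw [hrec s]
    ring
  have h3 : J γ M π' - J γ M π = ∑ s, M.ρ s * Δ s := by
    simp only [J, hΔ, mul_sub, Finset.sum_sub_distrib]
  rw [h3]
  linarith

/-- The visitation distribution depends on the policy in a Lipschitz way. -/
lemma sum_abs_visitation_sub_le : (1 - γ) * ∑ s, |visitation γ M π' s - visitation γ M π s|
    ≤ γ * ∑ s, visitation γ M π s * ∑ a, |π' s a - π s a| := by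
  have hdiff : ∀ s', visitation γ M π' s' - visitation γ M π s'
      = γ * ∑ s, ∑ a, ((visitation γ M π' s - visitation γ M π s) * (π' s a * M.P s a s')
        + visitation γ M π s * ((π' s a - π s a) * M.P s a s')) := by
    intro s'
    rw [visitation_eq hγ0 hγ1 M hπ, visitation_eq hγ0 hγ1 M hπ', add_sub_add_left_eq_sub,
      ← mul_sub, ← Finset.sum_sub_distrib]
    congr 1
    refine Finset.sum_congr rfl fun s _ => ?_
    rw [Finset.mul_sum, Finset.mul_sum, ← Finset.sum_sub_distrib]
    exact Finset.sum_congr rfl fun a _ => by ring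
  have hle : ∀ s', |visitation γ M π' s' - visitation γ M π s'|
      ≤ γ * ∑ s, ∑ a, (|visitation γ M π' s - visitation γ M π s| * (π' s a * M.P s a s')
        + visitation γ M π s * (|π' s a - π s a| * M.P s a s')) := by
    intro s'
    rw [hdiff, abs_mul, abs_of_nonneg hγ0]
    refine mul_le_mul_of_nonneg_left ?_ hγ0
    refine (Finset.abs_sum_le_sum_abs _ _).trans (Finset.sum_le_sum fun s _ => ?_)
    refine (Finset.abs_sum_le_sum_abs _ _).trans (Finset.sum_le_sum fun a _ => ?_)
    refine (abs_add_le _ _).trans (le_of_eq ?_)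
    have hPn := (M.P_mem s a).1 s'
    rw [abs_mul, abs_mul (visitation γ M π s), abs_mul (π' s a - π s a),
      abs_of_nonneg (mul_nonneg (hπ'.nonneg s a) hPn), abs_of_nonneg hPn,
      abs_of_nonneg (visitation_nonneg hγ0 hγ1 M hπ s)]
  have hsum := Finset.sum_le_sum fun s' (_ : s' ∈ Finset.univ) => hle s'
  have hcol : ∑ s', γ * ∑ s, ∑ a,
        (|visitation γ M π' s - visitation γ M π s| * (π' s a * M.P s a s')
        + visitation γ M π s * (|π' s a - π s a| * M.P s a s'))
      = γ * ∑ s, |visitation γ M π' s - visitation γ M π s|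
        + γ * ∑ s, visitation γ M π s * ∑ a, |π' s a - π s a| := by
    rw [← Finset.mul_sum, Finset.sum_comm, ← mul_add, ← Finset.sum_add_distrib]
    congr 1
    refine Finset.sum_congr rfl fun s _ => ?_
    rw [Finset.sum_comm]
    simp only [Finset.sum_add_distrib, ← Finset.mul_sum, (M.P_mem _ _).2, mul_one, hπ'.sum_eq]
  rw [hcol] at hsum
  linarith

/-- The return of `π'` differs from its first-order surrogate at `π` by at most the expected
squared distance. The visitation bound `ε` turns the supremum over the states into an expectation,
and Pinsker's inequality is the hypothesis `hK`. -/
lemma abs_J_sub_surrogate_le {Amax ε : ℝ} (hε : 0 < ε)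
    (hadv : ∀ s a, |advantage γ M π s a| ≤ Amax) (hAmax : 0 ≤ Amax)
    (hvisit : ∀ s, ε ≤ visitation γ M π s) {K : S → ℝ}
    (hK : ∀ s, (∑ a, |π' s a - π s a|) ^ 2 ≤ 2 * K s) :
    |(1 - γ) * (J γ M π' - J γ M π)
        - ∑ s, visitation γ M π s * ∑ a, π' s a * advantage γ M π s a|
      ≤ γ * regWeight γ Amax ε * ∑ s, visitation γ M π s * K s := by
  set ν := visitation γ M π with hν
  set d : S → ℝ := fun s => ∑ a, |π' s a - π s a| with hd
  have hd0 : ∀ s, 0 ≤ d s := fun s => Finset.sum_nonneg fun _ _ => abs_nonneg _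
  have hν0 : ∀ s, 0 ≤ ν s := visitation_nonneg hγ0 hγ1 M hπ
  have hν1 : ∑ s, ν s = 1 := sum_visitation hγ0 hγ1 M hπ
  have h1γ : 0 < 1 - γ := by linarith
  set D := ∑ s, ν s * d s with hD
  have hD0 : 0 ≤ D := Finset.sum_nonneg fun s _ => mul_nonneg (hν0 s) (hd0 s)
  have hsup : ∀ s, d s ≤ D / ε := by
    intro s
    rw [le_div_iff₀ hε]
    calc d s * ε ≤ ν s * d s := by
          rw [mul_comm]; exact mul_le_mul_of_nonneg_right (hvisit s) (hd0 s)
      _ ≤ D := Finset.single_le_sum (f := fun s => ν s * d s)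
          (fun s _ => mul_nonneg (hν0 s) (hd0 s)) (Finset.mem_univ s)
  have hδ : ∀ s, |∑ a, π' s a * advantage γ M π s a| ≤ Amax * (D / ε) := by
    intro s
    have : ∑ a, π' s a * advantage γ M π s a = ∑ a, (π' s a - π s a) * advantage γ M π s a := by
      simp only [sub_mul, Finset.sum_sub_distrib, sum_mul_advantage hγ0 hγ1 M hπ, sub_zero]
    rw [this]
    calc _ ≤ ∑ a, |π' s a - π s a| * Amax :=
          (Finset.abs_sum_le_sum_abs _ _).trans (Finset.sum_le_sum fun a _ => by
            rw [abs_mul]; exact mul_le_mul_of_nonneg_left (hadv s a) (abs_nonneg _))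
      _ = Amax * d s := by rw [← Finset.sum_mul, mul_comm]
      _ ≤ _ := mul_le_mul_of_nonneg_left (hsup s) hAmax
  have hJen : D ^ 2 ≤ ∑ s, ν s * d s ^ 2 := by
    have := Finset.sum_sq_le_sum_mul_sum_of_sq_le_mul Finset.univ (r := fun s => ν s * d s)
      (f := ν) (g := fun s => ν s * d s ^ 2) (fun s _ => hν0 s)
      (fun s _ => mul_nonneg (hν0 s) (sq_nonneg _)) (fun s _ => le_of_eq (by ring))
    rwa [hν1, one_mul] at this
  have hDK : D ^ 2 ≤ 2 * ∑ s, ν s * K s := by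
    refine hJen.trans ?_
    rw [Finset.mul_sum]
    refine Finset.sum_le_sum fun s _ => ?_
    nlinarith [mul_le_mul_of_nonneg_left (hK s) (hν0 s)]
  rw [J_sub_J hγ0 hγ1 M hπ hπ', ← Finset.sum_sub_distrib]
  have hν' := sum_abs_visitation_sub_le hγ0 hγ1 M hπ hπ'
  calc |∑ s, (visitation γ M π' s * ∑ a, π' s a * advantage γ M π s a
          - ν s * ∑ a, π' s a * advantage γ M π s a)|
      ≤ ∑ s, |visitation γ M π' s - ν s| * (Amax * (D / ε)) := by
        refine (Finset.abs_sum_le_sum_abs _ _).trans (Finset.sum_le_sum fun s _ => ?_)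
        rw [← sub_mul, abs_mul]
        exact mul_le_mul_of_nonneg_left (hδ s) (abs_nonneg _)
    _ = (∑ s, |visitation γ M π' s - ν s|) * (Amax * (D / ε)) := by rw [Finset.sum_mul]
    _ ≤ (γ * D / (1 - γ)) * (Amax * (D / ε)) := by
        refine mul_le_mul_of_nonneg_right ?_ (by positivity)
        rw [le_div_iff₀ h1γ, mul_comm]
        exact hν'
    _ = γ * (Amax / ((1 - γ) * ε)) * D ^ 2 := by field_simp
    _ ≤ γ * (Amax / ((1 - γ) * ε)) * (2 * ∑ s, ν s * K s) :=
        mul_le_mul_of_nonneg_left hDK (by positivity)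
    _ = _ := by rw [regWeight]; ring

end Comparison

/-- One within-task adaptation loses at most a multiple of the squared distance between the
meta-policy `π` and the comparison policy `π'`: the two surrogate errors cost `γ` times the squared
distances of `π'` and of the adapted policy `p`, and the within-task objective trades the latter
against the former. -/
lemma J_sub_J_response_le {γ : ℝ} (hγ0 : 0 ≤ γ) (hγ1 : γ < 1) (M : MDP S A rmax)
    {π π' p : S → A → ℝ} (hπ : IsPolicy π) (hpos : ∀ s a, 0 < π s a) (hπ' : IsPolicy π')
    {Amax ε : ℝ} (hε : 0 < ε) (hAmax : 0 < Amax)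
    (hadv : ∀ s a, |advantage γ M π s a| ≤ Amax)
    (hvisit : ∀ s, ε ≤ visitation γ M π s) {i : Order}
    (hp : ∀ s, IsResponse i (regWeight γ Amax ε) (π s) (Q γ M π s) (p s))
    (hfin : ∀ s, FiniteDist i (π s) (π' s)) :
    J γ M π' - J γ M p ≤ (1 + γ) / (1 - γ) * regWeight γ Amax ε
      * ∑ s, visitation γ M π s * sqDistReal i (π s) (π' s) := by
  have h1γ : 0 < 1 - γ := by linarith
  have hlam : 0 < regWeight γ Amax ε := by unfold regWeight; positivity
  set lam := regWeight γ Amax ε with hlamdef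
  set ν := visitation γ M π
  have hν0 : ∀ s, 0 ≤ ν s := visitation_nonneg hγ0 hγ1 M hπ
  have hpP : IsPolicy p := fun s => (hp s).1
  have hfinp : ∀ s, FiniteDist i (π s) (p s) := fun s => (hp s).finiteDist (hpos s)
  have e1 := abs_J_sub_surrogate_le hγ0 hγ1 M hπ hπ' hε hadv hAmax.le hvisit
    fun s => sq_sum_abs_sub_le_sqDistReal (hπ s) (hπ' s) (hfin s)
  have e2 := abs_J_sub_surrogate_le hγ0 hγ1 M hπ hpP hε hadv hAmax.le hvisit
    fun s => sq_sum_abs_sub_le_sqDistReal (hπ s) (hpP s) (hfinp s)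
  have e3 : ∑ s, ν s * ∑ a, π' s a * advantage γ M π s a
        - lam * ∑ s, ν s * sqDistReal i (π s) (π' s)
      ≤ ∑ s, ν s * ∑ a, p s a * advantage γ M π s a
        - lam * ∑ s, ν s * sqDistReal i (π s) (p s) := by
    rw [Finset.mul_sum, Finset.mul_sum, ← Finset.sum_sub_distrib, ← Finset.sum_sub_distrib]
    refine Finset.sum_le_sum fun s _ => ?_
    have h := (hp s).le hlam (hpos s) (hπ' s) (hfin s)
    have hA : ∀ r : S → A → ℝ, IsPolicy r → ∑ a, r s a * advantage γ M π s a
        = ∑ a, r s a * Q γ M π s a - V γ M π s := by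
      intro r hr
      simp only [advantage, mul_sub, Finset.sum_sub_distrib, ← Finset.sum_mul, hr.sum_eq, one_mul]
    rw [hA _ hπ', hA _ hpP]
    nlinarith [mul_le_mul_of_nonneg_left h (hν0 s)]
  have e4 : 0 ≤ ∑ s, ν s * sqDistReal i (π s) (p s) :=
    Finset.sum_nonneg fun s _ => mul_nonneg (hν0 s) (sqDistReal_nonneg (hπ s) (hpP s) (hfinp s))
  have e5 : γ * lam * ∑ s, ν s * sqDistReal i (π s) (p s)
      ≤ lam * ∑ s, ν s * sqDistReal i (π s) (p s) := by
    rw [mul_assoc]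
    exact mul_le_of_le_one_left (by positivity) hγ1.le
  have h1 := (abs_le.1 e1).2
  have h2 := (abs_le.1 e2).1
  rw [← hlamdef] at h1 h2
  have key : (1 - γ) * (J γ M π' - J γ M p)
      ≤ (1 + γ) * lam * ∑ s, ν s * sqDistReal i (π s) (π' s) := by linarith
  rw [div_mul_eq_mul_div, div_mul_eq_mul_div, le_div_iff₀ h1γ]
  linarith

/-! ### The adapted policy as a smooth function -/

/-- The softmax of a vector of logits. -/
noncomputable def softmaxVec (z : A → ℝ) (a : A) : ℝ := Real.exp (z a) / ∑ a', Real.exp (z a')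

section Response

variable [Nonempty A]

lemma sum_exp_pos (z : A → ℝ) : 0 < ∑ a, Real.exp (z a) :=
  Finset.sum_pos (fun _ _ => Real.exp_pos _) Finset.univ_nonempty

lemma softmaxVec_pos (z : A → ℝ) (a : A) : 0 < softmaxVec z a :=
  div_pos (Real.exp_pos _) (sum_exp_pos z)

lemma softmaxVec_mem (z : A → ℝ) : softmaxVec z ∈ stdSimplex ℝ A := by
  refine ⟨fun a => (softmaxVec_pos z a).le, ?_⟩
  simp only [softmaxVec, ← Finset.sum_div]
  exact div_self (sum_exp_pos z).ne'

lemma contDiff_softmaxVec {n : WithTop ℕ∞} (a : A) :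
    ContDiff ℝ n fun z : A → ℝ => softmaxVec z a := by
  unfold softmaxVec
  refine ContDiff.div (by fun_prop) (by fun_prop) fun z => (sum_exp_pos z).ne'

lemma isPolicy_softmaxPolicy (θ : EuclideanSpace ℝ (S × A)) : IsPolicy (softmaxPolicy θ) :=
  fun s => softmaxVec_mem fun a => θ (s, a)

lemma softmaxPolicy_pos (θ : EuclideanSpace ℝ (S × A)) (s : S) (a : A) : 0 < softmaxPolicy θ s a :=
  softmaxVec_pos (fun a => θ (s, a)) a

/-- Every positive policy is a softmax policy. -/
lemma exists_softmaxPolicy_eq {p : S → A → ℝ} (hp : IsPolicy p) (hpos : ∀ s a, 0 < p s a) :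
    ∃ θ : EuclideanSpace ℝ (S × A), softmaxPolicy θ = p := by
  refine ⟨WithLp.toLp 2 fun x => Real.log (p x.1 x.2), ?_⟩
  funext s a
  simp only [softmaxPolicy, Real.exp_log (hpos _ _), hp.sum_eq, div_one]

/-- `η` is the Lagrange multiplier of the constraint `∑ a, p a = 1` in the within-task problem for
`KL(π ‖ ·)`, with `π` the softmax of `z`: its solution is `p a = lam * π a / (η - q a)`. -/
def IsMultiplier (lam : ℝ) (z q : A → ℝ) (η : ℝ) : Prop :=
  (∀ a, q a < η) ∧ ∑ a, lam * softmaxVec z a / (η - q a) = 1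

/-- The total mass `∑ a, lam * π a / (η - q a)` is at least one at `η = max q + lam * π a₀`, where
`a₀` maximizes `q`, and at most one at `η = max q + lam`. -/
lemma exists_isMultiplier {lam : ℝ} (hlam : 0 < lam) (z q : A → ℝ) :
    ∃ η, IsMultiplier lam z q η := by
  obtain ⟨a₀, ha₀⟩ := Finite.exists_max q
  have hpos := softmaxVec_pos z
  have hle1 : softmaxVec z a₀ ≤ 1 := by
    rw [← (softmaxVec_mem z).2]
    exact Finset.single_le_sum (fun a _ => (hpos a).le) (Finset.mem_univ a₀)
  have hlt : ∀ η, q a₀ + lam * softmaxVec z a₀ ≤ η → ∀ a, q a < η := fun η hη a =>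
    lt_of_lt_of_le (lt_of_le_of_lt (ha₀ a) (lt_add_of_pos_right _ (mul_pos hlam (hpos a₀)))) hη
  have hab : q a₀ + lam * softmaxVec z a₀ ≤ q a₀ + lam := by
    have := mul_le_mul_of_nonneg_left hle1 hlam.le
    linarith
  have hcont : ContinuousOn (fun η => ∑ a, lam * softmaxVec z a / (η - q a))
      (Set.Icc (q a₀ + lam * softmaxVec z a₀) (q a₀ + lam)) := by
    refine continuousOn_finsetSum _ fun a _ => ContinuousOn.div (by fun_prop) (by fun_prop) ?_
    intro η hη
    exact (sub_pos.2 (hlt η hη.1 a)).ne'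
  have hleft : 1 ≤ ∑ a, lam * softmaxVec z a / (q a₀ + lam * softmaxVec z a₀ - q a) := by
    have h1 : lam * softmaxVec z a₀ / (q a₀ + lam * softmaxVec z a₀ - q a₀) = 1 := by
      rw [add_sub_cancel_left]; exact div_self (mul_pos hlam (hpos a₀)).ne'
    rw [← h1]
    exact Finset.single_le_sum
      (f := fun a => lam * softmaxVec z a / (q a₀ + lam * softmaxVec z a₀ - q a))
      (fun a _ => div_nonneg (mul_pos hlam (hpos a)).le (sub_pos.2 (hlt _ le_rfl a)).le)
      (Finset.mem_univ a₀)
  have hright : ∑ a, lam * softmaxVec z a / (q a₀ + lam - q a) ≤ 1 := by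
    rw [← (softmaxVec_mem z).2]
    refine Finset.sum_le_sum fun a _ => ?_
    rw [div_le_iff₀ (sub_pos.2 (hlt _ hab a))]
    nlinarith [ha₀ a, hpos a]
  obtain ⟨η, hη, h⟩ := intermediate_value_Icc' hab hcont ⟨hright, hleft⟩
  exact ⟨η, hlt η hη.1, h⟩

lemma IsMultiplier.not_lt {lam : ℝ} (hlam : 0 < lam) {z q : A → ℝ} {η η' : ℝ}
    (h : IsMultiplier lam z q η) (h' : IsMultiplier lam z q η') : ¬ η < η' := by
  intro hlt
  have : ∑ a, lam * softmaxVec z a / (η' - q a) < ∑ a, lam * softmaxVec z a / (η - q a) :=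
    Finset.sum_lt_sum_of_nonempty Finset.univ_nonempty fun a _ =>
      div_lt_div_of_pos_left (mul_pos hlam (softmaxVec_pos z a)) (sub_pos.2 (h.1 a)) (by linarith)
  rw [h.2, h'.2] at this
  exact lt_irrefl _ this

lemma IsMultiplier.unique {lam : ℝ} (hlam : 0 < lam) {z q : A → ℝ} {η η' : ℝ}
    (h : IsMultiplier lam z q η) (h' : IsMultiplier lam z q η') : η = η' :=
  le_antisymm (_root_.not_lt.1 (h'.not_lt hlam h)) (_root_.not_lt.1 (h.not_lt hlam h'))

/-- The Lagrange multiplier of the within-task problem for `KL(π ‖ ·)`, as a function of the logits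
`x.1` of `π` and of the action values `x.2`. For `lam > 0` it exists and is unique. -/
noncomputable def multiplier (lam : ℝ) (x : (A → ℝ) × (A → ℝ)) : ℝ :=
  Classical.epsilon (IsMultiplier lam x.1 x.2)

lemma multiplier_spec {lam : ℝ} (hlam : 0 < lam) (x : (A → ℝ) × (A → ℝ)) :
    IsMultiplier lam x.1 x.2 (multiplier lam x) :=
  Classical.epsilon_spec (exists_isMultiplier hlam x.1 x.2)

lemma isInvertible_of_apply_one_ne_zero {L : ℝ →L[ℝ] ℝ} (h : L 1 ≠ 0) : L.IsInvertible := by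
  refine ⟨ContinuousLinearEquiv.equivOfInverse L ((L 1)⁻¹ • ContinuousLinearMap.id ℝ ℝ) ?_ ?_, ?_⟩
  · intro x
    have : L x = x * L 1 := by simpa using L.map_smul x 1
    simp [this]; field_simp
  · intro x
    have : ∀ x, L x = x * L 1 := fun x => by simpa using L.map_smul x 1
    rw [this]; simp; field_simp
  · ext; simp

/-- The multiplier is smooth, by the implicit function theorem. -/
lemma contDiff_multiplier {lam : ℝ} (hlam : 0 < lam) {n : WithTop ℕ∞} (hn : n ≠ 0) :
    ContDiff ℝ n (multiplier (A := A) lam) := by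
  rw [contDiff_iff_contDiffAt]
  intro x₀
  set η₀ := multiplier lam x₀ with hη₀
  have hm₀ := multiplier_spec hlam x₀
  rw [← hη₀] at hm₀
  set f : ((A → ℝ) × (A → ℝ)) × ℝ → ℝ :=
    fun y => ∑ a, lam * softmaxVec y.1.1 a / (y.2 - y.1.2 a) with hf
  have hcd : ContDiffAt ℝ n f (x₀, η₀) := by
    refine ContDiffAt.sum fun a _ => ContDiffAt.div ?_ ?_ (sub_pos.2 (hm₀.1 a)).ne'
    · refine contDiffAt_const.mul ?_
      exact ((contDiff_softmaxVec a).comp (contDiff_fst.comp contDiff_fst)).contDiffAt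
    · fun_prop
  have hderiv : HasDerivAt (fun η => f (x₀, η))
      (∑ a, -(lam * softmaxVec x₀.1 a) / (η₀ - x₀.2 a) ^ 2) η₀ := by
    refine HasDerivAt.fun_sum fun a _ => ?_
    have := (((hasDerivAt_id η₀).sub_const (x₀.2 a)).inv (sub_pos.2 (hm₀.1 a)).ne').const_mul
      (lam * softmaxVec x₀.1 a)
    convert! this using 1
    simp only [id]; ring
  have hne : ∑ a, -(lam * softmaxVec x₀.1 a) / (η₀ - x₀.2 a) ^ 2 ≠ 0 := by
    refine (Finset.sum_neg (fun a _ => ?_) Finset.univ_nonempty).ne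
    exact div_neg_of_neg_of_pos (neg_neg_of_pos (mul_pos hlam (softmaxVec_pos _ a)))
      (pow_pos (sub_pos.2 (hm₀.1 a)) 2)
  have hinv : (fderiv ℝ f (x₀, η₀) ∘L .inr ℝ _ ℝ).IsInvertible := by
    apply isInvertible_of_apply_one_ne_zero
    have h1 : HasDerivAt (fun η => f (x₀, η)) (fderiv ℝ f (x₀, η₀) (0, 1)) η₀ :=
      (hcd.differentiableAt hn).hasFDerivAt.comp_hasDerivAt η₀
        ((hasDerivAt_const η₀ x₀).prodMk (hasDerivAt_id η₀))
    have h2 := h1.unique hderiv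
    simp only [ContinuousLinearMap.comp_apply, ContinuousLinearMap.inr_apply]
    rw [h2]; exact hne
  have hψ := hcd.contDiffAt_implicitFunction hn hinv
  refine hψ.congr_of_eventuallyEq ?_
  set ψ := hcd.implicitFunction hn hinv with hψdef
  have hψ0 : ψ x₀ = η₀ := hcd.implicitFunction_apply_self hn hinv
  have hopen : IsOpen {y : ((A → ℝ) × (A → ℝ)) × ℝ | ∀ a, y.1.2 a < y.2} := by
    simp only [Set.ofPred_forall]
    exact isOpen_iInter_of_finite fun a => isOpen_lt (by fun_prop) (by fun_prop)
  have hcont : ContinuousAt (fun x => (x, ψ x)) x₀ := continuousAt_id.prodMk hψ.continuousAt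
  have hmem : ∀ᶠ x in nhds x₀, (x, ψ x) ∈ {y : ((A → ℝ) × (A → ℝ)) × ℝ | ∀ a, y.1.2 a < y.2} := by
    refine hcont.eventually_mem (hopen.mem_nhds ?_)
    simp only [hψ0]
    exact hm₀.1
  filter_upwards [hmem, hcd.eventually_apply_implicitFunction hn hinv] with x h1 h2
  refine (multiplier_spec hlam x).unique hlam ⟨h1, ?_⟩
  have h3 : f (x₀, η₀) = 1 := hm₀.2
  rw [h3] at h2
  exact h2

/-- The solution of the within-task problem, as a function of the logits `x.1` of the meta-policy
and of the action values `x.2`. -/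
noncomputable def response (i : Order) (lam : ℝ) (x : (A → ℝ) × (A → ℝ)) (a : A) : ℝ :=
  match i with
  | .one => lam * softmaxVec x.1 a / (multiplier lam x - x.2 a)
  | .two => softmaxVec (fun a => x.1 a + x.2 a / lam) a

lemma contDiff_response (i : Order) {lam : ℝ} (hlam : 0 < lam) {n : WithTop ℕ∞} (hn : n ≠ 0)
    (a : A) : ContDiff ℝ n fun x : (A → ℝ) × (A → ℝ) => response i lam x a := by
  cases i
  · refine ContDiff.div ?_ ?_ fun x => (sub_pos.2 ((multiplier_spec hlam x).1 a)).ne'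
    · exact contDiff_const.mul ((contDiff_softmaxVec a).comp contDiff_fst)
    · exact (contDiff_multiplier hlam hn).sub (by fun_prop)
  · exact (contDiff_softmaxVec a).comp (by fun_prop)

lemma isResponse_response (i : Order) {lam : ℝ} (hlam : 0 < lam) (x : (A → ℝ) × (A → ℝ)) :
    IsResponse i lam (softmaxVec x.1) x.2 (response i lam x) := by
  cases i
  · obtain ⟨h1, h2⟩ := multiplier_spec hlam x
    have hpos : ∀ a, 0 < response .one lam x a := fun a =>
      div_pos (mul_pos hlam (softmaxVec_pos _ a)) (sub_pos.2 (h1 a))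
    exact ⟨⟨fun a => (hpos a).le, h2⟩, hpos, multiplier lam x, fun a =>
      div_mul_cancel₀ _ (sub_pos.2 (h1 a)).ne'⟩
  · refine ⟨softmaxVec_mem _, softmaxVec_pos _,
      -(lam * (Real.log (∑ a, Real.exp (x.1 a))
        - Real.log (∑ a, Real.exp (x.1 a + x.2 a / lam)))), fun a => ?_⟩
    have hZ := sum_exp_pos x.1
    have hZ' := sum_exp_pos (fun a => x.1 a + x.2 a / lam)
    simp only [response]
    rw [Real.log_div (softmaxVec_pos _ a).ne' (softmaxVec_pos _ a).ne']
    simp only [softmaxVec]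
    rw [Real.log_div (Real.exp_pos _).ne' hZ'.ne', Real.log_div (Real.exp_pos _).ne' hZ.ne',
      Real.log_exp, Real.log_exp]
    field_simp
    ring

/-- The logits and action values that determine the adapted policy at the state `s`. -/
noncomputable def taskInput (γ : ℝ) (M : MDP S A rmax) (φ : EuclideanSpace ℝ (S × A)) (s : S) :
    (A → ℝ) × (A → ℝ) :=
  (fun a => φ (s, a), Q γ M (softmaxPolicy φ) s)

lemma alg_softmaxPolicy (i : Order) (γ : ℝ) {lam : ℝ} (hlam : 0 < lam) (M : MDP S A rmax)
    (φ : EuclideanSpace ℝ (S × A)) (s : S) :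
    alg i γ lam M (softmaxPolicy φ) s = response i lam (taskInput γ M φ s) :=
  alg_eq_of_isResponse hlam (isPolicy_softmaxPolicy φ s) (softmaxPolicy_pos φ s)
    (isResponse_response i hlam (taskInput γ M φ s))

lemma isResponse_alg (i : Order) (γ : ℝ) {lam : ℝ} (hlam : 0 < lam) (M : MDP S A rmax)
    (φ : EuclideanSpace ℝ (S × A)) (s : S) :
    IsResponse i lam (softmaxPolicy φ s) (Q γ M (softmaxPolicy φ) s)
      (alg i γ lam M (softmaxPolicy φ) s) := by
  rw [alg_softmaxPolicy i γ hlam]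
  exact isResponse_response i hlam (taskInput γ M φ s)

lemma isPolicy_alg (i : Order) (γ : ℝ) {lam : ℝ} (hlam : 0 < lam) (M : MDP S A rmax)
    (φ : EuclideanSpace ℝ (S × A)) : IsPolicy (alg i γ lam M (softmaxPolicy φ)) :=
  fun s => (isResponse_alg i γ hlam M φ s).1

end Response

section Smooth

variable {E : Type*} [NormedAddCommGroup E] [NormedSpace ℝ E]

/-- The value function is a smooth function of the policy: it is obtained by inverting `1 - γ P`. -/
lemma contDiff_V {γ : ℝ} (hγ0 : 0 ≤ γ) (hγ1 : γ < 1) (M : MDP S A rmax) {n : WithTop ℕ∞}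
    {p : E → S → A → ℝ} (hp : ∀ s a, ContDiff ℝ n fun x => p x s a) (hpol : ∀ x, IsPolicy (p x))
    (s : S) : ContDiff ℝ n fun x => V γ M (p x) s := by
  classical
  -- the transition operator of the policy `p x`, and the mean reward
  set T : E → (S → ℝ) →L[ℝ] (S → ℝ) := fun x => ∑ s, ∑ a, ∑ s', (γ * (p x s a * M.P s a s')) •
    ((ContinuousLinearMap.single ℝ (fun _ : S => ℝ) s).comp (ContinuousLinearMap.proj s'))
    with hT
  set R : E → S → ℝ := fun x s => ∑ a, p x s a * meanReward M s a with hR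
  have hTapp : ∀ x v s, T x v s = γ * ∑ a, p x s a * ∑ s', M.P s a s' * v s' := by
    intro x v s
    simp only [hT, sum_apply, Finset.sum_apply, smul_apply,
      ContinuousLinearMap.comp_apply, ContinuousLinearMap.proj_apply,
      ContinuousLinearMap.single_apply, Pi.smul_apply, smul_eq_mul]
    rw [Finset.sum_eq_single s]
    · simp only [Pi.single_eq_same, Finset.mul_sum]
      exact Finset.sum_congr rfl fun a _ => Finset.sum_congr rfl fun s' _ => by ring
    · intro b _ hb
      simp [Pi.single_eq_of_ne hb.symm]
    · simp
  have hTcd : ContDiff ℝ n T := by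
    refine ContDiff.sum fun s _ => ContDiff.sum fun a _ => ContDiff.sum fun s' _ => ?_
    exact (contDiff_const.mul ((hp s a).mul contDiff_const)).smul contDiff_const
  have hRcd : ContDiff ℝ n R := contDiff_pi.2 fun s =>
    ContDiff.sum fun a _ => (hp s a).mul contDiff_const
  have hnorm : ∀ x, ‖T x‖ < 1 := by
    intro x
    refine lt_of_le_of_lt (ContinuousLinearMap.opNorm_le_bound _ hγ0 fun v => ?_) hγ1
    refine (pi_norm_le_iff_of_nonneg (by positivity)).2 fun s => ?_
    rw [hTapp, norm_mul, Real.norm_of_nonneg hγ0]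
    refine mul_le_mul_of_nonneg_left ?_ hγ0
    calc ‖∑ a, p x s a * ∑ s', M.P s a s' * v s'‖ ≤ ∑ a, p x s a * ‖v‖ := by
          refine norm_sum_le_of_le _ fun a _ => ?_
          rw [norm_mul, Real.norm_of_nonneg ((hpol x).nonneg s a)]
          refine mul_le_mul_of_nonneg_left ?_ ((hpol x).nonneg s a)
          calc ‖∑ s', M.P s a s' * v s'‖ ≤ ∑ s', M.P s a s' * ‖v‖ := by
                refine norm_sum_le_of_le _ fun s' _ => ?_
                rw [norm_mul, Real.norm_of_nonneg ((M.P_mem s a).1 s')]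
                exact mul_le_mul_of_nonneg_left (norm_le_pi_norm v s') ((M.P_mem s a).1 s')
            _ = ‖v‖ := by rw [← Finset.sum_mul, (M.P_mem s a).2, one_mul]
      _ = ‖v‖ := by rw [← Finset.sum_mul, (hpol x).sum_eq, one_mul]
  have hV : ∀ x, (1 - T x) (V γ M (p x)) = R x := by
    intro x
    funext s
    simp only [sub_apply, one_apply_eq_self, Pi.sub_apply, hTapp]
    rw [V_eq_sum_Q hγ0 hγ1 M (hpol x), sub_eq_iff_eq_add]
    simp only [hR, Q_eq hγ0 hγ1 M (hpol x), mul_add, Finset.sum_add_distrib]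
    rw [Finset.mul_sum (a := γ)]
    congr 1
    exact Finset.sum_congr rfl fun a _ => by ring
  have hVinv : ∀ x, V γ M (p x) = Ring.inverse (1 - T x) (R x) := by
    intro x
    have hu : IsUnit (1 - T x) := (Units.oneSub (T x) (hnorm x)).isUnit
    rw [← hV x, ← mul_apply_eq_comp, Ring.inverse_mul_cancel _ hu,
      one_apply_eq_self]
  have hinvcd : ContDiff ℝ n fun x => Ring.inverse (1 - T x) := by
    rw [contDiff_iff_contDiffAt]
    intro x
    have h := contDiffAt_ringInverse ℝ (n := n) (Units.oneSub (T x) (hnorm x))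
    exact ContDiffAt.comp x (by simpa using h) (contDiff_const.sub hTcd).contDiffAt
  have hall : ContDiff ℝ n fun x => V γ M (p x) := by
    simp only [hVinv]
    exact hinvcd.clm_apply hRcd
  exact contDiff_pi.1 hall s

lemma contDiff_Q {γ : ℝ} (hγ0 : 0 ≤ γ) (hγ1 : γ < 1) (M : MDP S A rmax) {n : WithTop ℕ∞}
    {p : E → S → A → ℝ} (hp : ∀ s a, ContDiff ℝ n fun x => p x s a) (hpol : ∀ x, IsPolicy (p x))
    (s : S) (a : A) : ContDiff ℝ n fun x => Q γ M (p x) s a := by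
  simp only [fun x => Q_eq hγ0 hγ1 M (hpol x) s a]
  exact contDiff_const.add (contDiff_const.mul (ContDiff.sum fun s' _ =>
    contDiff_const.mul (contDiff_V hγ0 hγ1 M hp hpol s')))

variable [Nonempty A]

lemma contDiff_softmaxPolicy {n : WithTop ℕ∞} (s : S) (a : A) :
    ContDiff ℝ n fun φ : EuclideanSpace ℝ (S × A) => softmaxPolicy φ s a :=
  (contDiff_softmaxVec a).comp
    (f := fun φ : EuclideanSpace ℝ (S × A) => fun a => φ (s, a))
    (contDiff_pi.2 fun a => by fun_prop)

lemma contDiff_taskInput {γ : ℝ} (hγ0 : 0 ≤ γ) (hγ1 : γ < 1) (M : MDP S A rmax)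
    {n : WithTop ℕ∞} (s : S) : ContDiff ℝ n fun φ => taskInput γ M φ s := by
  refine ContDiff.prodMk (contDiff_pi.2 fun a => by fun_prop) (contDiff_pi.2 fun a => ?_)
  exact contDiff_Q hγ0 hγ1 M (fun s a => contDiff_softmaxPolicy s a) isPolicy_softmaxPolicy s a

lemma contDiff_alg (i : Order) {γ : ℝ} (hγ0 : 0 ≤ γ) (hγ1 : γ < 1) {lam : ℝ} (hlam : 0 < lam)
    (M : MDP S A rmax) {n : WithTop ℕ∞} (hn : n ≠ 0) (s : S) (a : A) :
    ContDiff ℝ n fun φ : EuclideanSpace ℝ (S × A) => alg i γ lam M (softmaxPolicy φ) s a := by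
  simp only [alg_softmaxPolicy i γ hlam]
  exact (contDiff_response i hlam hn a).comp (contDiff_taskInput hγ0 hγ1 M s)

lemma contDiff_adaptedReward (i : Order) {γ : ℝ} (hγ0 : 0 ≤ γ) (hγ1 : γ < 1) {lam : ℝ}
    (hlam : 0 < lam) (M : MDP S A rmax) {n : WithTop ℕ∞} (hn : n ≠ 0) :
    ContDiff ℝ n (adaptedReward i γ lam M) := by
  refine ContDiff.sum fun s _ => contDiff_const.mul ?_
  exact contDiff_V hγ0 hγ1 M (contDiff_alg i hγ0 hγ1 hlam M hn) (isPolicy_alg i γ hlam M) s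

end Smooth

/-! ### Second derivatives of twice continuously differentiable curves -/

section Curves

lemma hasDerivAt_of_contDiff_two {f : ℝ → ℝ} (hf : ContDiff ℝ 2 f) (t : ℝ) :
    HasDerivAt f (deriv f t) t :=
  (hf.differentiable (by norm_num)).differentiableAt.hasDerivAt

lemma hasDerivAt_deriv_of_contDiff_two {f : ℝ → ℝ} (hf : ContDiff ℝ 2 f) (t : ℝ) :
    HasDerivAt (deriv f) (deriv (deriv f) t) t := by
  have : ContDiff ℝ 1 (deriv f) := by
    have h : ContDiff ℝ (1 + 1) f := by norm_num; exact hf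
    exact (contDiff_succ_iff_deriv.1 h).2.2
  exact (this.differentiable (by norm_num)).differentiableAt.hasDerivAt

lemma deriv_mul_of_contDiff {f g : ℝ → ℝ} (hf : ContDiff ℝ 2 f) (hg : ContDiff ℝ 2 g) (t : ℝ) :
    deriv (fun t => f t * g t) t = deriv f t * g t + f t * deriv g t :=
  ((hasDerivAt_of_contDiff_two hf t).mul (hasDerivAt_of_contDiff_two hg t)).deriv

lemma deriv_deriv_mul {f g : ℝ → ℝ} (hf : ContDiff ℝ 2 f) (hg : ContDiff ℝ 2 g) (t : ℝ) :
    deriv (deriv fun t => f t * g t) t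
      = deriv (deriv f) t * g t + 2 * (deriv f t * deriv g t) + f t * deriv (deriv g) t := by
  rw [funext (deriv_mul_of_contDiff hf hg)]
  have h1 := (hasDerivAt_deriv_of_contDiff_two hf t).fun_mul (hasDerivAt_of_contDiff_two hg t)
  have h2 := (hasDerivAt_of_contDiff_two hf t).fun_mul (hasDerivAt_deriv_of_contDiff_two hg t)
  rw [(h1.fun_add h2).deriv]
  ring

lemma deriv_sum_of_contDiff {ι : Type*} [Fintype ι] {f : ι → ℝ → ℝ} (hf : ∀ i, ContDiff ℝ 2 (f i))
    (t : ℝ) : deriv (fun t => ∑ i, f i t) t = ∑ i, deriv (f i) t :=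
  (HasDerivAt.fun_sum fun i _ => hasDerivAt_of_contDiff_two (hf i) t).deriv

lemma deriv_deriv_sum {ι : Type*} [Fintype ι] {f : ι → ℝ → ℝ} (hf : ∀ i, ContDiff ℝ 2 (f i))
    (t : ℝ) : deriv (deriv fun t => ∑ i, f i t) t = ∑ i, deriv (deriv (f i)) t := by
  rw [funext (deriv_sum_of_contDiff hf)]
  exact (HasDerivAt.fun_sum fun i _ => hasDerivAt_deriv_of_contDiff_two (hf i) t).deriv

lemma deriv_deriv_const_mul (c : ℝ) {f : ℝ → ℝ} (hf : ContDiff ℝ 2 f) (t : ℝ) :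
    deriv (deriv fun t => c * f t) t = c * deriv (deriv f) t := by
  have : (deriv fun t => c * f t) = fun t => c * deriv f t :=
    funext fun t => ((hasDerivAt_of_contDiff_two hf t).const_mul c).deriv
  rw [this]
  exact ((hasDerivAt_deriv_of_contDiff_two hf t).const_mul c).deriv

lemma deriv_const_mul_of_contDiff (c : ℝ) {f : ℝ → ℝ} (hf : ContDiff ℝ 2 f) (t : ℝ) :
    deriv (fun t => c * f t) t = c * deriv f t :=
  ((hasDerivAt_of_contDiff_two hf t).const_mul c).deriv

lemma deriv_add_of_contDiff {f g : ℝ → ℝ} (hf : ContDiff ℝ 2 f) (hg : ContDiff ℝ 2 g) (t : ℝ) :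
    deriv (fun t => f t + g t) t = deriv f t + deriv g t :=
  ((hasDerivAt_of_contDiff_two hf t).fun_add (hasDerivAt_of_contDiff_two hg t)).deriv

lemma deriv_deriv_add {f g : ℝ → ℝ} (hf : ContDiff ℝ 2 f) (hg : ContDiff ℝ 2 g) (t : ℝ) :
    deriv (deriv fun t => f t + g t) t = deriv (deriv f) t + deriv (deriv g) t := by
  rw [funext (deriv_add_of_contDiff hf hg)]
  exact ((hasDerivAt_deriv_of_contDiff_two hf t).fun_add
    (hasDerivAt_deriv_of_contDiff_two hg t)).deriv

lemma deriv_sub_of_contDiff {f g : ℝ → ℝ} (hf : ContDiff ℝ 2 f) (hg : ContDiff ℝ 2 g) (t : ℝ) :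
    deriv (fun t => f t - g t) t = deriv f t - deriv g t :=
  ((hasDerivAt_of_contDiff_two hf t).fun_sub (hasDerivAt_of_contDiff_two hg t)).deriv

lemma deriv_deriv_sub {f g : ℝ → ℝ} (hf : ContDiff ℝ 2 f) (hg : ContDiff ℝ 2 g) (t : ℝ) :
    deriv (deriv fun t => f t - g t) t = deriv (deriv f) t - deriv (deriv g) t := by
  rw [funext (deriv_sub_of_contDiff hf hg)]
  exact ((hasDerivAt_deriv_of_contDiff_two hf t).fun_sub
    (hasDerivAt_deriv_of_contDiff_two hg t)).deriv

lemma sum_deriv_eq_zero {p : ℝ → A → ℝ} (hp : ∀ a, ContDiff ℝ 2 fun t => p t a)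
    (hsum : ∀ t, ∑ a, p t a = 1) (t : ℝ) : ∑ a, deriv (fun t => p t a) t = 0 := by
  rw [← deriv_sum_of_contDiff hp]
  simp [hsum]

lemma sum_deriv_deriv_eq_zero {p : ℝ → A → ℝ} (hp : ∀ a, ContDiff ℝ 2 fun t => p t a)
    (hsum : ∀ t, ∑ a, p t a = 1) (t : ℝ) : ∑ a, deriv (deriv fun t => p t a) t = 0 := by
  rw [← deriv_deriv_sum hp]
  simp [hsum]

end Curves

/-! ### Derivatives of the value function along a curve of policies -/

section ValueCurve

/-- Sup-norm bound for the solution of a discounted fixed-point inequality. -/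
lemma norm_le_of_contraction {γ b : ℝ} (hγ0 : 0 ≤ γ) (hγ1 : γ < 1) (hb : 0 ≤ b) {x : S → ℝ}
    (h : ∀ s, |x s| ≤ b + γ * ‖x‖) : ‖x‖ ≤ b / (1 - γ) := by
  have h1 : ‖x‖ ≤ b + γ * ‖x‖ := (pi_norm_le_iff_of_nonneg (by positivity)).2 h
  rw [le_div_iff₀ (by linarith)]
  linarith

lemma abs_sum_mul_le {f g : A → ℝ} {C m : ℝ} (hf : ∑ a, |f a| ≤ C) (hm : 0 ≤ m)
    (hg : ∀ a, |g a| ≤ m) : |∑ a, f a * g a| ≤ C * m := by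
  calc |∑ a, f a * g a| ≤ ∑ a, |f a| * m :=
        (Finset.abs_sum_le_sum_abs _ _).trans (Finset.sum_le_sum fun a _ => by
          rw [abs_mul]; exact mul_le_mul_of_nonneg_left (hg a) (abs_nonneg _))
    _ = (∑ a, |f a|) * m := by rw [Finset.sum_mul]
    _ ≤ C * m := mul_le_mul_of_nonneg_right hf hm

lemma sum_abs_of_mem_stdSimplex {p : A → ℝ} (hp : p ∈ stdSimplex ℝ A) : ∑ a, |p a| = 1 := by
  rw [← hp.2]; exact Finset.sum_congr rfl fun a _ => abs_of_nonneg (hp.1 a)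

variable {γ : ℝ} (hγ0 : 0 ≤ γ) (hγ1 : γ < 1) (M : MDP S A rmax) {p : ℝ → S → A → ℝ}
  (hp : ∀ s a, ContDiff ℝ 2 fun t => p t s a) (hpol : ∀ t, IsPolicy (p t))

include hγ0 hγ1 hp hpol

lemma deriv_Q (t : ℝ) (s : S) (a : A) : deriv (fun t => Q γ M (p t) s a) t
    = γ * ∑ s', M.P s a s' * deriv (fun t => V γ M (p t) s') t := by
  have hV := contDiff_V hγ0 hγ1 M hp hpol
  simp only [fun x => Q_eq hγ0 hγ1 M (hpol x) s a]
  rw [deriv_const_add, deriv_const_mul_of_contDiff _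
    (ContDiff.sum fun s' _ => contDiff_const.mul (hV s')),
    deriv_sum_of_contDiff fun s' => contDiff_const.mul (hV s')]
  simp only [deriv_const_mul_of_contDiff _ (hV _)]

lemma deriv_deriv_Q (t : ℝ) (s : S) (a : A) : deriv (deriv fun t => Q γ M (p t) s a) t
    = γ * ∑ s', M.P s a s' * deriv (deriv fun t => V γ M (p t) s') t := by
  have hV := contDiff_V hγ0 hγ1 M hp hpol
  simp only [fun x => Q_eq hγ0 hγ1 M (hpol x) s a]
  rw [deriv_deriv_add contDiff_const
    (contDiff_const.mul (ContDiff.sum fun s' _ => contDiff_const.mul (hV s'))),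
    deriv_deriv_const_mul _ (ContDiff.sum fun s' _ => contDiff_const.mul (hV s')),
    deriv_deriv_sum fun s' => contDiff_const.mul (hV s')]
  simp only [deriv_deriv_const_mul _ (hV _)]
  simp

lemma deriv_V (t : ℝ) (s : S) : deriv (fun t => V γ M (p t) s) t
    = ∑ a, deriv (fun t => p t s a) t * Q γ M (p t) s a
      + ∑ a, p t s a * deriv (fun t => Q γ M (p t) s a) t := by
  have hQ := contDiff_Q hγ0 hγ1 M hp hpol
  simp only [fun x => V_eq_sum_Q hγ0 hγ1 M (hpol x) s]
  rw [deriv_sum_of_contDiff fun a => (hp s a).mul (hQ s a), ← Finset.sum_add_distrib]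
  exact Finset.sum_congr rfl fun a _ => deriv_mul_of_contDiff (hp s a) (hQ s a) t

lemma deriv_deriv_V (t : ℝ) (s : S) : deriv (deriv fun t => V γ M (p t) s) t
    = ∑ a, deriv (deriv fun t => p t s a) t * Q γ M (p t) s a
      + 2 * ∑ a, deriv (fun t => p t s a) t * deriv (fun t => Q γ M (p t) s a) t
      + ∑ a, p t s a * deriv (deriv fun t => Q γ M (p t) s a) t := by
  have hQ := contDiff_Q hγ0 hγ1 M hp hpol
  simp only [fun x => V_eq_sum_Q hγ0 hγ1 M (hpol x) s]
  rw [deriv_deriv_sum fun a => (hp s a).mul (hQ s a), Finset.mul_sum, ← Finset.sum_add_distrib,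
    ← Finset.sum_add_distrib]
  exact Finset.sum_congr rfl fun a _ => deriv_deriv_mul (hp s a) (hQ s a) t

omit hγ1 hp hpol in
lemma abs_mul_sum_P_le (s : S) (a : A) (x : S → ℝ) : |γ * ∑ s', M.P s a s' * x s'| ≤ γ * ‖x‖ := by
  rw [abs_mul, abs_of_nonneg hγ0]
  refine mul_le_mul_of_nonneg_left ?_ hγ0
  have := abs_sum_mul_le (C := 1) (sum_abs_of_mem_stdSimplex (M.P_mem s a)).le (norm_nonneg x)
    (fun s' => norm_le_pi_norm x s')
  rwa [one_mul] at this

lemma norm_deriv_V_le {t b : ℝ} (hb : 0 ≤ b)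
    (h : ∀ s, |∑ a, deriv (fun t => p t s a) t * Q γ M (p t) s a| ≤ b) :
    ‖fun s => deriv (fun t => V γ M (p t) s) t‖ ≤ b / (1 - γ) := by
  refine norm_le_of_contraction hγ0 hγ1 hb fun s => ?_
  rw [deriv_V hγ0 hγ1 M hp hpol]
  refine (abs_add_le _ _).trans (add_le_add (h s) ?_)
  have := abs_sum_mul_le (C := 1) (sum_abs_of_mem_stdSimplex (hpol t s)).le
    (mul_nonneg hγ0 (norm_nonneg fun s => deriv (fun t => V γ M (p t) s) t))
    (g := fun a => deriv (fun t => Q γ M (p t) s a) t) (fun a => by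
      rw [deriv_Q hγ0 hγ1 M hp hpol]
      exact abs_mul_sum_P_le hγ0 M s a fun s => deriv (fun t => V γ M (p t) s) t)
  rwa [one_mul] at this

lemma abs_deriv_Q_le {t b : ℝ} (hb : 0 ≤ b)
    (h : ∀ s, |∑ a, deriv (fun t => p t s a) t * Q γ M (p t) s a| ≤ b) (s : S) (a : A) :
    |deriv (fun t => Q γ M (p t) s a) t| ≤ γ * (b / (1 - γ)) := by
  rw [deriv_Q hγ0 hγ1 M hp hpol]
  exact (abs_mul_sum_P_le hγ0 M s a fun s => deriv (fun t => V γ M (p t) s) t).trans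
    (mul_le_mul_of_nonneg_left (norm_deriv_V_le hγ0 hγ1 M hp hpol hb h) hγ0)

/-- Since the derivatives of the action probabilities sum to zero, the `Q`-function in the
derivative of the return can be replaced with the advantage. -/
lemma abs_sum_deriv_mul_Q_le_of_advantage {t C Amax : ℝ} (hAmax : 0 ≤ Amax)
    (hadv : ∀ s a, |advantage γ M (p t) s a| ≤ Amax)
    (hC : ∀ s, ∑ a, |deriv (fun t => p t s a) t| ≤ C) (s : S) :
    |∑ a, deriv (fun t => p t s a) t * Q γ M (p t) s a| ≤ C * Amax := by
  have : ∑ a, deriv (fun t => p t s a) t * Q γ M (p t) s a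
      = ∑ a, deriv (fun t => p t s a) t * advantage γ M (p t) s a := by
    simp only [advantage, mul_sub, Finset.sum_sub_distrib, ← Finset.sum_mul,
      sum_deriv_eq_zero (hp s) (fun t => (hpol t).sum_eq s), zero_mul, sub_zero]
  rw [this]
  exact abs_sum_mul_le (hC s) hAmax (hadv s)

omit hp in
lemma abs_Q_le (t : ℝ) (s : S) (a : A) : |Q γ M (p t) s a| ≤ rmax / (1 - γ) := by
  rw [abs_of_nonneg (Q_nonneg hγ0 hγ1 M (hpol t) s a)]
  exact Q_le hγ0 hγ1 M (hpol t) s a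

/-- The second derivative of the value function along a curve of policies, in terms of the first
two derivatives of the action probabilities. -/
lemma norm_deriv_deriv_V_le (hrmax : 0 ≤ rmax) {t B C : ℝ} (hB0 : 0 ≤ B) (hC0 : 0 ≤ C)
    (hC : ∀ s, ∑ a, |deriv (fun t => p t s a) t| ≤ C)
    (hB : ∀ s, ∑ a, |deriv (deriv fun t => p t s a) t| ≤ B) :
    ‖fun s => deriv (deriv fun t => V γ M (p t) s) t‖
      ≤ rmax * B / (1 - γ) ^ 2 + 2 * γ * rmax * C ^ 2 / (1 - γ) ^ 3 := by
  have h1γ : 0 < 1 - γ := by linarith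
  have hQ0 : 0 ≤ rmax / (1 - γ) := by positivity
  have hQ := abs_Q_le (rmax := rmax) hγ0 hγ1 M hpol t
  have hdQ := abs_deriv_Q_le hγ0 hγ1 M hp hpol (mul_nonneg hC0 hQ0)
    fun s => abs_sum_mul_le (hC s) hQ0 (hQ s)
  have hmain : ‖fun s => deriv (deriv fun t => V γ M (p t) s) t‖
      ≤ (B * (rmax / (1 - γ)) + 2 * (C * (γ * (C * (rmax / (1 - γ)) / (1 - γ))))) / (1 - γ) := by
    refine norm_le_of_contraction hγ0 hγ1 (by positivity) fun s => ?_
    rw [deriv_deriv_V hγ0 hγ1 M hp hpol]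
    refine (abs_add_le _ _).trans (add_le_add ((abs_add_le _ _).trans (add_le_add ?_ ?_)) ?_)
    · exact abs_sum_mul_le (hB s) hQ0 (hQ s)
    · rw [abs_mul, abs_two]
      exact mul_le_mul_of_nonneg_left
        (abs_sum_mul_le (hC s) (by positivity) (hdQ s)) two_pos.le
    · have := abs_sum_mul_le (C := 1) (sum_abs_of_mem_stdSimplex (hpol t s)).le
        (mul_nonneg hγ0 (norm_nonneg fun s => deriv (deriv fun t => V γ M (p t) s) t))
        (g := fun a => deriv (deriv fun t => Q γ M (p t) s a) t) (fun a => by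
          rw [deriv_deriv_Q hγ0 hγ1 M hp hpol]
          exact abs_mul_sum_P_le hγ0 M s a fun s => deriv (deriv fun t => V γ M (p t) s) t)
      rwa [one_mul] at this
  refine hmain.trans (le_of_eq ?_)
  field_simp

lemma abs_deriv_deriv_Q_le (hrmax : 0 ≤ rmax) {t B C : ℝ} (hB0 : 0 ≤ B) (hC0 : 0 ≤ C)
    (hC : ∀ s, ∑ a, |deriv (fun t => p t s a) t| ≤ C)
    (hB : ∀ s, ∑ a, |deriv (deriv fun t => p t s a) t| ≤ B) (s : S) (a : A) :
    |deriv (deriv fun t => Q γ M (p t) s a) t|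
      ≤ γ * (rmax * B / (1 - γ) ^ 2 + 2 * γ * rmax * C ^ 2 / (1 - γ) ^ 3) := by
  rw [deriv_deriv_Q hγ0 hγ1 M hp hpol]
  exact (abs_mul_sum_P_le hγ0 M s a fun s => deriv (deriv fun t => V γ M (p t) s) t).trans
    (mul_le_mul_of_nonneg_left (norm_deriv_deriv_V_le hγ0 hγ1 M hp hpol hrmax hB0 hC0 hC hB) hγ0)

omit hγ0 hγ1 hp hpol in
lemma abs_sum_rho_mul_le (x : S → ℝ) : |∑ s, M.ρ s * x s| ≤ ‖x‖ := by
  have := abs_sum_mul_le (C := 1) (sum_abs_of_mem_stdSimplex M.ρ_mem).le (norm_nonneg x)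
    (fun s' => norm_le_pi_norm x s')
  rwa [one_mul] at this

lemma abs_deriv_J_le {t C Amax : ℝ} (hAmax : 0 ≤ Amax) (hC0 : 0 ≤ C)
    (hadv : ∀ s a, |advantage γ M (p t) s a| ≤ Amax)
    (hC : ∀ s, ∑ a, |deriv (fun t => p t s a) t| ≤ C) :
    |deriv (fun t => J γ M (p t)) t| ≤ C * Amax / (1 - γ) := by
  have hV := contDiff_V hγ0 hγ1 M hp hpol
  simp only [J]
  rw [deriv_sum_of_contDiff fun s => contDiff_const.mul (hV s)]
  simp only [deriv_const_mul_of_contDiff _ (hV _)]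
  exact (abs_sum_rho_mul_le M fun s => deriv (fun t => V γ M (p t) s) t).trans
    (norm_deriv_V_le hγ0 hγ1 M hp hpol (mul_nonneg hC0 hAmax)
      (abs_sum_deriv_mul_Q_le_of_advantage hγ0 hγ1 M hp hpol hAmax hadv hC))

lemma abs_deriv_deriv_J_le (hrmax : 0 ≤ rmax) {t B C : ℝ} (hB0 : 0 ≤ B) (hC0 : 0 ≤ C)
    (hC : ∀ s, ∑ a, |deriv (fun t => p t s a) t| ≤ C)
    (hB : ∀ s, ∑ a, |deriv (deriv fun t => p t s a) t| ≤ B) :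
    |deriv (deriv fun t => J γ M (p t)) t|
      ≤ rmax * B / (1 - γ) ^ 2 + 2 * γ * rmax * C ^ 2 / (1 - γ) ^ 3 := by
  have hV := contDiff_V hγ0 hγ1 M hp hpol
  simp only [J]
  rw [deriv_deriv_sum fun s => contDiff_const.mul (hV s)]
  simp only [deriv_deriv_const_mul _ (hV _)]
  exact (abs_sum_rho_mul_le M fun s => deriv (deriv fun t => V γ M (p t) s) t).trans
    (norm_deriv_deriv_V_le hγ0 hγ1 M hp hpol hrmax hB0 hC0 hC hB)

end ValueCurve

/-! ### Derivatives of the softmax and of the adapted policy -/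

section Variance

/-- **Popoviciu's inequality**: the variance is at most the squared radius of the range. -/
lemma sum_mul_sub_mean_sq_le {π u : A → ℝ} (hπ : π ∈ stdSimplex ℝ A) {c k : ℝ}
    (hu : ∀ a, (u a - c) ^ 2 ≤ k) : ∑ a, π a * (u a - ∑ b, π b * u b) ^ 2 ≤ k := by
  set m := ∑ b, π b * u b with hm
  have h1 : ∑ a, π a * (u a - m) ^ 2 = ∑ a, π a * (u a - c) ^ 2 - (m - c) ^ 2 := by
    have : ∀ a, π a * (u a - m) ^ 2 = π a * (u a - c) ^ 2 - 2 * (m - c) * (π a * u a)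
        + (m ^ 2 - c ^ 2) * π a := fun a => by ring
    simp only [this, Finset.sum_add_distrib, Finset.sum_sub_distrib, ← Finset.mul_sum, hπ.2, ← hm]
    ring
  have h2 : ∑ a, π a * (u a - c) ^ 2 ≤ ∑ a, π a * k :=
    Finset.sum_le_sum fun a _ => mul_le_mul_of_nonneg_left (hu a) (hπ.1 a)
  rw [← Finset.sum_mul, hπ.2, one_mul] at h2
  nlinarith [sq_nonneg (m - c)]

lemma sum_mul_abs_le_of_sum_mul_sq_le {π x : A → ℝ} (hπ : π ∈ stdSimplex ℝ A) {k : ℝ} (hk : 0 ≤ k)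
    (hx : ∑ a, π a * x a ^ 2 ≤ k ^ 2) : ∑ a, π a * |x a| ≤ k := by
  have := Finset.sum_sq_le_sum_mul_sum_of_sq_le_mul Finset.univ (r := fun a => π a * |x a|)
    (f := π) (g := fun a => π a * x a ^ 2) (fun a _ => hπ.1 a)
    (fun a _ => mul_nonneg (hπ.1 a) (sq_nonneg _))
    (fun a _ => le_of_eq (by rw [mul_pow, sq_abs]; ring))
  rw [hπ.2, one_mul] at this
  exact abs_le_of_sq_le_sq' (this.trans hx) hk |>.2

/-- The coordinates of a vector at one state lie in an interval of length `√2 ‖v‖`: two different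
coordinates contribute both to the norm. -/
lemma exists_center [Nonempty A] (v : EuclideanSpace ℝ (S × A)) (s : S) :
    ∃ c, ∀ a, (v (s, a) - c) ^ 2 ≤ ‖v‖ ^ 2 / 2 := by
  classical
  obtain ⟨a₁, h₁⟩ := Finite.exists_max fun a => v (s, a)
  obtain ⟨a₀, h₀⟩ := Finite.exists_min fun a => v (s, a)
  refine ⟨(v (s, a₀) + v (s, a₁)) / 2, fun a => ?_⟩
  have hle : (v (s, a) - (v (s, a₀) + v (s, a₁)) / 2) ^ 2
      ≤ ((v (s, a₁) - v (s, a₀)) / 2) ^ 2 :=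
    sq_le_sq' (by linarith [h₀ a]) (by linarith [h₁ a])
  by_cases h : a₀ = a₁
  · rw [h, sub_self, zero_div, zero_pow two_ne_zero] at hle
    rw [h]
    exact hle.trans (by positivity)
  · have hnorm : v (s, a₀) ^ 2 + v (s, a₁) ^ 2 ≤ ‖v‖ ^ 2 := by
      rw [EuclideanSpace.norm_sq_eq]
      have hne : ((s, a₀) : S × A) ≠ (s, a₁) := fun h' => h (Prod.ext_iff.1 h').2
      have := Finset.sum_le_sum_of_subset_of_nonneg
        (Finset.subset_univ {((s, a₀) : S × A), (s, a₁)})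
        (f := fun x => ‖v x‖ ^ 2) (fun _ _ _ => sq_nonneg _)
      rw [Finset.sum_pair hne] at this
      simpa only [Real.norm_eq_abs, sq_abs] using this
    nlinarith [sq_nonneg (v (s, a₀) + v (s, a₁))]

end Variance

section SoftmaxCurve

variable [Nonempty A] {z : ℝ → A → ℝ} (hz : ∀ a, ContDiff ℝ 2 fun t => z t a)

include hz

lemma contDiff_softmaxVec_curve (a : A) : ContDiff ℝ 2 fun t => softmaxVec (z t) a :=
  (contDiff_softmaxVec a).comp (contDiff_pi.2 hz)

lemma deriv_softmaxVec (t : ℝ) (a : A) : deriv (fun t => softmaxVec (z t) a) t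
    = softmaxVec (z t) a * (deriv (fun t => z t a) t
      - ∑ b, softmaxVec (z t) b * deriv (fun t => z t b) t) := by
  have h1 : ∀ b, HasDerivAt (fun t => Real.exp (z t b))
      (Real.exp (z t b) * deriv (fun t => z t b) t) t := fun b =>
    (hasDerivAt_of_contDiff_two (hz b) t).exp
  have h2 : HasDerivAt (fun t => ∑ b, Real.exp (z t b))
      (∑ b, Real.exp (z t b) * deriv (fun t => z t b) t) t := HasDerivAt.fun_sum fun b _ => h1 b
  have hZ := sum_exp_pos (z t)
  have h3 := ((h1 a).fun_div h2 hZ.ne').deriv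
  simp only [softmaxVec]
  rw [h3]
  have : ∑ b, Real.exp (z t b) / (∑ a', Real.exp (z t a')) * deriv (fun t => z t b) t
      = (∑ b, Real.exp (z t b) * deriv (fun t => z t b) t) / ∑ a', Real.exp (z t a') := by
    rw [Finset.sum_div]
    exact Finset.sum_congr rfl fun b _ => by ring
  rw [this]
  field_simp

lemma deriv_deriv_softmaxVec (t : ℝ) (a : A) : deriv (deriv fun t => softmaxVec (z t) a) t
    = softmaxVec (z t) a * ((deriv (fun t => z t a) t
        - ∑ b, softmaxVec (z t) b * deriv (fun t => z t b) t) ^ 2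
      - ∑ c, softmaxVec (z t) c * (deriv (fun t => z t c) t
        - ∑ b, softmaxVec (z t) b * deriv (fun t => z t b) t) ^ 2
      + deriv (deriv fun t => z t a) t
      - ∑ b, softmaxVec (z t) b * deriv (deriv fun t => z t b) t) := by
  have hd : ∀ b, HasDerivAt (fun t => softmaxVec (z t) b) (softmaxVec (z t) b *
      (deriv (fun t => z t b) t - ∑ b, softmaxVec (z t) b * deriv (fun t => z t b) t)) t := by
    intro b
    rw [← deriv_softmaxVec hz]
    exact hasDerivAt_of_contDiff_two (contDiff_softmaxVec_curve hz b) t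
  have hdz := fun b => hasDerivAt_deriv_of_contDiff_two (hz b) t
  have h := (hd a).fun_mul ((hdz a).fun_sub
    (HasDerivAt.fun_sum (u := Finset.univ) fun b _ => (hd b).fun_mul (hdz b)))
  rw [funext fun t => deriv_softmaxVec hz t a, h.deriv]
  set m := ∑ b, softmaxVec (z t) b * deriv (fun t => z t b) t with hm
  have hvar : ∑ b, softmaxVec (z t) b * (deriv (fun t => z t b) t - m) * deriv (fun t => z t b) t
      = ∑ c, softmaxVec (z t) c * (deriv (fun t => z t c) t - m) ^ 2 := by
    have : ∀ c, softmaxVec (z t) c * (deriv (fun t => z t c) t - m) ^ 2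
        = softmaxVec (z t) c * (deriv (fun t => z t c) t - m) * deriv (fun t => z t c) t
          - m * (softmaxVec (z t) c * deriv (fun t => z t c) t) + m ^ 2 * softmaxVec (z t) c :=
      fun c => by ring
    simp only [this, Finset.sum_add_distrib, Finset.sum_sub_distrib, ← Finset.mul_sum,
      (softmaxVec_mem (z t)).2, ← hm]
    ring
  rw [Finset.sum_add_distrib, hvar]
  ring

lemma sum_abs_deriv_softmaxVec_le {t c k : ℝ} (hk : 0 ≤ k)
    (h : ∀ a, (deriv (fun t => z t a) t - c) ^ 2 ≤ k ^ 2) :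
    ∑ a, |deriv (fun t => softmaxVec (z t) a) t| ≤ k := by
  have hpos := softmaxVec_pos (z t)
  simp only [deriv_softmaxVec hz, abs_mul, abs_of_pos (hpos _)]
  exact sum_mul_abs_le_of_sum_mul_sq_le (softmaxVec_mem _) hk
    (sum_mul_sub_mean_sq_le (softmaxVec_mem _) h)

lemma sum_abs_deriv_deriv_softmaxVec_le {t c k m : ℝ}
    (h : ∀ a, (deriv (fun t => z t a) t - c) ^ 2 ≤ k ^ 2)
    (hm : ∀ a, |deriv (deriv fun t => z t a) t| ≤ m) :
    ∑ a, |deriv (deriv fun t => softmaxVec (z t) a) t| ≤ 2 * k ^ 2 + 2 * m := by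
  have hpos := softmaxVec_pos (z t)
  have hmem := softmaxVec_mem (z t)
  have hvar := sum_mul_sub_mean_sq_le hmem h
  simp only [deriv_deriv_softmaxVec hz, abs_mul, abs_of_pos (hpos _)]
  set μ := ∑ b, softmaxVec (z t) b * deriv (fun t => z t b) t
  set v := ∑ c, softmaxVec (z t) c * (deriv (fun t => z t c) t - μ) ^ 2 with hv
  have hv0 : 0 ≤ v := Finset.sum_nonneg fun a _ => mul_nonneg (hpos a).le (sq_nonneg _)
  have hmean : |∑ b, softmaxVec (z t) b * deriv (deriv fun t => z t b) t| ≤ m := by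
    have := abs_sum_mul_le (C := 1) (sum_abs_of_mem_stdSimplex hmem).le
      ((abs_nonneg _).trans (hm (Classical.arbitrary A))) hm
    rwa [one_mul] at this
  calc _ ≤ ∑ a, softmaxVec (z t) a * ((deriv (fun t => z t a) t - μ) ^ 2 + (v + 2 * m)) := by
        refine Finset.sum_le_sum fun a _ => mul_le_mul_of_nonneg_left ?_ (hpos a).le
        have h1 := abs_le.1 (hm a)
        have h2 := abs_le.1 hmean
        have h3 := sq_nonneg (deriv (fun t => z t a) t - μ)
        exact abs_le.2 ⟨by linarith, by linarith⟩
    _ = v + (v + 2 * m) := by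
        simp only [mul_add, Finset.sum_add_distrib, ← Finset.sum_mul, hmem.2, ← hv]; ring
    _ ≤ _ := by linarith

end SoftmaxCurve

section Reciprocal

variable {π x p w : A → ℝ} {lam : ℝ}

/-- A bound from below for the denominators `w = η - q` in `p = lam * π / w`: by the Cauchy-Schwarz
inequality `η` exceeds the mean of `q` by at least `lam`, and `q` is close to its mean. -/
lemma half_le_denominator (hlam : 0 < lam) (hπ : π ∈ stdSimplex ℝ A) (hp : p ∈ stdSimplex ℝ A)
    (hw : ∀ a, 0 < w a) (hpw : ∀ a, p a * w a = lam * π a) {η : ℝ} {q : A → ℝ}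
    (hwq : ∀ a, w a = η - q a) (hq : ∀ a, q a - ∑ b, π b * q b ≤ lam / 2) (a : A) :
    lam / 2 ≤ w a := by
  have hmean : lam ≤ ∑ b, π b * w b := by
    have hcs := Finset.sum_sq_le_sum_mul_sum_of_sq_le_mul Finset.univ (r := π)
      (f := fun b => π b * w b) (g := fun b => p b / lam)
      (fun b _ => mul_nonneg (hπ.1 b) (hw b).le) (fun b _ => div_nonneg (hp.1 b) hlam.le)
      (fun b _ => le_of_eq (by
        have : π b = p b * w b / lam := by rw [hpw]; field_simp
        have hwb := hw b
        rw [this]; field_simp))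
    rw [hπ.2, ← Finset.sum_div, hp.2] at hcs
    rw [mul_one_div, le_div_iff₀ hlam] at hcs
    linarith
  have h1 : ∑ b, π b * w b = η - ∑ b, π b * q b := by
    simp only [hwq, mul_sub, Finset.sum_sub_distrib, ← Finset.sum_mul, hπ.2, one_mul]
  have := hq a
  rw [hwq a]
  linarith

variable (hlam : 0 < lam) (hπ : π ∈ stdSimplex ℝ A) (hp : p ∈ stdSimplex ℝ A)
  (hw : ∀ a, lam / 2 ≤ w a) (hpw : ∀ a, p a * w a = lam * π a)

include hlam hp hw

lemma sum_div_le : ∑ a, p a / w a ≤ 2 / lam := by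
  calc ∑ a, p a / w a ≤ ∑ a, p a * (2 / lam) := by
        refine Finset.sum_le_sum fun a _ => ?_
        rw [div_eq_mul_inv]
        refine mul_le_mul_of_nonneg_left ?_ (hp.1 a)
        have h := inv_anti₀ (half_pos hlam) (hw a)
        rwa [inv_div] at h
    _ = _ := by rw [← Finset.sum_mul, hp.2, one_mul]

lemma sum_div_nonneg : 0 ≤ ∑ a, p a / w a :=
  Finset.sum_nonneg fun a _ => div_nonneg (hp.1 a) ((half_pos hlam).le.trans (hw a))

/-- The derivative `η` of the multiplier is determined by the mean `n` of `(η - q) / w`. -/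
lemma abs_multiplier_mul_le {η n N m : ℝ} {q : A → ℝ} (hq : ∀ a, |q a| ≤ m)
    (hn : ∑ a, p a * ((η - q a) / w a) = n) (hN : |n| ≤ N) :
    |η| * ∑ a, p a / w a ≤ N + m * ∑ a, p a / w a := by
  have hW0 := sum_div_nonneg hlam hp hw
  have h1 : η * ∑ a, p a / w a = n + ∑ a, p a / w a * q a := by
    rw [← hn, Finset.mul_sum, ← Finset.sum_add_distrib]
    exact Finset.sum_congr rfl fun a _ => by ring
  have h2 : |∑ a, p a / w a * q a| ≤ m * ∑ a, p a / w a := by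
    rw [mul_comm m, Finset.sum_mul]
    refine (Finset.abs_sum_le_sum_abs _ _).trans (Finset.sum_le_sum fun a _ => ?_)
    have h0 : 0 ≤ p a / w a := div_nonneg (hp.1 a) ((half_pos hlam).le.trans (hw a))
    rw [abs_mul, abs_of_nonneg h0]
    exact mul_le_mul_of_nonneg_left (hq a) h0
  rw [← abs_of_nonneg hW0, ← abs_mul, h1, abs_of_nonneg hW0]
  exact (abs_add_le _ _).trans (add_le_add hN h2)

lemma sum_mul_abs_div_le {η n N m : ℝ} {q : A → ℝ} (hm : 0 ≤ m) (hq : ∀ a, |q a| ≤ m)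
    (hn : ∑ a, p a * ((η - q a) / w a) = n) (hN : |n| ≤ N) :
    ∑ a, p a * |(η - q a) / w a| ≤ N + 4 * m / lam := by
  have h1 := abs_multiplier_mul_le hlam hp hw hq hn hN
  have hW := sum_div_le hlam hp hw
  calc ∑ a, p a * |(η - q a) / w a| ≤ ∑ a, p a / w a * (|η| + m) := by
        refine Finset.sum_le_sum fun a _ => ?_
        have hwa : 0 < w a := (half_pos hlam).trans_le (hw a)
        rw [abs_div, abs_of_pos hwa, mul_div_assoc', div_mul_eq_mul_div]
        gcongr
        · exact hp.1 a
        · exact (abs_sub _ _).trans (by linarith [hq a])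
    _ = |η| * ∑ a, p a / w a + m * ∑ a, p a / w a := by rw [← Finset.sum_mul]; ring
    _ ≤ N + m * (2 / lam) + m * (2 / lam) := by
        have := mul_le_mul_of_nonneg_left hW hm
        linarith
    _ = _ := by ring

include hπ hpw

lemma abs_multiplier_le {η n N m : ℝ} {q : A → ℝ} (hq : ∀ a, |q a| ≤ m)
    (hn : ∑ a, p a * ((η - q a) / w a) = n) (hN : |n| ≤ N) : |η| ≤ lam * N + m := by
  have h1 := abs_multiplier_mul_le hlam hp hw hq hn hN
  have hcs := Finset.sum_sq_le_sum_mul_sum_of_sq_le_mul Finset.univ (r := p)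
    (f := fun b => p b * w b) (g := fun b => p b / w b)
    (fun b _ => mul_nonneg (hp.1 b) ((half_pos hlam).le.trans (hw b)))
    (fun b _ => div_nonneg (hp.1 b) ((half_pos hlam).le.trans (hw b)))
    (fun b _ => le_of_eq (by
      have hwb : 0 < w b := (half_pos hlam).trans_le (hw b)
      field_simp))
  simp only [hpw, ← Finset.mul_sum, hp.2, hπ.2, mul_one, one_pow] at hcs
  have hN0 : 0 ≤ N := (abs_nonneg n).trans hN
  by_contra! hlt
  have hW0 : 0 < ∑ a, p a / w a := by
    by_contra! h
    nlinarith
  have : |η| * ∑ a, p a / w a ≤ (lam * N + m) * ∑ a, p a / w a := by nlinarith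
  exact absurd (le_of_mul_le_mul_right this hW0) (not_le.2 hlt)

/-- Bounds for the first two derivatives of `p = lam * π / (η - q)`, where `x` is the logarithmic
derivative of `π`, and the derivatives of `q` are bounded by `m₁` and `m₂`. -/
lemma reciprocal_response_bounds {κ γ v η₁ η₂ m₁ m₂ : ℝ} {q₁ q₂ p₁ p₂ : A → ℝ}
    (hγ0 : 0 ≤ γ) (hκ : 0 ≤ κ) (hm₁0 : 0 ≤ m₁) (hm₂0 : 0 ≤ m₂)
    (hx : ∑ a, π a * x a = 0) (hv : ∑ a, π a * x a ^ 2 = v) (hvκ : v ≤ κ ^ 2)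
    (hq₁ : ∀ a, |q₁ a| ≤ m₁) (hm₁ : m₁ ≤ γ * κ * lam / 2) (hq₂ : ∀ a, |q₂ a| ≤ m₂)
    (h₁ : ∀ a, p₁ a * w a + p a * (η₁ - q₁ a) = lam * (π a * x a))
    (h₂ : ∀ a, p₂ a * w a + 2 * (p₁ a * (η₁ - q₁ a)) + p a * (η₂ - q₂ a)
      = lam * (π a * (x a ^ 2 - v)))
    (hp₁ : ∑ a, p₁ a = 0) (hp₂ : ∑ a, p₂ a = 0) :
    ∑ a, |p₁ a| ≤ (3 + 2 * γ) * κ ∧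
    ∑ a, |p₂ a| ≤ 2 * (11 + 18 * γ + 12 * γ ^ 2) * κ ^ 2 + 4 * m₂ / lam := by
  have hwpos : ∀ a, 0 < w a := fun a => (half_pos hlam).trans_le (hw a)
  have hv0 : 0 ≤ v := by
    rw [← hv]; exact Finset.sum_nonneg fun a _ => mul_nonneg (hπ.1 a) (sq_nonneg _)
  have habs : ∑ a, π a * |x a| ≤ κ :=
    sum_mul_abs_le_of_sum_mul_sq_le hπ hκ (hv ▸ hvκ)
  have hp2π : ∀ a, p a ≤ 2 * π a := by
    intro a
    have := mul_le_mul_of_nonneg_left (hw a) (hp.1 a)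
    rw [hpw a] at this
    have h : lam * p a ≤ lam * (2 * π a) := by linarith
    exact le_of_mul_le_mul_left h hlam
  -- `y` is the logarithmic derivative of the denominator
  set y : A → ℝ := fun a => (η₁ - q₁ a) / w a with hy
  set ω : A → ℝ := fun a => (η₂ - q₂ a) / w a with hω
  have hp₁eq : ∀ a, p₁ a = p a * (x a - y a) := by
    intro a
    have hwa := (hwpos a).ne'
    have h := h₁ a
    rw [← mul_assoc, ← hpw a] at h
    simp only [hy]
    field_simp
    linarith
  have hp₂eq : ∀ a, p₂ a = p a * ((x a - y a) ^ 2 + y a ^ 2 - v) - p a * ω a := by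
    intro a
    have hwa := (hwpos a).ne'
    have h := h₂ a
    have hη₁ : η₁ - q₁ a = y a * w a := by simp only [hy]; field_simp
    have hη₂ : η₂ - q₂ a = ω a * w a := by simp only [hω]; field_simp
    rw [← mul_assoc lam, ← hpw a, hp₁eq, hη₁, hη₂] at h
    have : (p₂ a - (p a * ((x a - y a) ^ 2 + y a ^ 2 - v) - p a * ω a)) * w a = 0 := by
      linear_combination h
    rcases mul_eq_zero.1 this with h0 | h0
    · linarith
    · exact absurd h0 hwa
  -- first moments
  have he : |∑ a, p a * x a| ≤ κ := by
    have h1 : ∑ a, p a * x a = ∑ a, (p a - π a) * x a := by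
      simp only [sub_mul, Finset.sum_sub_distrib, hx, sub_zero]
    rw [h1]
    refine ((Finset.abs_sum_le_sum_abs _ _).trans (Finset.sum_le_sum fun a _ => ?_)).trans habs
    rw [abs_mul]
    refine mul_le_mul_of_nonneg_right (abs_le.2 ⟨?_, ?_⟩) (abs_nonneg _)
    · linarith [hp.1 a]
    · linarith [hp2π a]
  have hye : ∑ a, p a * y a = ∑ a, p a * x a := by
    have : ∑ a, p a * (x a - y a) = 0 := by
      rw [← hp₁]; exact Finset.sum_congr rfl fun a _ => (hp₁eq a).symm
    simp only [mul_sub, Finset.sum_sub_distrib] at this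
    linarith
  have hm₁' : 4 * m₁ / lam ≤ 2 * γ * κ := by
    rw [div_le_iff₀ hlam]; linarith
  have hyabs : ∑ a, p a * |y a| ≤ κ + 2 * γ * κ :=
    (sum_mul_abs_div_le hlam hp hw hm₁0 hq₁ hye he).trans (by linarith)
  have hη₁ := abs_multiplier_le hlam hπ hp hw hpw hq₁ hye he
  have hymax : ∀ a, |y a| ≤ 2 * κ + 2 * γ * κ := by
    intro a
    simp only [hy]
    rw [abs_div, abs_of_pos (hwpos a), div_le_iff₀ (hwpos a)]
    have h1 : |η₁ - q₁ a| ≤ lam * κ + γ * κ * lam :=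
      (abs_sub _ _).trans (by linarith [hq₁ a])
    have h2 : (2 * κ + 2 * γ * κ) * (lam / 2) ≤ (2 * κ + 2 * γ * κ) * w a :=
      mul_le_mul_of_nonneg_left (hw a) (by positivity)
    linarith
  -- second moments
  have hyy : ∑ a, p a * y a ^ 2 ≤ (2 * κ + 2 * γ * κ) * (κ + 2 * γ * κ) := by
    calc ∑ a, p a * y a ^ 2 ≤ ∑ a, (2 * κ + 2 * γ * κ) * (p a * |y a|) := by
          refine Finset.sum_le_sum fun a _ => ?_
          rw [← sq_abs, sq, mul_left_comm]
          exact mul_le_mul_of_nonneg_right (hymax a) (mul_nonneg (hp.1 a) (abs_nonneg _))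
      _ ≤ _ := by
          rw [← Finset.mul_sum]
          exact mul_le_mul_of_nonneg_left hyabs (by positivity)
  have hxx : ∑ a, p a * x a ^ 2 ≤ 2 * κ ^ 2 := by
    calc ∑ a, p a * x a ^ 2 ≤ ∑ a, 2 * (π a * x a ^ 2) := by
          refine Finset.sum_le_sum fun a _ => ?_
          rw [← mul_assoc]
          exact mul_le_mul_of_nonneg_right (hp2π a) (sq_nonneg _)
      _ ≤ _ := by rw [← Finset.mul_sum, hv]; linarith
  constructor
  · calc ∑ a, |p₁ a| ≤ ∑ a, (2 * (π a * |x a|) + p a * |y a|) := by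
          refine Finset.sum_le_sum fun a _ => ?_
          rw [hp₁eq, abs_mul, abs_of_nonneg (hp.1 a)]
          have h1 := mul_le_mul_of_nonneg_left (abs_sub (x a) (y a)) (hp.1 a)
          have h2 := mul_le_mul_of_nonneg_right (hp2π a) (abs_nonneg (x a))
          linarith
      _ ≤ _ := by
          rw [Finset.sum_add_distrib, ← Finset.mul_sum]
          linarith
  · -- `N` bounds the terms of the second derivative that do not contain `η₂ - q₂`
    set N := (11 + 18 * γ + 12 * γ ^ 2) * κ ^ 2 with hN
    have hmain : ∑ a, p a * ((x a - y a) ^ 2 + y a ^ 2 + v) ≤ N := by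
      calc ∑ a, p a * ((x a - y a) ^ 2 + y a ^ 2 + v)
          ≤ ∑ a, (2 * (p a * x a ^ 2) + 3 * (p a * y a ^ 2) + p a * v) := by
            refine Finset.sum_le_sum fun a _ => ?_
            have := mul_nonneg (hp.1 a) (sq_nonneg (x a + y a))
            linarith
        _ ≤ _ := by
            rw [Finset.sum_add_distrib, Finset.sum_add_distrib, ← Finset.mul_sum, ← Finset.mul_sum,
              ← Finset.sum_mul, hp.2, hN]
            linarith
    have hpt : ∀ a, |p a * ((x a - y a) ^ 2 + y a ^ 2 - v)|
        ≤ p a * ((x a - y a) ^ 2 + y a ^ 2 + v) := by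
      intro a
      rw [abs_mul, abs_of_nonneg (hp.1 a)]
      refine mul_le_mul_of_nonneg_left (abs_le.2 ⟨?_, ?_⟩) (hp.1 a)
      · nlinarith [sq_nonneg (x a - y a), sq_nonneg (y a)]
      · linarith
    have hωn : ∑ a, p a * ω a = ∑ a, p a * ((x a - y a) ^ 2 + y a ^ 2 - v) := by
      have : ∑ a, (p a * ((x a - y a) ^ 2 + y a ^ 2 - v) - p a * ω a) = 0 := by
        rw [← hp₂]; exact Finset.sum_congr rfl fun a _ => (hp₂eq a).symm
      rw [Finset.sum_sub_distrib] at this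
      linarith
    have hnN : |∑ a, p a * ((x a - y a) ^ 2 + y a ^ 2 - v)| ≤ N :=
      ((Finset.abs_sum_le_sum_abs _ _).trans (Finset.sum_le_sum fun a _ => hpt a)).trans hmain
    have hωabs := sum_mul_abs_div_le hlam hp hw hm₂0 hq₂ hωn hnN
    calc ∑ a, |p₂ a| ≤ ∑ a, (p a * ((x a - y a) ^ 2 + y a ^ 2 + v) + p a * |ω a|) := by
          refine Finset.sum_le_sum fun a _ => ?_
          rw [hp₂eq]
          refine (abs_sub _ _).trans (add_le_add (hpt a) ?_)
          rw [abs_mul, abs_of_nonneg (hp.1 a)]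
      _ ≤ N + (N + 4 * m₂ / lam) := by
          rw [Finset.sum_add_distrib]
          exact add_le_add hmain hωabs
      _ = _ := by rw [hN]; ring

end Reciprocal

/-! ### Smoothness of the adapted reward along lines -/

lemma constB_pos {γ lam : ℝ} (hγ1 : γ < 1) (hrmax : 0 < rmax) (hlam : 0 < lam) (i : Order) :
    0 < constB i γ rmax lam := by
  have h1γ : 0 < 1 - γ := by linarith
  cases i <;> simp only [constB] <;> positivity

lemma constG_pos {γ Amax : ℝ} (hγ1 : γ < 1) (hAmax : 0 < Amax) (i : Order) :
    0 < constG i γ Amax := by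
  have h1γ : 0 < 1 - γ := by linarith
  cases i <;> simp only [constG] <;> positivity

section Line

variable [Nonempty A] {γ : ℝ} (hγ0 : 0 ≤ γ) (hγ1 : γ < 1) (hrmax : 0 < rmax) (M : MDP S A rmax)
  {Amax : ℝ} (hAmax : 0 < Amax)
  (hadv : ∀ θ s a, |advantage γ M (softmaxPolicy θ) s a| ≤ Amax)
  {lam : ℝ} (hlam : 2 * Amax ≤ (1 - γ) * lam) (φ v : EuclideanSpace ℝ (S × A))

lemma contDiff_line {n : WithTop ℕ∞} : ContDiff ℝ n fun t : ℝ => φ + t • v := by fun_prop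

lemma contDiff_line_apply (x : S × A) : ContDiff ℝ 2 fun t : ℝ => (φ + t • v) x := by
  simp only [PiLp.add_apply, PiLp.smul_apply, smul_eq_mul]
  fun_prop

lemma deriv_line_apply (x : S × A) (t : ℝ) : deriv (fun t : ℝ => (φ + t • v) x) t = v x := by
  simp only [PiLp.add_apply, PiLp.smul_apply, smul_eq_mul]
  rw [deriv_const_add, deriv_mul_const_field, deriv_id'', one_mul]

lemma deriv_deriv_line_apply (x : S × A) (t : ℝ) :
    deriv (deriv fun t : ℝ => (φ + t • v) x) t = 0 := by
  rw [funext (deriv_line_apply φ v x)]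
  simp

lemma contDiff_softmaxPolicy_line (s : S) (a : A) :
    ContDiff ℝ 2 fun t : ℝ => softmaxPolicy (φ + t • v) s a :=
  (contDiff_softmaxPolicy s a).comp (contDiff_line φ v)

lemma sum_abs_deriv_softmaxPolicy_line_le {κ : ℝ} (hκ : 0 ≤ κ) (hκv : ‖v‖ ^ 2 / 2 = κ ^ 2) (t : ℝ)
    (s : S) : ∑ a, |deriv (fun t : ℝ => softmaxPolicy (φ + t • v) s a) t| ≤ κ := by
  obtain ⟨c, hc⟩ := exists_center v s
  refine sum_abs_deriv_softmaxVec_le (z := fun t a => (φ + t • v) (s, a)) (c := c)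
    (fun a => contDiff_line_apply φ v (s, a)) hκ fun a => ?_
  rw [deriv_line_apply, ← hκv]
  exact hc a

lemma sum_abs_deriv_deriv_softmaxPolicy_line_le {κ : ℝ} (hκv : ‖v‖ ^ 2 / 2 = κ ^ 2)
    (t : ℝ) (s : S) :
    ∑ a, |deriv (deriv fun t : ℝ => softmaxPolicy (φ + t • v) s a) t| ≤ 2 * κ ^ 2 := by
  obtain ⟨c, hc⟩ := exists_center v s
  have := sum_abs_deriv_deriv_softmaxVec_le (z := fun t a => (φ + t • v) (s, a)) (c := c)
    (k := κ) (m := 0) (t := t) (fun a => contDiff_line_apply φ v (s, a)) (fun a => by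
      rw [deriv_line_apply, ← hκv]; exact hc a) (fun a => by
      rw [deriv_deriv_line_apply, abs_zero])
  rwa [mul_zero, add_zero] at this

include hγ1 hAmax hlam in
omit [Nonempty A] in
lemma lam_pos_of_le : 0 < lam := by
  by_contra! h
  nlinarith

include hγ0 hγ1

lemma contDiff_Q_line (s : S) (a : A) :
    ContDiff ℝ 2 fun t : ℝ => Q γ M (softmaxPolicy (φ + t • v)) s a :=
  contDiff_Q hγ0 hγ1 M (contDiff_softmaxPolicy_line φ v) (fun _ => isPolicy_softmaxPolicy _) s a

include hAmax hadv hlam in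
/-- By the policy gradient formula the derivative of `Q` is controlled by the advantages, hence by
`Amax`; the choice of `lam` turns this into a bound on the derivative of `Q / lam` that no longer
depends on `Amax`. Here `κ = ‖v‖ / √2` bounds the total variation speed of the softmax policy. -/
lemma abs_deriv_Q_line_le {κ : ℝ} (hκ : 0 ≤ κ) (hκv : ‖v‖ ^ 2 / 2 = κ ^ 2) (t : ℝ) (s : S) (a : A) :
    |deriv (fun t : ℝ => Q γ M (softmaxPolicy (φ + t • v)) s a) t| ≤ γ * κ * lam / 2 := by
  have hp := contDiff_softmaxPolicy_line φ v
  have hpol : ∀ t : ℝ, IsPolicy (softmaxPolicy (φ + t • v)) := fun _ => isPolicy_softmaxPolicy _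
  have h1γ : 0 < 1 - γ := by linarith
  refine (abs_deriv_Q_le hγ0 hγ1 M hp hpol (mul_nonneg hκ hAmax.le)
    (abs_sum_deriv_mul_Q_le_of_advantage hγ0 hγ1 M hp hpol hAmax.le (hadv _)
      (sum_abs_deriv_softmaxPolicy_line_le φ v hκ hκv t)) s a).trans ?_
  have hassoc : γ * κ * lam / 2 = γ * (κ * lam / 2) := by ring
  rw [hassoc]
  refine mul_le_mul_of_nonneg_left ?_ hγ0
  rw [div_le_iff₀ h1γ]
  have := mul_le_mul_of_nonneg_left hlam hκ
  linarith

include hrmax in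
lemma abs_deriv_deriv_Q_line_le (t : ℝ) (s : S) (a : A) :
    |deriv (deriv fun t : ℝ => Q γ M (softmaxPolicy (φ + t • v)) s a) t|
      ≤ 2 * rmax / (1 - γ) ^ 3 * ‖v‖ ^ 2 := by
  have hp := contDiff_softmaxPolicy_line φ v
  have hpol : ∀ t : ℝ, IsPolicy (softmaxPolicy (φ + t • v)) := fun _ => isPolicy_softmaxPolicy _
  have h1γ : 0 < 1 - γ := by linarith
  have hκ : 0 ≤ √(‖v‖ ^ 2 / 2) := Real.sqrt_nonneg _
  have hκv : ‖v‖ ^ 2 / 2 = √(‖v‖ ^ 2 / 2) ^ 2 := (Real.sq_sqrt (by positivity)).symm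
  refine (abs_deriv_deriv_Q_le hγ0 hγ1 M hp hpol hrmax.le (by positivity) hκ
    (sum_abs_deriv_softmaxPolicy_line_le φ v hκ hκv t)
    (sum_abs_deriv_deriv_softmaxPolicy_line_le φ v hκv t) s a).trans ?_
  rw [← hκv]
  have h1 : rmax * (2 * (‖v‖ ^ 2 / 2)) / (1 - γ) ^ 2
      + 2 * γ * rmax * (‖v‖ ^ 2 / 2) / (1 - γ) ^ 3 = rmax / (1 - γ) ^ 3 * ‖v‖ ^ 2 := by
    field_simp; ring
  rw [h1]
  have h2 : 0 ≤ rmax / (1 - γ) ^ 3 * ‖v‖ ^ 2 := by positivity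
  calc γ * (rmax / (1 - γ) ^ 3 * ‖v‖ ^ 2) ≤ 2 * (rmax / (1 - γ) ^ 3 * ‖v‖ ^ 2) :=
        mul_le_mul_of_nonneg_right (by linarith) h2
    _ = _ := by ring

/-- A Lipschitz constant, in total variation, of the adapted policy as a function of the
meta-parameter. -/
def responseLipschitz (i : Order) : ℝ :=
  match i with
  | .one => 4
  | .two => 2

include hAmax hadv hlam hrmax

/-- Bounds for the first two derivatives of the adapted policy along a line. For `KL(π ‖ ·)` they
come from differentiating the equation `p * (η - Q) = lam * π` twice; for `KL(· ‖ π)` the adapted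
policy is the softmax of `φ + Q / lam`. -/
lemma alg_line_bounds (i : Order) (t : ℝ) (s : S) :
    ∑ a, |deriv (fun t : ℝ => alg i γ lam M (softmaxPolicy (φ + t • v)) s a) t|
      ≤ responseLipschitz i * ‖v‖ ∧
    ∑ a, |deriv (deriv fun t : ℝ => alg i γ lam M (softmaxPolicy (φ + t • v)) s a) t|
      ≤ constB i γ rmax lam * ‖v‖ ^ 2 := by
  have h1γ : 0 < 1 - γ := by linarith
  have hlam0 := lam_pos_of_le hγ1 hAmax hlam
  obtain ⟨κ, hκ, hκv⟩ : ∃ κ : ℝ, 0 ≤ κ ∧ ‖v‖ ^ 2 / 2 = κ ^ 2 :=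
    ⟨√(‖v‖ ^ 2 / 2), Real.sqrt_nonneg _, (Real.sq_sqrt (by positivity)).symm⟩
  have hv0 := norm_nonneg v
  have hQ := contDiff_Q_line hγ0 hγ1 M φ v s
  have hQ₁ := abs_deriv_Q_line_le hγ0 hγ1 M hAmax hadv hlam φ v hκ hκv t s
  have hQ₂ := abs_deriv_deriv_Q_line_le hγ0 hγ1 hrmax M φ v t s
  have hz := fun a => contDiff_line_apply φ v (s, a)
  set m₂ := 2 * rmax / (1 - γ) ^ 3 * ‖v‖ ^ 2 with hm₂
  have hm₂0 : 0 ≤ m₂ := by positivity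
  have hm₂lam : m₂ / lam = 2 * rmax / (lam * (1 - γ) ^ 3) * ‖v‖ ^ 2 := by
    rw [hm₂]; field_simp
  have hr0 : 0 ≤ rmax / (lam * (1 - γ) ^ 3) * ‖v‖ ^ 2 := by positivity
  have hinv : 1 + γ ≤ 1 / (1 - γ) := by
    rw [le_div_iff₀ h1γ]; nlinarith [sq_nonneg γ]
  cases i
  · -- the derivatives of the defining equation `p * (η - Q) = lam * π`
    have hp := fun a => (contDiff_alg .one hγ0 hγ1 hlam0 M (n := 2) (by norm_num) s a).comp
      (contDiff_line φ v)
    set p : ℝ → A → ℝ := fun t => alg .one γ lam M (softmaxPolicy (φ + t • v)) s with hpdef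
    have hp : ∀ a, ContDiff ℝ 2 fun t => p t a := hp
    have hps : ∀ t, p t ∈ stdSimplex ℝ A := fun t => isPolicy_alg .one γ hlam0 M _ s
    set η : ℝ → ℝ := fun t => multiplier lam (taskInput γ M (φ + t • v) s) with hηdef
    have hη : ContDiff ℝ 2 η := (contDiff_multiplier hlam0 (by norm_num)).comp
      ((contDiff_taskInput hγ0 hγ1 M s).comp (contDiff_line φ v))
    set π : ℝ → A → ℝ := fun t => softmaxVec (fun a => (φ + t • v) (s, a)) with hπdef
    have hπ : ∀ a, ContDiff ℝ 2 fun t => π t a := contDiff_softmaxVec_curve hz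
    have hπs : ∀ t, π t ∈ stdSimplex ℝ A := fun t => softmaxVec_mem _
    set q : ℝ → A → ℝ := fun t => Q γ M (softmaxPolicy (φ + t • v)) s with hqdef
    have hwpos : ∀ t a, 0 < η t - q t a := fun t a =>
      sub_pos.2 ((multiplier_spec hlam0 (taskInput γ M (φ + t • v) s)).1 a)
    have hpw : ∀ t a, p t a * (η t - q t a) = lam * π t a := by
      intro t a
      simp only [hpdef, alg_softmaxPolicy .one γ hlam0]
      exact div_mul_cancel₀ _ (hwpos t a).ne'
    have hw : ∀ a, ContDiff ℝ 2 fun t => η t - q t a := fun a => hη.sub (hQ a)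
    -- the mean of `Q` under the meta-policy is `V`, so the advantage bound applies
    have hhalf : ∀ a, lam / 2 ≤ η t - q t a := by
      refine half_le_denominator hlam0 (hπs t) (hps t) (hwpos t) (hpw t) (η := η t) (q := q t)
        (fun a => rfl) fun a => ?_
      have h1 : ∑ b, π t b * q t b = V γ M (softmaxPolicy (φ + t • v)) s :=
        (V_eq_sum_Q hγ0 hγ1 M (isPolicy_softmaxPolicy _) s).symm
      have h2 := (abs_le.1 (hadv (φ + t • v) s a)).2
      rw [advantage] at h2
      rw [h1]
      have : (1 - γ) * lam ≤ lam := by nlinarith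
      simp only [hqdef]
      linarith
    set μ := ∑ b, π t b * v (s, b) with hμ
    obtain ⟨c, hc⟩ := exists_center v s
    simp only [hκv] at hc
    have hvar := sum_mul_sub_mean_sq_le (hπs t) hc
    have hπ₁ : ∀ a, deriv (fun t => π t a) t = π t a * (v (s, a) - μ) := by
      intro a
      have := deriv_softmaxVec hz t a
      simp only [deriv_line_apply] at this
      exact this
    have hπ₂ : ∀ a, deriv (deriv fun t => π t a) t = π t a * ((v (s, a) - μ) ^ 2
        - ∑ b, π t b * (v (s, b) - μ) ^ 2) := by
      intro a
      have := deriv_deriv_softmaxVec hz t a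
      simp only [deriv_line_apply, deriv_deriv_line_apply, mul_zero, Finset.sum_const_zero,
        add_zero, sub_zero] at this
      exact this
    have hmean : ∑ a, π t a * (v (s, a) - μ) = 0 := by
      simp only [mul_sub, Finset.sum_sub_distrib, ← Finset.sum_mul, (hπs t).2, one_mul, ← hμ,
        sub_self]
    have h₁ : ∀ a, deriv (fun t => p t a) t * (η t - q t a)
        + p t a * (deriv η t - deriv (fun t => q t a) t) = lam * (π t a * (v (s, a) - μ)) := by
      intro a
      rw [← hπ₁, ← deriv_const_mul_of_contDiff lam (hπ a), ← deriv_sub_of_contDiff hη (hQ a),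
        ← deriv_mul_of_contDiff (hp a) (hw a)]
      simp only [hpw]
    have h₂ : ∀ a, deriv (deriv fun t => p t a) t * (η t - q t a)
        + 2 * (deriv (fun t => p t a) t * (deriv η t - deriv (fun t => q t a) t))
        + p t a * (deriv (deriv η) t - deriv (deriv fun t => q t a) t)
        = lam * (π t a * ((v (s, a) - μ) ^ 2 - ∑ b, π t b * (v (s, b) - μ) ^ 2)) := by
      intro a
      rw [← hπ₂, ← deriv_deriv_const_mul lam (hπ a), ← deriv_sub_of_contDiff hη (hQ a),
        ← deriv_deriv_sub hη (hQ a), ← deriv_deriv_mul (hp a) (hw a)]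
      simp only [hpw]
    obtain ⟨b₁, b₂⟩ := reciprocal_response_bounds hlam0 (hπs t) (hps t) hhalf (hpw t)
      hγ0 hκ (by positivity) hm₂0 hmean rfl hvar hQ₁ le_rfl hQ₂ h₁ h₂
      (sum_deriv_eq_zero hp (fun t => (hps t).2) t)
      (sum_deriv_deriv_eq_zero hp (fun t => (hps t).2) t)
    constructor
    · refine b₁.trans ?_
      have h5 : (3 + 2 * γ) * κ ≤ 5 * κ := mul_le_mul_of_nonneg_right (by linarith) hκ
      -- `κ = ‖v‖ / √2`, and `25 / 2 ≤ 16`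
      have h4 : 5 * κ ≤ 4 * ‖v‖ := abs_le_of_sq_le_sq' (by nlinarith) (by positivity) |>.2
      exact h5.trans h4
    · refine b₂.trans ?_
      rw [← hκv, mul_div_assoc, hm₂lam]
      have h24 : 11 + 18 * γ + 12 * γ ^ 2 ≤ 24 / (1 - γ) := by
        have : γ ^ 2 ≤ γ := by nlinarith
        have : 24 / (1 - γ) = 24 * (1 / (1 - γ)) := by ring
        nlinarith
      have h3 := mul_le_mul_of_nonneg_right h24 (sq_nonneg ‖v‖)
      have h4 : 0 ≤ 12 / lam * ‖v‖ ^ 2 := by positivity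
      simp only [constB]
      have e1 : 16 * rmax / (lam * (1 - γ) ^ 3) = 16 * (rmax / (lam * (1 - γ) ^ 3)) := by ring
      have e2 : 2 * rmax / (lam * (1 - γ) ^ 3) = 2 * (rmax / (lam * (1 - γ) ^ 3)) := by ring
      rw [e1, e2]
      linarith
  · -- the adapted policy is the softmax of `φ + Q / lam`
    have hy : ∀ a, ContDiff ℝ 2 fun t : ℝ =>
        (φ + t • v) (s, a) + lam⁻¹ * Q γ M (softmaxPolicy (φ + t • v)) s a := fun a =>
      (hz a).add (contDiff_const.mul (hQ a))
    have halg : ∀ t : ℝ, alg .two γ lam M (softmaxPolicy (φ + t • v)) s = softmaxVec fun a =>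
        (φ + t • v) (s, a) + lam⁻¹ * Q γ M (softmaxPolicy (φ + t • v)) s a := by
      intro t
      rw [alg_softmaxPolicy .two γ hlam0]
      funext a
      simp only [response, taskInput, div_eq_inv_mul]
    obtain ⟨c, hc⟩ := exists_center v s
    simp only [hκv] at hc
    have hd : ∀ a, (deriv (fun t : ℝ => (φ + t • v) (s, a)
        + lam⁻¹ * Q γ M (softmaxPolicy (φ + t • v)) s a) t - c) ^ 2 ≤ (3 / 2 * κ) ^ 2 := by
      intro a
      rw [deriv_add_of_contDiff (hz a) (contDiff_const.mul (hQ a)), deriv_line_apply,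
        deriv_const_mul_of_contDiff _ (hQ a)]
      have h1 := abs_le_of_sq_le_sq' (hc a) hκ
      have h2 : |lam⁻¹ * deriv (fun t : ℝ => Q γ M (softmaxPolicy (φ + t • v)) s a) t|
          ≤ κ / 2 := by
        rw [abs_mul, abs_of_pos (inv_pos.2 hlam0), inv_mul_le_iff₀ hlam0]
        refine (hQ₁ a).trans ?_
        have : γ * (κ * lam) ≤ 1 * (κ * lam) :=
          mul_le_mul_of_nonneg_right hγ1.le (by positivity)
        linarith
      have h3 := abs_le.1 h2
      exact sq_le_sq' (by linarith) (by linarith)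
    have hdd : ∀ a, |deriv (deriv fun t : ℝ => (φ + t • v) (s, a)
        + lam⁻¹ * Q γ M (softmaxPolicy (φ + t • v)) s a) t| ≤ m₂ / lam := by
      intro a
      rw [deriv_deriv_add (hz a) (contDiff_const.mul (hQ a)), deriv_deriv_line_apply,
        deriv_deriv_const_mul _ (hQ a), zero_add, abs_mul, abs_of_pos (inv_pos.2 hlam0),
        div_eq_inv_mul]
      exact mul_le_mul_of_nonneg_left (hQ₂ a) (inv_pos.2 hlam0).le
    simp only [halg]
    constructor
    · refine (sum_abs_deriv_softmaxVec_le hy (by positivity) hd).trans ?_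
      have : 3 / 2 * κ ≤ 2 * ‖v‖ := abs_le_of_sq_le_sq' (by nlinarith) (by positivity) |>.2
      exact this
    · refine (sum_abs_deriv_deriv_softmaxVec_le hy hd hdd).trans ?_
      rw [hm₂lam, mul_pow, ← hκv]
      simp only [constB]
      have h18 : 9 / 4 ≤ 18 / (1 - γ) ^ 2 := by
        rw [le_div_iff₀ (by positivity)]
        nlinarith
      have h3 := mul_le_mul_of_nonneg_right h18 (sq_nonneg ‖v‖)
      have e1 : 16 * rmax / (lam * (1 - γ) ^ 3) = 16 * (rmax / (lam * (1 - γ) ^ 3)) := by ring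
      have e2 : 2 * rmax / (lam * (1 - γ) ^ 3) = 2 * (rmax / (lam * (1 - γ) ^ 3)) := by ring
      rw [e1, e2]
      linarith

end Line

/-! ### Stochastic gradient ascent for a family of smooth bounded functions -/

section Ascent

variable {Γ : Type*} [MeasurableSpace Γ] {ι : Type*} [Fintype ι]

open scoped RealInnerProductSpace Gradient

/-- Taylor's inequality along the unit segment. -/
lemma abs_sub_sub_deriv_le {g : ℝ → ℝ} (hg : ContDiff ℝ 2 g) {K : ℝ}
    (hK : ∀ t, |deriv (deriv g) t| ≤ K) : |g 1 - g 0 - deriv g 0| ≤ K / 2 := by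
  have h1 : ∀ t ∈ Set.Icc (0 : ℝ) 1, ‖deriv g t - deriv g 0‖ ≤ K * t := by
    intro t ht
    have hd := hasDerivAt_deriv_of_contDiff_two hg
    refine image_norm_le_of_norm_deriv_right_le_deriv_boundary
      (f := fun t => deriv g t - deriv g 0) (f' := deriv (deriv g)) (B := fun t => K * t)
      (B' := fun _ => K)
      (fun x _ => ((hd x).sub_const _).continuousAt.continuousWithinAt)
      (fun x _ => ((hd x).sub_const _).hasDerivWithinAt) (by simp)
      (fun x => by simpa using (hasDerivAt_id x).const_mul K) (fun x _ => hK x) ht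
  have hd := hasDerivAt_of_contDiff_two hg
  have hd' : ∀ t, HasDerivAt (fun t => g t - g 0 - deriv g 0 * t) (deriv g t - deriv g 0) t := by
    intro t
    have := ((hd t).sub_const (g 0)).fun_sub ((hasDerivAt_id t).const_mul (deriv g 0))
    simpa using this
  have h2 := image_norm_le_of_norm_deriv_right_le_deriv_boundary (a := 0) (b := 1)
      (f := fun t => g t - g 0 - deriv g 0 * t) (f' := fun t => deriv g t - deriv g 0)
      (B := fun t => K / 2 * t ^ 2) (B' := fun t => K * t)
      (fun x _ => (hd' x).continuousAt.continuousWithinAt)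
      (fun x _ => (hd' x).hasDerivWithinAt) (by simp)
      (fun x => by
        have := (hasDerivAt_pow 2 x).const_mul (K / 2)
        convert! this using 1
        simp; ring)
      (fun x hx => h1 x ⟨hx.1, hx.2.le⟩) (Set.right_mem_Icc.2 zero_le_one)
  simpa [Real.norm_eq_abs] using h2

/-- A measurable family of continuously differentiable functions with values in `[0, b]`, gradients
of norm at most `G`, and first-order Taylor remainders of at most `L / 2 * ‖v‖ ^ 2`. -/
structure IsSmoothFamily (f : Γ → EuclideanSpace ℝ ι → ℝ) (b L G : ℝ) : Prop where
  measurable : ∀ x, Measurable fun τ => f τ x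
  nonneg : ∀ τ x, 0 ≤ f τ x
  le : ∀ τ x, f τ x ≤ b
  contDiff : ∀ τ, ContDiff ℝ 1 (f τ)
  taylor : ∀ τ x v, |f τ (x + v) - f τ x - ⟪∇ (f τ) x, v⟫| ≤ L / 2 * ‖v‖ ^ 2
  norm_gradient_le : ∀ τ x, ‖∇ (f τ) x‖ ≤ G

namespace IsSmoothFamily

variable {f : Γ → EuclideanSpace ℝ ι → ℝ} {b L G : ℝ} (hf : IsSmoothFamily f b L G)

include hf

lemma hasGradientAt (τ : Γ) (x : EuclideanSpace ℝ ι) : HasGradientAt (f τ) (∇ (f τ) x) x :=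
  ((hf.contDiff τ).differentiable (by norm_num)).differentiableAt.hasGradientAt

lemma continuous_gradient (τ : Γ) : Continuous (∇ (f τ)) := by
  have := (hf.contDiff τ).continuous_fderiv (by norm_num)
  exact (InnerProductSpace.toDual ℝ _).symm.continuous.comp this

/-- The gradient is measurable in the parameter, as a limit of difference quotients. -/
lemma measurable_gradient (x : EuclideanSpace ℝ ι) : Measurable fun τ => ∇ (f τ) x := by
  classical
  have hcoord : ∀ j, Measurable fun τ => (∇ (f τ) x) j := by
    intro j
    set e := EuclideanSpace.single j (1 : ℝ)
    refine measurable_of_tendsto_metrizable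
      (f := fun (n : ℕ) τ => ((n : ℝ) + 1) * (f τ (x + ((n : ℝ) + 1)⁻¹ • e) - f τ x))
      (fun n => ((hf.measurable _).sub (hf.measurable _)).const_mul _) ?_
    rw [tendsto_pi_nhds]
    intro τ
    have hd : HasDerivAt (fun t : ℝ => f τ (x + t • e)) (⟪∇ (f τ) x, e⟫) 0 := by
      have h1 := (hf.hasGradientAt τ x).hasFDerivAt
      have h2 : HasDerivAt (fun t : ℝ => x + t • e) e 0 := by
        simpa using ((hasDerivAt_id (0 : ℝ)).smul_const e).const_add x
      have h3 : HasFDerivAt (f τ) (InnerProductSpace.toDual ℝ _ (∇ (f τ) x))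
          (x + (0 : ℝ) • e) := by simpa using h1
      simpa using! h3.comp_hasDerivAt (0 : ℝ) h2
    have he : ⟪∇ (f τ) x, e⟫ = (∇ (f τ) x) j := by
      rw [EuclideanSpace.inner_single_right]
      simp
    rw [he] at hd
    have h4 := hd.tendsto_slope_zero
    have h5 : Filter.Tendsto (fun n : ℕ => ((n : ℝ) + 1)⁻¹) Filter.atTop
        (nhdsWithin 0 {0}ᶜ) := by
      refine tendsto_nhdsWithin_iff.2 ⟨?_, Filter.Eventually.of_forall fun n => ?_⟩
      · simpa using tendsto_one_div_add_atTop_nhds_zero_nat (𝕜 := ℝ)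
      · simp only [Set.mem_compl_iff, Set.mem_singleton_iff]; positivity
    have h6 := h4.comp h5
    simpa [Function.comp_def] using h6
  exact (WithLp.measurable_toLp 2 _).comp (measurable_pi_iff.2 hcoord)

lemma measurable_gradient_uncurry :
    Measurable fun y : EuclideanSpace ℝ ι × Γ => ∇ (f y.2) y.1 :=
  measurable_uncurry_of_continuous_of_measurable (u := fun x τ => ∇ (f τ) x)
    (fun τ => hf.continuous_gradient τ) fun x => hf.measurable_gradient x

variable (μ : Measure Γ) [IsProbabilityMeasure μ]

lemma integrable (x : EuclideanSpace ℝ ι) : Integrable (fun τ => f τ x) μ :=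
  Integrable.of_bound (hf.measurable x).aestronglyMeasurable b
    (Filter.Eventually.of_forall fun τ => by
      rw [Real.norm_of_nonneg (hf.nonneg τ x)]; exact hf.le τ x)

lemma integrable_gradient (x : EuclideanSpace ℝ ι) : Integrable (fun τ => ∇ (f τ) x) μ :=
  Integrable.of_bound (hf.measurable_gradient x).aestronglyMeasurable G
    (Filter.Eventually.of_forall fun τ => hf.norm_gradient_le τ x)

lemma mean_nonneg (x : EuclideanSpace ℝ ι) : 0 ≤ ∫ τ, f τ x ∂μ :=
  integral_nonneg fun τ => hf.nonneg τ x

lemma mean_le (x : EuclideanSpace ℝ ι) : ∫ τ, f τ x ∂μ ≤ b := by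
  have := integral_mono (hf.integrable μ x) (integrable_const b) fun τ => hf.le τ x
  simpa using this

lemma mean_taylor_integral (x v : EuclideanSpace ℝ ι) :
    |∫ τ, f τ (x + v) ∂μ - ∫ τ, f τ x ∂μ - ⟪∫ τ, ∇ (f τ) x ∂μ, v⟫| ≤ L / 2 * ‖v‖ ^ 2 := by
  have h1 : ⟪∫ τ, ∇ (f τ) x ∂μ, v⟫ = ∫ τ, ⟪∇ (f τ) x, v⟫ ∂μ := by
    rw [real_inner_comm, ← integral_inner (hf.integrable_gradient μ x)]
    simp only [real_inner_comm]
  have hint : Integrable (fun τ => ⟪∇ (f τ) x, v⟫) μ := by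
    simpa only [real_inner_comm] using (hf.integrable_gradient μ x).const_inner (𝕜 := ℝ) v
  have hsub : Integrable (fun τ => f τ (x + v) - f τ x) μ :=
    (hf.integrable μ _).sub (hf.integrable μ _)
  rw [h1, ← integral_sub (hf.integrable μ _) (hf.integrable μ _), ← integral_sub hsub hint,
    ← Real.norm_eq_abs]
  have := norm_integral_le_of_norm_le_const (μ := μ)
    (f := fun τ => f τ (x + v) - f τ x - ⟪∇ (f τ) x, v⟫)
    (Filter.Eventually.of_forall fun τ => hf.taylor τ x v)
  simpa using this

/-- The mean of the family is differentiable, with the mean of the gradients as its gradient. -/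
lemma hasGradientAt_mean (x : EuclideanSpace ℝ ι) :
    HasGradientAt (fun x => ∫ τ, f τ x ∂μ) (∫ τ, ∇ (f τ) x ∂μ) x := by
  rw [hasGradientAt_iff_isLittleO_nhds_zero]
  refine Asymptotics.IsBigO.trans_isLittleO ?_ (Asymptotics.isLittleO_norm_pow_id one_lt_two)
  refine Asymptotics.IsBigO.of_bound (L / 2) (Filter.Eventually.of_forall fun v => ?_)
  rw [Real.norm_eq_abs, Real.norm_of_nonneg (by positivity)]
  exact hf.mean_taylor_integral μ x v

lemma gradient_mean (x : EuclideanSpace ℝ ι) :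
    ∇ (fun x => ∫ τ, f τ x ∂μ) x = ∫ τ, ∇ (f τ) x ∂μ :=
  (hf.hasGradientAt_mean μ x).gradient

lemma continuous_mean : Continuous fun x => ∫ τ, f τ x ∂μ :=
  continuous_iff_continuousAt.2 fun x => (hf.hasGradientAt_mean μ x).continuousAt

lemma norm_gradient_mean_le (x : EuclideanSpace ℝ ι) : ‖∇ (fun x => ∫ τ, f τ x ∂μ) x‖ ≤ G := by
  rw [hf.gradient_mean μ]
  have := norm_integral_le_of_norm_le_const (μ := μ)
    (Filter.Eventually.of_forall fun τ => hf.norm_gradient_le τ x)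
  simpa using this

lemma measurable_gradient_mean : Measurable (∇ (fun x => ∫ τ, f τ x ∂μ)) := by
  rw [funext (hf.gradient_mean μ)]
  exact (hf.measurable_gradient_uncurry.stronglyMeasurable.integral_prod_right'
    (ν := μ)).measurable

lemma mean_taylor (x v : EuclideanSpace ℝ ι) :
    ∫ τ, f τ x ∂μ + ⟪∇ (fun x => ∫ τ, f τ x ∂μ) x, v⟫ - L / 2 * ‖v‖ ^ 2
      ≤ ∫ τ, f τ (x + v) ∂μ := by
  rw [hf.gradient_mean μ]
  have := (abs_le.1 (hf.mean_taylor_integral μ x v)).1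
  linarith

section Iteration

variable {Ω : Type*} [MeasurableSpace Ω] (Pr : Measure Ω) [IsProbabilityMeasure Pr]
  {τs : ℕ → Ω → Γ} (hτ_meas : ∀ t, Measurable (τs t)) (hτ_indep : iIndepFun τs Pr)
  (hτ_law : ∀ t, Pr.map (τs t) = μ) {α : ℝ} {x₀ : EuclideanSpace ℝ ι}
  {x : ℕ → Ω → EuclideanSpace ℝ ι} (hx₀ : ∀ ω, x 0 ω = x₀)
  (hx : ∀ t ω, x (t + 1) ω = x t ω + α • ∇ (f (τs t ω)) (x t ω))

include hx₀ hx in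
omit hf in
/-- The iterate at time `t` is a function of the first `t` samples. -/
lemma measurable_iterate_past (hf : IsSmoothFamily f b L G) (t : ℕ) :
    Measurable[⨆ k ∈ Set.Iio t, MeasurableSpace.comap (τs k) inferInstance] (x t) := by
  induction t with
  | zero => rw [funext hx₀]; exact measurable_const
  | succ t ih =>
    have hmono : (⨆ k ∈ Set.Iio t, MeasurableSpace.comap (τs k) inferInstance)
        ≤ ⨆ k ∈ Set.Iio (t + 1), MeasurableSpace.comap (τs k) inferInstance :=
      biSup_mono fun k (hk : k < t) => Nat.lt_succ_of_lt hk
    have hτ : Measurable[⨆ k ∈ Set.Iio (t + 1), MeasurableSpace.comap (τs k) inferInstance]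
        (τs t) :=
      measurable_iff_comap_le.2 (le_biSup (fun k => MeasurableSpace.comap (τs k) inferInstance)
        (Nat.lt_succ_self t))
    have ih' := ih.mono hmono le_rfl
    rw [funext (hx t)]
    exact ih'.add ((hf.measurable_gradient_uncurry.comp (ih'.prodMk hτ)).const_smul α)

include hτ_meas hx₀ hx

lemma measurable_iterate (t : ℕ) : Measurable (x t) :=
  (measurable_iterate_past hx₀ hx hf t).mono
    (iSup₂_le fun k _ => (hτ_meas k).comap_le) le_rfl

include hτ_indep in
lemma indepFun_iterate (t : ℕ) : IndepFun (x t) (τs t) Pr := by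
  rw [IndepFun_iff_Indep]
  have h := indep_iSup_of_disjoint (S := Set.Iio t) (T := {t})
    (fun k => (hτ_meas k).comap_le) hτ_indep.iIndep (by simp)
  refine indep_of_indep_of_le_left (indep_of_indep_of_le_right h ?_)
    (measurable_iff_comap_le.1 (measurable_iterate_past hx₀ hx hf t))
  exact le_biSup (fun k => MeasurableSpace.comap (τs k) inferInstance) (Set.mem_singleton t)

include hτ_indep hτ_law in
/-- The stochastic gradient is unbiased. -/
lemma integral_inner_gradient (t : ℕ) :
    ∫ ω, ⟪∇ (fun x => ∫ τ, f τ x ∂μ) (x t ω), ∇ (f (τs t ω)) (x t ω)⟫ ∂Pr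
      = ∫ ω, ‖∇ (fun x => ∫ τ, f τ x ∂μ) (x t ω)‖ ^ 2 ∂Pr := by
  have hxm := hf.measurable_iterate hτ_meas hx₀ hx t
  -- the iterate depends on the earlier samples only, so it is independent of the current one
  have hprod : Pr.map (fun ω => (x t ω, τs t ω)) = (Pr.map (x t)).prod μ := by
    rw [← hτ_law t]
    exact (indepFun_iff_map_prod_eq_prod_map_map hxm.aemeasurable (hτ_meas t).aemeasurable).1
      (hf.indepFun_iterate Pr hτ_meas hτ_indep hx₀ hx t)
  have : IsProbabilityMeasure (Pr.map (x t)) :=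
    Measure.isProbabilityMeasure_map hxm.aemeasurable
  have hG0 : 0 ≤ G := by
    obtain ⟨τ⟩ := nonempty_of_isProbabilityMeasure μ
    exact (norm_nonneg _).trans (hf.norm_gradient_le τ x₀)
  have hmeas : Measurable fun y : EuclideanSpace ℝ ι × Γ =>
      ⟪∇ (fun x => ∫ τ, f τ x ∂μ) y.1, ∇ (f y.2) y.1⟫ :=
    ((hf.measurable_gradient_mean μ).comp measurable_fst).inner hf.measurable_gradient_uncurry
  have hbound : ∀ y : EuclideanSpace ℝ ι × Γ,
      ‖⟪∇ (fun x => ∫ τ, f τ x ∂μ) y.1, ∇ (f y.2) y.1⟫‖ ≤ G * G := fun y =>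
    (norm_inner_le_norm _ _).trans (mul_le_mul (hf.norm_gradient_mean_le μ _)
      (hf.norm_gradient_le _ _) (norm_nonneg _) hG0)
  calc _ = ∫ y, ⟪∇ (fun x => ∫ τ, f τ x ∂μ) y.1, ∇ (f y.2) y.1⟫
        ∂(Pr.map (fun ω => (x t ω, τs t ω))) :=
        (integral_map (hxm.prodMk (hτ_meas t)).aemeasurable hmeas.aestronglyMeasurable).symm
    _ = ∫ z, ∫ τ, ⟪∇ (fun x => ∫ τ, f τ x ∂μ) z, ∇ (f τ) z⟫ ∂μ ∂(Pr.map (x t)) := by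
        rw [hprod]
        exact integral_prod _ (Integrable.of_bound hmeas.aestronglyMeasurable _
          (Filter.Eventually.of_forall hbound))
    _ = ∫ z, ‖∇ (fun x => ∫ τ, f τ x ∂μ) z‖ ^ 2 ∂(Pr.map (x t)) := by
        congr 1
        funext z
        rw [integral_inner (hf.integrable_gradient μ z), ← hf.gradient_mean μ,
          real_inner_self_eq_norm_sq]
    _ = _ := integral_map hxm.aemeasurable
        ((hf.measurable_gradient_mean μ).norm.pow_const 2).aestronglyMeasurable

lemma integrable_sq_norm_gradient (t : ℕ) :
    Integrable (fun ω => ‖∇ (fun x => ∫ τ, f τ x ∂μ) (x t ω)‖ ^ 2) Pr := by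
  have hxm := hf.measurable_iterate hτ_meas hx₀ hx t
  refine Integrable.of_bound
    (((hf.measurable_gradient_mean μ).comp hxm).norm.pow_const 2).aestronglyMeasurable (G ^ 2)
    (Filter.Eventually.of_forall fun ω => ?_)
  rw [Real.norm_of_nonneg (by positivity)]
  exact pow_le_pow_left₀ (norm_nonneg _) (hf.norm_gradient_mean_le μ _) 2

lemma integrable_mean (t : ℕ) : Integrable (fun ω => ∫ τ, f τ (x t ω) ∂μ) Pr := by
  have hxm := hf.measurable_iterate hτ_meas hx₀ hx t
  refine Integrable.of_bound ((hf.continuous_mean μ).measurable.comp hxm).aestronglyMeasurable b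
    (Filter.Eventually.of_forall fun ω => ?_)
  rw [Real.norm_of_nonneg (hf.mean_nonneg μ _)]
  exact hf.mean_le μ _

include hτ_indep hτ_law

/-- One step of stochastic gradient ascent increases the mean of the objective. -/
lemma ascent_step (hα : 0 ≤ α) (hL : 0 ≤ L) (t : ℕ) :
    ∫ ω, (∫ τ, f τ (x t ω) ∂μ) ∂Pr
        + α * ∫ ω, ‖∇ (fun x => ∫ τ, f τ x ∂μ) (x t ω)‖ ^ 2 ∂Pr - L / 2 * α ^ 2 * G ^ 2
      ≤ ∫ ω, (∫ τ, f τ (x (t + 1) ω) ∂μ) ∂Pr := by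
  have hxm := hf.measurable_iterate hτ_meas hx₀ hx t
  have hG0 : 0 ≤ G := by
    obtain ⟨τ⟩ := nonempty_of_isProbabilityMeasure μ
    exact (norm_nonneg _).trans (hf.norm_gradient_le τ x₀)
  have hinner : Integrable (fun ω => ⟪∇ (fun x => ∫ τ, f τ x ∂μ) (x t ω),
      ∇ (f (τs t ω)) (x t ω)⟫) Pr := by
    refine Integrable.of_bound (((hf.measurable_gradient_mean μ).comp hxm).inner
      (hf.measurable_gradient_uncurry.comp (hxm.prodMk (hτ_meas t)))).aestronglyMeasurable (G * G)
      (Filter.Eventually.of_forall fun ω => ?_)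
    exact (norm_inner_le_norm _ _).trans (mul_le_mul (hf.norm_gradient_mean_le μ _)
      (hf.norm_gradient_le _ _) (norm_nonneg _) hG0)
  have hF := hf.integrable_mean μ Pr hτ_meas hx₀ hx
  rw [← hf.integral_inner_gradient μ Pr hτ_meas hτ_indep hτ_law hx₀ hx t,
    ← integral_const_mul, ← integral_add (hF t) (hinner.const_mul α)]
  have hadd : Integrable (fun ω => (∫ τ, f τ (x t ω) ∂μ) + α * ⟪∇ (fun x => ∫ τ, f τ x ∂μ) (x t ω),
      ∇ (f (τs t ω)) (x t ω)⟫) Pr := (hF t).add (hinner.const_mul α)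
  have hc : L / 2 * α ^ 2 * G ^ 2 = ∫ _, L / 2 * α ^ 2 * G ^ 2 ∂Pr := by simp
  rw [hc, ← integral_sub hadd (integrable_const _)]
  refine integral_mono (hadd.sub (integrable_const _)) (hF (t + 1))
    fun ω => ?_
  have h := hf.mean_taylor μ (x t ω) (α • ∇ (f (τs t ω)) (x t ω))
  rw [inner_smul_right, norm_smul, mul_pow, Real.norm_of_nonneg hα] at h
  have hGsq : ‖∇ (f (τs t ω)) (x t ω)‖ ^ 2 ≤ G ^ 2 :=
    pow_le_pow_left₀ (norm_nonneg _) (hf.norm_gradient_le _ _) 2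
  have := mul_le_mul_of_nonneg_left hGsq (show 0 ≤ L / 2 * α ^ 2 by positivity)
  simp only [hx]
  linarith

/-- The gradients along stochastic gradient ascent are small on average. -/
lemma sum_integral_sq_norm_gradient_le (hα : 0 ≤ α) (hL : 0 ≤ L) (T : ℕ) :
    α * ∑ t ∈ Finset.Icc 1 T, ∫ ω, ‖∇ (fun x => ∫ τ, f τ x ∂μ) (x t ω)‖ ^ 2 ∂Pr
      ≤ b + T * (L / 2 * α ^ 2 * G ^ 2) := by
  have hF := hf.integrable_mean μ Pr hτ_meas hx₀ hx
  have htel : ∀ T : ℕ,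
      α * ∑ t ∈ Finset.Icc 1 T, ∫ ω, ‖∇ (fun x => ∫ τ, f τ x ∂μ) (x t ω)‖ ^ 2 ∂Pr
      ≤ ∫ ω, (∫ τ, f τ (x (T + 1) ω) ∂μ) ∂Pr - ∫ ω, (∫ τ, f τ (x 1 ω) ∂μ) ∂Pr
        + T * (L / 2 * α ^ 2 * G ^ 2) := by
    intro T
    induction T with
    | zero => simp
    | succ T ih =>
      rw [Finset.sum_Icc_succ_top (by omega), mul_add]
      have := hf.ascent_step μ Pr hτ_meas hτ_indep hτ_law hx₀ hx hα hL (T + 1)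
      push_cast
      linarith
  have h1 : ∫ ω, (∫ τ, f τ (x (T + 1) ω) ∂μ) ∂Pr ≤ b := by
    have := integral_mono (hF (T + 1)) (integrable_const b) fun ω => hf.mean_le μ (x (T + 1) ω)
    simpa using this
  have h2 : 0 ≤ ∫ ω, (∫ τ, f τ (x 1 ω) ∂μ) ∂Pr := integral_nonneg fun ω => hf.mean_nonneg μ _
  have := htel T
  linarith

end Iteration

end IsSmoothFamily

end Ascent

open scoped RealInnerProductSpace Gradient

/-! ### Measurability in the task -/

section Measurability

variable {Γ : Type*} [MeasurableSpace Γ] {M : Γ → MDP S A rmax}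
  (hρ : ∀ s, Measurable fun τ => (M τ).ρ s)
  (hP : ∀ s a s', Measurable fun τ => (M τ).P s a s')
  (hr : ∀ s a s', Measurable fun τ => (M τ).r s a s')
  {γ : ℝ} (hγ0 : 0 ≤ γ) (hγ1 : γ < 1)

include hP

lemma measurable_pairLaw {p μ : Γ → S → A → ℝ} (hp : ∀ s a, Measurable fun τ => p τ s a)
    (hμ : ∀ s a, Measurable fun τ => μ τ s a) (t : ℕ) (s : S) (a : A) :
    Measurable fun τ => pairLaw (M τ) (p τ) (μ τ) t s a := by
  induction t generalizing s a with
  | zero => exact hμ s a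
  | succ t ih =>
    exact (Finset.measurable_fun_sum _ fun s' _ => Finset.measurable_fun_sum _ fun a' _ =>
      (ih s' a').mul (hP s' a' s)).mul (hp s a)

include hr hγ0 hγ1

lemma measurable_V {p : Γ → S → A → ℝ} (hp : ∀ s a, Measurable fun τ => p τ s a)
    (hpol : ∀ τ, IsPolicy (p τ)) (s : S) : Measurable fun τ => V γ (M τ) (p τ) s := by
  classical
  set μ₀ : Γ → S → A → ℝ := fun τ s₀ a₀ => if s₀ = s then p τ s₀ a₀ else 0 with hμ₀
  have hμ0 : ∀ τ s a, 0 ≤ μ₀ τ s a := by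
    intro τ s₀ a
    simp only [hμ₀]
    split_ifs
    · exact (hpol τ).nonneg _ _
    · exact le_rfl
  have hμm : ∀ s a, Measurable fun τ => μ₀ τ s a := by
    intro s₀ a
    by_cases h : s₀ = s
    · simpa only [hμ₀, if_pos h] using hp s₀ a
    · simp only [hμ₀, if_neg h, measurable_const]
  refine measurable_of_tendsto_metrizable
    (f := fun n τ => ∑ t ∈ Finset.range n, γ ^ t * ∑ s, ∑ a,
      pairLaw (M τ) (p τ) (μ₀ τ) t s a * meanReward (M τ) s a) (fun n => ?_) ?_
  · refine Finset.measurable_fun_sum _ fun t _ => Measurable.const_mul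
      (Finset.measurable_fun_sum _ fun s' _ => Finset.measurable_fun_sum _ fun a' _ => ?_) _
    exact (measurable_pairLaw hP hp hμm t s' a').mul
      (Finset.measurable_fun_sum _ fun s'' _ => (hP _ _ _).mul (hr _ _ _))
  · rw [tendsto_pi_nhds]
    intro τ
    have h := (summable_pairLaw hγ0 hγ1 (M τ) (hpol τ) (hμ0 τ) (meanReward (M τ))).hasSum
    rw [← discountedReturn_eq_tsum] at h
    have h2 : discountedReturn γ (M τ) (p τ) (μ₀ τ) = V γ (M τ) (p τ) s := by
      simp only [V, hμ₀]
    rw [h2] at h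
    exact h.tendsto_sum_nat

lemma measurable_Q {p : Γ → S → A → ℝ} (hp : ∀ s a, Measurable fun τ => p τ s a)
    (hpol : ∀ τ, IsPolicy (p τ)) (s : S) (a : A) : Measurable fun τ => Q γ (M τ) (p τ) s a := by
  simp only [fun τ => Q_eq hγ0 hγ1 (M τ) (hpol τ) s a]
  exact (Finset.measurable_fun_sum _ fun s'' _ => (hP _ _ _).mul (hr _ _ _)).add
    ((Finset.measurable_fun_sum _ fun s' _ =>
      (hP s a s').mul (measurable_V hP hr hγ0 hγ1 hp hpol s')).const_mul γ)

include hρ in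
lemma measurable_J {p : Γ → S → A → ℝ} (hp : ∀ s a, Measurable fun τ => p τ s a)
    (hpol : ∀ τ, IsPolicy (p τ)) : Measurable fun τ => J γ (M τ) (p τ) :=
  Finset.measurable_fun_sum _ fun s _ => (hρ s).mul (measurable_V hP hr hγ0 hγ1 hp hpol s)

include hρ in
lemma measurable_adaptedReward [Nonempty A] (i : Order) {lam : ℝ} (hlam : 0 < lam)
    (φ : EuclideanSpace ℝ (S × A)) : Measurable fun τ => adaptedReward i γ lam (M τ) φ := by
  refine measurable_J hρ hP hr hγ0 hγ1 (fun s a => ?_) fun τ => isPolicy_alg i γ hlam (M τ) φ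
  have hin : Measurable fun τ => taskInput γ (M τ) φ s := by
    refine Measurable.prodMk measurable_const (measurable_pi_iff.2 fun a => ?_)
    exact measurable_Q hP hr hγ0 hγ1 (p := fun _ => softmaxPolicy φ) (fun _ _ => measurable_const)
      (fun _ => isPolicy_softmaxPolicy φ) s a
  have hres : Measurable fun x : (A → ℝ) × (A → ℝ) => response i lam x a :=
    (contDiff_response i hlam (n := 1) one_ne_zero a).continuous.measurable
  simp only [alg_softmaxPolicy i γ hlam]
  exact hres.comp hin

end Measurability

/-! ### The adapted rewards form a smooth family -/

/-- The Lipschitz constant of the gradient of the adapted reward; the step size is at most its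
inverse. -/
noncomputable def smoothnessConst (i : Order) (γ rmax lam : ℝ) : ℝ :=
  rmax * constB i γ rmax lam / (1 - γ) ^ 2 + 2 * γ * rmax * constC i γ ^ 2 / (1 - γ) ^ 3

section Smoothness

variable [Nonempty A] {γ : ℝ} (hγ0 : 0 ≤ γ) (hγ1 : γ < 1) (hrmax : 0 < rmax) (M : MDP S A rmax)
  {Amax : ℝ} (hAmax : 0 < Amax)
  (hadv : ∀ θ s a, |advantage γ M (softmaxPolicy θ) s a| ≤ Amax)
  {lam : ℝ} (hlam : 2 * Amax ≤ (1 - γ) * lam) (i : Order) (φ v : EuclideanSpace ℝ (S × A))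

lemma responseLipschitz_pos : 0 < responseLipschitz i := by
  cases i <;> norm_num [responseLipschitz]

include hγ0 hγ1

omit [Nonempty A] in
lemma responseLipschitz_le_constC : responseLipschitz i ≤ constC i γ := by
  have h1γ : 0 < 1 - γ := by linarith
  cases i <;> simp only [responseLipschitz, constC] <;> rw [le_div_iff₀ h1γ] <;> linarith

include hAmax in
omit [Nonempty A] in
lemma responseLipschitz_mul_le_constG :
    responseLipschitz i * Amax / (1 - γ) ≤ constG i γ Amax := by
  have h1γ : 0 < 1 - γ := by linarith
  have hsq : (1 - γ) ^ 2 ≤ 1 - γ := by nlinarith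
  cases i <;> simp only [responseLipschitz, constG] <;> gcongr

include hrmax hAmax hadv hlam

lemma abs_deriv_adaptedReward_line_le (t : ℝ) :
    |deriv (fun t : ℝ => adaptedReward i γ lam M (φ + t • v)) t| ≤ constG i γ Amax * ‖v‖ := by
  have hlam0 := lam_pos_of_le hγ1 hAmax hlam
  have h1γ : 0 < 1 - γ := by linarith
  have hb := alg_line_bounds hγ0 hγ1 hrmax M hAmax hadv hlam φ v i t
  -- the adapted policy is itself a softmax policy, so its advantage is bounded
  have hadv' : ∀ s a, |advantage γ M (alg i γ lam M (softmaxPolicy (φ + t • v))) s a| ≤ Amax := by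
    intro s a
    obtain ⟨θ, hθ⟩ := exists_softmaxPolicy_eq (isPolicy_alg i γ hlam0 M (φ + t • v))
      fun s => (isResponse_alg i γ hlam0 M (φ + t • v) s).2.1
    rw [← hθ]
    exact hadv θ s a
  have h := abs_deriv_J_le hγ0 hγ1 M
    (p := fun t : ℝ => alg i γ lam M (softmaxPolicy (φ + t • v)))
    (fun s a => (contDiff_alg i hγ0 hγ1 hlam0 M (n := 2) (by norm_num) s a).comp
      (contDiff_line φ v))
    (fun t => isPolicy_alg i γ hlam0 M _) hAmax.le
    (mul_nonneg (responseLipschitz_pos i).le (norm_nonneg v)) hadv' fun s => (hb s).1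
  refine h.trans ?_
  have h2 := mul_le_mul_of_nonneg_right
    (responseLipschitz_mul_le_constG hγ0 hγ1 hAmax i) (norm_nonneg v)
  refine le_trans (le_of_eq ?_) h2
  ring

lemma abs_deriv_deriv_adaptedReward_line_le (t : ℝ) :
    |deriv (deriv fun t : ℝ => adaptedReward i γ lam M (φ + t • v)) t|
      ≤ smoothnessConst i γ rmax lam * ‖v‖ ^ 2 := by
  have hlam0 := lam_pos_of_le hγ1 hAmax hlam
  have h1γ : 0 < 1 - γ := by linarith
  have hB := constB_pos hγ1 hrmax hlam0 i
  have hb := alg_line_bounds hγ0 hγ1 hrmax M hAmax hadv hlam φ v i t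
  have hC := mul_le_mul_of_nonneg_right (responseLipschitz_le_constC hγ0 hγ1 i) (norm_nonneg v)
  have h := abs_deriv_deriv_J_le hγ0 hγ1 M
    (p := fun t : ℝ => alg i γ lam M (softmaxPolicy (φ + t • v)))
    (fun s a => (contDiff_alg i hγ0 hγ1 hlam0 M (n := 2) (by norm_num) s a).comp
      (contDiff_line φ v))
    (fun t => isPolicy_alg i γ hlam0 M _) hrmax.le (B := constB i γ rmax lam * ‖v‖ ^ 2)
    (C := constC i γ * ‖v‖) (by positivity)
    ((mul_nonneg (responseLipschitz_pos i).le (norm_nonneg v)).trans hC)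
    (fun s => (hb s).1.trans hC) fun s => (hb s).2
  refine h.trans (le_of_eq ?_)
  rw [smoothnessConst]
  ring

lemma deriv_adaptedReward_line_zero :
    deriv (fun t : ℝ => adaptedReward i γ lam M (φ + t • v)) 0
      = ⟪∇ (adaptedReward i γ lam M) φ, v⟫ := by
  have hlam0 := lam_pos_of_le hγ1 hAmax hlam
  have h1 : HasGradientAt (adaptedReward i γ lam M) (∇ (adaptedReward i γ lam M) φ)
      (φ + (0 : ℝ) • v) := by
    rw [zero_smul, add_zero]
    exact ((contDiff_adaptedReward i hγ0 hγ1 hlam0 M (n := 1) one_ne_zero).differentiable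
      one_ne_zero).differentiableAt.hasGradientAt
  have h2 : HasDerivAt (fun t : ℝ => φ + t • v) v 0 := by
    simpa using ((hasDerivAt_id (0 : ℝ)).smul_const v).const_add φ
  have h3 := (h1.hasFDerivAt.comp_hasDerivAt (0 : ℝ) h2).deriv
  rw [InnerProductSpace.toDual_apply_apply] at h3
  exact h3

lemma abs_adaptedReward_taylor_le :
    |adaptedReward i γ lam M (φ + v) - adaptedReward i γ lam M φ
      - ⟪∇ (adaptedReward i γ lam M) φ, v⟫| ≤ smoothnessConst i γ rmax lam / 2 * ‖v‖ ^ 2 := by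
  have hlam0 := lam_pos_of_le hγ1 hAmax hlam
  have h := abs_sub_sub_deriv_le
    ((contDiff_adaptedReward i hγ0 hγ1 hlam0 M (n := 2) (by norm_num)).comp (contDiff_line φ v))
    (abs_deriv_deriv_adaptedReward_line_le hγ0 hγ1 hrmax M hAmax hadv hlam i φ v)
  have h0 := deriv_adaptedReward_line_zero hγ0 hγ1 hrmax M hAmax hadv hlam i φ v
  simp only [Function.comp_def, one_smul, zero_smul, add_zero, h0] at h
  refine h.trans (le_of_eq ?_)
  ring

lemma norm_gradient_adaptedReward_le :
    ‖∇ (adaptedReward i γ lam M) φ‖ ≤ constG i γ Amax := by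
  set g := ∇ (adaptedReward i γ lam M) φ with hg
  have h := abs_deriv_adaptedReward_line_le hγ0 hγ1 hrmax M hAmax hadv hlam i φ g 0
  rw [deriv_adaptedReward_line_zero hγ0 hγ1 hrmax M hAmax hadv hlam i φ g, ← hg,
    real_inner_self_eq_norm_sq, abs_of_nonneg (sq_nonneg _), sq] at h
  rcases (norm_nonneg g).eq_or_lt with h0 | h0
  · rw [← h0]
    exact (constG_pos hγ1 hAmax i).le
  · exact le_of_mul_le_mul_right h h0

end Smoothness

section MetaObjective

variable [Nonempty A] {Γ : Type*} [MeasurableSpace Γ] {M : Γ → MDP S A rmax}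
  (hρ : ∀ s, Measurable fun τ => (M τ).ρ s)
  (hP : ∀ s a s', Measurable fun τ => (M τ).P s a s')
  (hr : ∀ s a s', Measurable fun τ => (M τ).r s a s')
  {γ : ℝ} (hγ0 : 0 ≤ γ) (hγ1 : γ < 1) (hrmax : 0 < rmax)
  {Amax : ℝ} (hAmax : 0 < Amax)
  (hadv : ∀ τ θ s a, |advantage γ (M τ) (softmaxPolicy θ) s a| ≤ Amax)

include hρ hP hr hγ0 hγ1 hrmax hAmax hadv

/-- The adapted rewards satisfy the hypotheses of stochastic gradient ascent, with the constants of
the step size. -/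
lemma isSmoothFamily_adaptedReward {lam : ℝ} (hlam0 : 0 < lam)
    (hlam : 2 * Amax ≤ (1 - γ) * lam) (i : Order) :
    IsSmoothFamily (fun τ => adaptedReward i γ lam (M τ)) (rmax / (1 - γ))
      (smoothnessConst i γ rmax lam) (constG i γ Amax) where
  measurable φ := measurable_adaptedReward hρ hP hr hγ0 hγ1 i hlam0 φ
  nonneg τ φ := J_nonneg hγ0 hγ1 (M τ) (isPolicy_alg i γ hlam0 (M τ) φ)
  le τ φ := J_le hγ0 hγ1 (M τ) (isPolicy_alg i γ hlam0 (M τ) φ)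
  contDiff τ := contDiff_adaptedReward i hγ0 hγ1 hlam0 (M τ) one_ne_zero
  taylor τ φ v := abs_adaptedReward_taylor_le hγ0 hγ1 hrmax (M τ) hAmax (hadv τ) hlam i φ v
  norm_gradient_le τ φ := norm_gradient_adaptedReward_le hγ0 hγ1 hrmax (M τ) hAmax (hadv τ) hlam i φ

end MetaObjective

/-! ### The comparison of the meta-objective with the optimal rewards -/

lemma isPolicy_of_mem_policyClass [Nonempty A] {Θ : Set (EuclideanSpace ℝ (S × A))}
    {π : S → A → ℝ} (hπ : π ∈ policyClass Θ) : IsPolicy π := by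
  have hclosed : IsClosed {π : S → A → ℝ | IsPolicy π} := by
    have : {π : S → A → ℝ | IsPolicy π} = Set.pi Set.univ fun _ => stdSimplex ℝ A := by
      ext π; simp [IsPolicy]
    rw [this]
    exact isClosed_set_pi fun s _ => isClosed_stdSimplex ℝ A
  refine closure_minimal ?_ hclosed hπ
  rintro _ ⟨θ, _, rfl⟩
  exact isPolicy_softmaxPolicy θ

/-- If the squared distance is finite, the adapted policy loses at most a multiple of it; if it is
infinite there is nothing to prove. -/
lemma ofReal_gap_le_sqDist [Nonempty S] [Nonempty A] {γ : ℝ} (hγ0 : 0 ≤ γ) (hγ1 : γ < 1)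
    (M : MDP S A rmax) {Amax ε : ℝ} (hAmax : 0 < Amax) (hε : 0 < ε)
    {θ : EuclideanSpace ℝ (S × A)} (hadv : ∀ s a, |advantage γ M (softmaxPolicy θ) s a| ≤ Amax)
    (hvisit : ∀ s, ε ≤ visitation γ M (softmaxPolicy θ) s) (i : Order) {π' : S → A → ℝ}
    (hπ' : IsPolicy π') :
    ENNReal.ofReal ((J γ M π' - adaptedReward i γ (regWeight γ Amax ε) M θ)
        / ((1 + γ) / (1 - γ) * regWeight γ Amax ε))
      ≤ sqDist i γ M (softmaxPolicy θ) π' := by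
  have h1γ : 0 < 1 - γ := by linarith
  have hlam : 0 < regWeight γ Amax ε := by unfold regWeight; positivity
  set π := softmaxPolicy θ with hπdef
  have hπ : IsPolicy π := isPolicy_softmaxPolicy θ
  have hpos : ∀ s a, 0 < π s a := softmaxPolicy_pos θ
  by_cases hfin : ∀ s, FiniteDist i (π s) (π' s)
  · have h := J_sub_J_response_le hγ0 hγ1 M hπ hpos hπ' hε hAmax hadv hvisit
      (isResponse_alg i γ hlam M θ) hfin
    have hν0 : ∀ s, 0 ≤ visitation γ M π s := visitation_nonneg hγ0 hγ1 M hπ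
    have hsq : sqDist i γ M π π'
        = ENNReal.ofReal (∑ s, visitation γ M π s * sqDistReal i (π s) (π' s)) := by
      rw [sqDist, ENNReal.ofReal_sum_of_nonneg fun s _ =>
        mul_nonneg (hν0 s) (sqDistReal_nonneg (hπ s) (hπ' s) (hfin s))]
      refine Finset.sum_congr rfl fun s _ => ?_
      rw [sqDistAction_of_finite (hfin s), ENNReal.ofReal_mul (hν0 s)]
    rw [hsq]
    refine ENNReal.ofReal_le_ofReal ?_
    rw [div_le_iff₀ (by positivity), mul_comm]
    exact h
  · push Not at hfin
    obtain ⟨s, hs⟩ := hfin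
    have : sqDist i γ M π π' = ⊤ := by
      refine ENNReal.sum_eq_top.2 ⟨s, Finset.mem_univ s, ?_⟩
      rw [sqDistAction_of_not_finite hs]
      exact ENNReal.mul_top (ENNReal.ofReal_pos.2 (hε.trans_le (hvisit s))).ne'
    rw [this]
    exact le_top

/-- A concave monotone function on `[0, ∞)` has an affine majorant with nonnegative slope touching
it at an interior point. -/
lemma exists_affine_majorant {h : ℝ → ℝ} (h_concave : ConcaveOn ℝ (Set.Ici 0) h)
    (h_mono : MonotoneOn h (Set.Ici 0)) {m : ℝ} (hm : 0 < m) :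
    ∃ c, 0 ≤ c ∧ ∀ x, 0 ≤ x → h x ≤ h m + c * (x - m) := by
  set slopes : Set ℝ := (fun x => (h m - h x) / (m - x)) '' Set.Ico 0 m with hslopes
  have hne : slopes.Nonempty := ⟨_, 0, ⟨le_rfl, hm⟩, rfl⟩
  have hlb : ∀ y ∈ slopes, 0 ≤ y := by
    rintro _ ⟨x, hx, rfl⟩
    exact div_nonneg (sub_nonneg.2 (h_mono hx.1 hm.le hx.2.le)) (sub_nonneg.2 hx.2.le)
  refine ⟨sInf slopes, le_csInf hne hlb, fun x hx => ?_⟩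
  rcases lt_trichotomy x m with hlt | rfl | hgt
  · have h1 : sInf slopes ≤ (h m - h x) / (m - x) :=
      csInf_le ⟨0, hlb⟩ ⟨x, ⟨hx, hlt⟩, rfl⟩
    rw [le_div_iff₀ (sub_pos.2 hlt)] at h1
    linarith
  · simp
  · have h1 : (h x - h m) / (x - m) ≤ sInf slopes := by
      refine le_csInf hne ?_
      rintro _ ⟨y, hy, rfl⟩
      exact h_concave.slope_anti_adjacent hy.1 hx hy.2 hgt
    rw [div_le_iff₀ (sub_pos.2 hgt)] at h1
    linarith

/-! ### The averaged optimality gap -/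

/-- The ascent inequality, divided by the step size, gives the rate of the theorem: the two terms
of the step size bound its inverse by their sum, and each of them bounds it from above. -/
lemma average_le_of_ascent {i : Order} {γ rmax Amax lam : ℝ} (hγ0 : 0 ≤ γ) (hγ1 : γ < 1)
    (hrmax : 0 < rmax) (hAmax : 0 < Amax) (hlam0 : 0 < lam) {T : ℕ} (hT : 1 ≤ T) {g : ℝ}
    (h : stepSize i γ rmax Amax lam T * g ≤ rmax / (1 - γ) + T *
      (smoothnessConst i γ rmax lam / 2 * stepSize i γ rmax Amax lam T ^ 2
        * constG i γ Amax ^ 2)) :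
    1 / (T : ℝ) * g ≤ constK i γ rmax lam / T + constM i γ rmax Amax lam / Real.sqrt T := by
  have hD : 0 < 1 - γ := by linarith
  have hD1 : 1 - γ ≤ 1 := by linarith
  have hB : 0 < constB i γ rmax lam := constB_pos hγ1 hrmax hlam0 i
  have hC : 1 ≤ constC i γ := by
    cases i <;> simp only [constC] <;> rw [le_div_iff₀ hD] <;> linarith
  have hG : 0 < constG i γ Amax := constG_pos hγ1 hAmax i
  set D := 1 - γ with hDdef
  set B := constB i γ rmax lam
  set C := constC i γ
  set G := constG i γ Amax with hGdef
  set L := smoothnessConst i γ rmax lam with hLdef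
  have hLeq : L = rmax * B / D ^ 2 + 2 * γ * rmax * C ^ 2 / D ^ 3 := rfl
  have hL : 0 < L := by rw [hLeq]; positivity
  have hLle : L ≤ rmax * (B + 2 * C ^ 2) / D ^ 3 := by
    have h1 : rmax * B / D ^ 2 ≤ rmax * B / D ^ 3 :=
      div_le_div_of_nonneg_left (by positivity) (by positivity)
        (pow_le_pow_of_le_one hD.le hD1 (by norm_num))
    have h2 : 2 * γ * rmax * C ^ 2 / D ^ 3 ≤ rmax * (2 * C ^ 2) / D ^ 3 := by
      refine div_le_div_of_nonneg_right ?_ (by positivity)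
      have : γ * (rmax * C ^ 2) ≤ 1 * (rmax * C ^ 2) :=
        mul_le_mul_of_nonneg_right hγ1.le (by positivity)
      linarith
    rw [hLeq, mul_add, add_div]
    exact add_le_add h1 h2
  have hTpos : (0 : ℝ) < T := by exact_mod_cast hT
  have hsq : 0 < Real.sqrt T := Real.sqrt_pos.2 hTpos
  have hsqT : Real.sqrt T * Real.sqrt T = T := Real.mul_self_sqrt hTpos.le
  have hαdef : stepSize i γ rmax Amax lam T = min L⁻¹ (1 / (G * Real.sqrt T)) := rfl
  set α := stepSize i γ rmax Amax lam T
  have hα : 0 < α := by rw [hαdef]; exact lt_min (inv_pos.2 hL) (by positivity)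
  have hα2 : α * (G * Real.sqrt T) ≤ 1 := by
    rw [← le_div_iff₀ (by positivity), hαdef]; exact min_le_right _ _
  have hαinv : 1 ≤ α * (L + G * Real.sqrt T) := by
    rcases min_choice L⁻¹ (1 / (G * Real.sqrt T)) with hm | hm
    · have : α * L = 1 := by rw [hαdef, hm]; exact inv_mul_cancel₀ hL.ne'
      nlinarith [mul_pos hα (mul_pos hG hsq)]
    · have : α * (G * Real.sqrt T) = 1 := by
        rw [hαdef, hm]; exact one_div_mul_cancel (by positivity)
      nlinarith [mul_pos hα hL]
  -- divide the hypothesis by `α`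
  have hsum : g ≤ rmax / D * (L + G * Real.sqrt T) + L / 2 * G * Real.sqrt T := by
    refine le_of_mul_le_mul_left (h.trans ?_) hα
    have h1 : rmax / D * 1 ≤ rmax / D * (α * (L + G * Real.sqrt T)) :=
      mul_le_mul_of_nonneg_left hαinv (by positivity)
    have h2 : T * (L / 2 * α ^ 2 * G ^ 2)
        = (L / 2 * α * G * Real.sqrt T) * (α * (G * Real.sqrt T)) := by
      linear_combination -(L / 2 * α ^ 2 * G ^ 2) * hsqT
    have h3 : (L / 2 * α * G * Real.sqrt T) * (α * (G * Real.sqrt T))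
        ≤ (L / 2 * α * G * Real.sqrt T) * 1 :=
      mul_le_mul_of_nonneg_left hα2 (by positivity)
    rw [h2]
    linarith
  have hK : rmax / D * L ≤ constK i γ rmax lam := by
    calc rmax / D * L ≤ rmax / D * (rmax * (B + 2 * C ^ 2) / D ^ 3) :=
          mul_le_mul_of_nonneg_left hLle (by positivity)
      _ = (B + 2 * C ^ 2) * rmax ^ 2 / D ^ 4 := by field_simp
      _ ≤ 2 * ((B + 2 * C ^ 2) * rmax ^ 2 / D ^ 4) := by
          have : 0 ≤ (B + 2 * C ^ 2) * rmax ^ 2 / D ^ 4 := by positivity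
          linarith
      _ = constK i γ rmax lam := by simp only [constK]; ring
  have hM : rmax / D * G + L / 2 * G ≤ constM i γ rmax Amax lam := by
    have h1 : rmax / D ≤ (B + 2 * C ^ 2) * rmax / (2 * D ^ 4) := by
      rw [div_le_div_iff₀ hD (by positivity)]
      -- this uses `1 ≤ C`
      have hX : 2 ≤ B + 2 * C ^ 2 := by nlinarith
      have hD4 : D ^ 4 ≤ D := by
        have := pow_le_pow_of_le_one hD.le hD1 (show 1 ≤ 4 by norm_num)
        rwa [pow_one] at this
      calc rmax * (2 * D ^ 4) ≤ rmax * (2 * D) := by gcongr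
        _ = 2 * rmax * D := by ring
        _ ≤ (B + 2 * C ^ 2) * rmax * D := by gcongr
    have h2 : L / 2 ≤ (B + 2 * C ^ 2) * rmax / (2 * D ^ 4) := by
      have : rmax * (B + 2 * C ^ 2) / D ^ 3 ≤ rmax * (B + 2 * C ^ 2) / D ^ 4 :=
        div_le_div_of_nonneg_left (by positivity) (by positivity)
          (pow_le_pow_of_le_one hD.le hD1 (by norm_num))
      have e : (B + 2 * C ^ 2) * rmax / (2 * D ^ 4) = rmax * (B + 2 * C ^ 2) / D ^ 4 / 2 := by
        field_simp
      rw [e]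
      linarith
    have hMdef : constM i γ rmax Amax lam = (B + 2 * C ^ 2) * G * rmax / D ^ 4 := rfl
    calc rmax / D * G + L / 2 * G
        ≤ (B + 2 * C ^ 2) * rmax / (2 * D ^ 4) * G + (B + 2 * C ^ 2) * rmax / (2 * D ^ 4) * G := by
          gcongr
      _ = constM i γ rmax Amax lam := by rw [hMdef]; field_simp; ring
  have e1 : 1 / (T : ℝ) * (rmax / D * (L + G * Real.sqrt T) + L / 2 * G * Real.sqrt T)
      = rmax / D * L / T + (rmax / D * G + L / 2 * G) / Real.sqrt T := by
    have hdiv : Real.sqrt T / T = 1 / Real.sqrt T := Real.sqrt_div_self'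
    linear_combination (rmax / D * G + L / 2 * G) * hdiv
  calc 1 / (T : ℝ) * g
      ≤ 1 / (T : ℝ) * (rmax / D * (L + G * Real.sqrt T) + L / 2 * G * Real.sqrt T) :=
        mul_le_mul_of_nonneg_left hsum (by positivity)
    _ ≤ _ := by rw [e1]; gcongr

/-- A bound of the Lebesgue integral of the positive part bounds the Bochner integral. -/
lemma integral_le_toReal_of_ofReal_le {Γ : Type*} [MeasurableSpace Γ] {μ : Measure Γ} {X : Γ → ℝ}
    (hX : Integrable X μ) {I : ℝ≥0∞} (hI : I ≠ ⊤) (h : ∫⁻ τ, ENNReal.ofReal (X τ) ∂μ ≤ I) :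
    ∫ τ, X τ ∂μ ≤ I.toReal := by
  calc ∫ τ, X τ ∂μ ≤ ∫ τ, max (X τ) 0 ∂μ :=
        integral_mono hX hX.pos_part fun τ => le_max_left _ _
    _ = (∫⁻ τ, ENNReal.ofReal (max (X τ) 0) ∂μ).toReal :=
        integral_eq_lintegral_of_nonneg_ae (Filter.Eventually.of_forall fun τ => le_max_right _ _)
          hX.pos_part.aestronglyMeasurable
    _ ≤ I.toReal := by
        refine ENNReal.toReal_mono hI ?_
        refine le_trans (le_of_eq (lintegral_congr fun τ => ?_)) h
        rcases le_total (X τ) 0 with h0 | h0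
        · rw [max_eq_right h0, ENNReal.ofReal_zero, ENNReal.ofReal_of_nonpos h0]
        · rw [max_eq_left h0]

/-- The averaged gap, bounded through one admissible parameter `θ` and one measurable choice `f`
of optimal policies. -/
lemma average_gap_le
    {S A : Type*} [Fintype S] [Nonempty S] [Fintype A] [Nonempty A]
    {γ : ℝ} (hγ0 : 0 ≤ γ) (hγ1 : γ < 1) {rmax : ℝ} (hrmax : 0 < rmax)
    {Γ : Type*} [MeasurableSpace Γ] {M : Γ → MDP S A rmax}
    (hρ : ∀ s, Measurable fun τ => (M τ).ρ s)
    (hP : ∀ s a s', Measurable fun τ => (M τ).P s a s')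
    (hr : ∀ s a s', Measurable fun τ => (M τ).r s a s')
    (μ : Measure Γ) [IsProbabilityMeasure μ] {Θ : Set (EuclideanSpace ℝ (S × A))}
    {Amax : ℝ} (hAmax : 0 < Amax)
    (hadv : ∀ τ θ s a, |advantage γ (M τ) (softmaxPolicy θ) s a| ≤ Amax)
    {ε : ℝ} (hε : 0 < ε)
    (hvisit : ∀ τ, ∀ φ ∈ Θ, ∀ s, ε ≤ visitation γ (M τ) (softmaxPolicy φ) s)
    {i : Order} {lam : ℝ} (hlam : lam = regWeight γ Amax ε)
    {h : ℝ → ℝ} (h_concave : ConcaveOn ℝ (Set.Ici 0) h) (h_mono : MonotoneOn h (Set.Ici 0))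
    (hgrad : ∀ φ' ∈ Θ, ∀ φ : EuclideanSpace ℝ (S × A),
      metaObjective i γ lam M μ φ' - metaObjective i γ lam M μ φ
        ≤ h (‖gradient (metaObjective i γ lam M μ) φ‖ ^ 2))
    {Ω : Type*} [MeasurableSpace Ω] (Pr : Measure Ω) [IsProbabilityMeasure Pr]
    {τs : ℕ → Ω → Γ} (hτ_meas : ∀ t, Measurable (τs t))
    (hτ_indep : iIndepFun τs Pr) (hτ_law : ∀ t, Pr.map (τs t) = μ)
    {T : ℕ} (hT : 1 ≤ T) {φ₀ : EuclideanSpace ℝ (S × A)}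
    {φ : ℕ → Ω → EuclideanSpace ℝ (S × A)} (hφ₀ : ∀ ω, φ 0 ω = φ₀)
    (hφ : ∀ t ω, φ (t + 1) ω = φ t ω + stepSize i γ rmax Amax lam T •
      gradient (adaptedReward i γ lam (M (τs t ω))) (φ t ω))
    {θ : EuclideanSpace ℝ (S × A)} (hθ : θ ∈ Θ)
    {f : Γ → S → A → ℝ} (hf : Measurable f) (hfopt : ∀ τ, IsOptimal γ (M τ) Θ (f τ))
    (hI : ∫⁻ τ, sqDist i γ (M τ) (softmaxPolicy θ) (f τ) ∂μ ≠ ⊤) :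
    (1 / (T : ℝ)) * ∑ t ∈ Finset.Icc 1 T,
        ∫ ω, (∫ τ, (J γ (M τ) (f τ) - adaptedReward i γ lam (M τ) (φ t ω)) ∂μ) ∂Pr
      ≤ h (constK i γ rmax lam / T + constM i γ rmax Amax lam / Real.sqrt T)
        + (1 + γ) / (1 - γ) * lam
          * (∫⁻ τ, sqDist i γ (M τ) (softmaxPolicy θ) (f τ) ∂μ).toReal := by
  have hD : 0 < 1 - γ := by linarith
  have hlam0 : 0 < lam := by rw [hlam, regWeight]; positivity
  -- the visitation frequencies sum to one, so `ε ≤ 1`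
  have hε1 : ε ≤ 1 := by
    obtain ⟨τ⟩ := nonempty_of_isProbabilityMeasure μ
    have s := Classical.arbitrary S
    refine (hvisit τ θ hθ s).trans ?_
    rw [← sum_visitation hγ0 hγ1 (M τ) (isPolicy_softmaxPolicy θ)]
    exact Finset.single_le_sum
      (fun s _ => visitation_nonneg hγ0 hγ1 (M τ) (isPolicy_softmaxPolicy θ) s)
      (Finset.mem_univ s)
  have hlamA : 2 * Amax ≤ (1 - γ) * lam := by
    have : (1 - γ) * lam = 2 * Amax / ε := by rw [hlam, regWeight]; field_simp
    rw [this, le_div_iff₀ hε]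
    nlinarith
  have hfam := isSmoothFamily_adaptedReward hρ hP hr hγ0 hγ1 hrmax hAmax hadv hlam0 hlamA i
  have hpol : ∀ τ, IsPolicy (f τ) := fun τ => isPolicy_of_mem_policyClass (hfopt τ).1
  have hJmeas : Measurable fun τ => J γ (M τ) (f τ) := by
    refine measurable_J hρ hP hr hγ0 hγ1 (fun s a => ?_) hpol
    exact (measurable_pi_apply a).comp ((measurable_pi_apply s).comp hf)
  have hJint : Integrable (fun τ => J γ (M τ) (f τ)) μ :=
    Integrable.of_bound hJmeas.aestronglyMeasurable (rmax / (1 - γ))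
      (Filter.Eventually.of_forall fun τ => by
        rw [Real.norm_of_nonneg (J_nonneg hγ0 hγ1 (M τ) (hpol τ))]
        exact J_le hγ0 hγ1 (M τ) (hpol τ))
  set F := metaObjective i γ lam M μ with hF
  set Jbar := ∫ τ, J γ (M τ) (f τ) ∂μ with hJbar
  set c := (1 + γ) / (1 - γ) * lam with hc
  have hc0 : 0 < c := by positivity
  set I := ∫⁻ τ, sqDist i γ (M τ) (softmaxPolicy θ) (f τ) ∂μ with hIdef
  have hgapint : ∀ x, ∫ τ, (J γ (M τ) (f τ) - adaptedReward i γ lam (M τ) x) ∂μ = Jbar - F x :=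
    fun x => integral_sub hJint (hfam.integrable μ x)
  have hθgap : Jbar - F θ ≤ c * I.toReal := by
    have h1 := integral_le_toReal_of_ofReal_le
      (X := fun τ => (J γ (M τ) (f τ) - adaptedReward i γ lam (M τ) θ) / c)
      ((hJint.sub (hfam.integrable μ θ)).div_const c) hI
      (lintegral_mono fun τ => by
        have := ofReal_gap_le_sqDist hγ0 hγ1 (M τ) hAmax hε (hadv τ θ) (hvisit τ θ hθ) i (hpol τ)
        rwa [← hlam] at this)
    rw [integral_div, hgapint, div_le_iff₀ hc0] at h1
    linarith
  set m := constK i γ rmax lam / T + constM i γ rmax Amax lam / Real.sqrt T with hm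
  have hm0 : 0 < m := by
    have hB : 0 < constB i γ rmax lam := constB_pos hγ1 hrmax hlam0 i
    have hG : 0 < constG i γ Amax := constG_pos hγ1 hAmax i
    have hTpos : (0 : ℝ) < T := by exact_mod_cast hT
    simp only [hm, constK, constM]
    positivity
  -- an affine majorant of `h` at the rate `m` replaces Jensen's inequality: it can be averaged
  -- over the iterations and the samples without any measurability of `h`
  obtain ⟨c', hc'0, hc'⟩ := exists_affine_majorant h_concave h_mono hm0
  set X : ℕ → Ω → ℝ := fun t ω => ‖gradient F (φ t ω)‖ ^ 2 with hX
  have hXint : ∀ t, Integrable (X t) Pr := hfam.integrable_sq_norm_gradient μ Pr hτ_meas hφ₀ hφ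
  have hFint : ∀ t, Integrable (fun ω => F (φ t ω)) Pr :=
    hfam.integrable_mean μ Pr hτ_meas hφ₀ hφ
  have hstep : ∀ t, ∫ ω, (∫ τ, (J γ (M τ) (f τ) - adaptedReward i γ lam (M τ) (φ t ω)) ∂μ) ∂Pr
      ≤ c * I.toReal + h m - c' * m + c' * ∫ ω, X t ω ∂Pr := by
    intro t
    simp only [hgapint]
    have hpt : ∀ ω, Jbar - F (φ t ω) ≤ (c * I.toReal + h m - c' * m) + c' * X t ω := by
      intro ω
      have h1 := hgrad θ hθ (φ t ω)
      have h2 := hc' (X t ω) (sq_nonneg _)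
      have h3 : X t ω = ‖gradient F (φ t ω)‖ ^ 2 := rfl
      rw [← h3] at h1
      linarith
    have h1 := integral_mono ((integrable_const Jbar).sub (hFint t))
      ((integrable_const (c * I.toReal + h m - c' * m)).add ((hXint t).const_mul c')) hpt
    refine h1.trans (le_of_eq ?_)
    simp only [Pi.add_apply]
    rw [integral_add (integrable_const _) ((hXint t).const_mul c'), integral_const_mul]
    simp
  have hα : 0 ≤ stepSize i γ rmax Amax lam T := by
    have hB : 0 < constB i γ rmax lam := constB_pos hγ1 hrmax hlam0 i
    have hG : 0 < constG i γ Amax := constG_pos hγ1 hAmax i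
    exact le_min (by positivity) (by positivity)
  have hL : 0 ≤ smoothnessConst i γ rmax lam := by
    have hB : 0 < constB i γ rmax lam := constB_pos hγ1 hrmax hlam0 i
    simp only [smoothnessConst]
    positivity
  have havg : 1 / (T : ℝ) * ∑ t ∈ Finset.Icc 1 T, ∫ ω, X t ω ∂Pr ≤ m :=
    average_le_of_ascent hγ0 hγ1 hrmax hAmax hlam0 hT
      (hfam.sum_integral_sq_norm_gradient_le μ Pr hτ_meas hτ_indep hτ_law hφ₀ hφ hα hL T)
  have hTpos : (0 : ℝ) < T := by exact_mod_cast hT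
  calc _ ≤ (1 / (T : ℝ)) * ∑ t ∈ Finset.Icc 1 T,
        (c * I.toReal + h m - c' * m + c' * ∫ ω, X t ω ∂Pr) :=
        mul_le_mul_of_nonneg_left (Finset.sum_le_sum fun t _ => hstep t) (by positivity)
    _ = c * I.toReal + h m - c' * m
        + c' * (1 / (T : ℝ) * ∑ t ∈ Finset.Icc 1 T, ∫ ω, X t ω ∂Pr) := by
        rw [Finset.sum_add_distrib, ← Finset.mul_sum, Finset.sum_const, Nat.card_Icc,
          Nat.add_sub_cancel, nsmul_eq_mul]
        field_simp
    _ ≤ _ := by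
        have := mul_le_mul_of_nonneg_left havg hc'0
        linarith

end MetaRL

theorem theorem3
    {S A : Type*} [Fintype S] [Nonempty S] [Fintype A] [Nonempty A]
    -- discount factor, reward bound
    (γ : ℝ) (hγ0 : 0 ≤ γ) (hγ1 : γ < 1) (rmax : ℝ) (hrmax : 0 < rmax)
    -- the tasks and their distribution
    {Γ : Type*} [MeasurableSpace Γ] (M : Γ → MetaRL.MDP S A rmax)
    (hρ : ∀ s, Measurable fun τ => (M τ).ρ s)
    (hP : ∀ s a s', Measurable fun τ => (M τ).P s a s')
    (hr : ∀ s a s', Measurable fun τ => (M τ).r s a s')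
    (μ : Measure Γ) [IsProbabilityMeasure μ]
    -- the set of admissible parameters
    (Θ : Set (EuclideanSpace ℝ (S × A)))
    -- bounded advantage functions
    (Amax : ℝ) (hAmax : 0 < Amax)
    (hadv : ∀ τ θ s a, |MetaRL.advantage γ (M τ) (MetaRL.softmaxPolicy θ) s a| ≤ Amax)
    -- sufficient state visit
    (ε : ℝ) (hε : 0 < ε)
    (hvisit : ∀ τ, ∀ φ ∈ Θ, ∀ s, ε ≤ MetaRL.visitation γ (M τ) (MetaRL.softmaxPolicy φ) s)
    -- which of the two within-task algorithms is used, and its regularization weight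
    (i : MetaRL.Order) (lam : ℝ) (hlam : lam = MetaRL.regWeight γ Amax ε)
    -- the error of the meta-objective is bounded through its gradient
    (h : ℝ → ℝ) (h_concave : ConcaveOn ℝ (Set.Ici 0) h) (h_mono : MonotoneOn h (Set.Ici 0))
    (h_nonneg : ∀ x, 0 ≤ x → 0 ≤ h x)
    (hgrad : ∀ φ' ∈ Θ, ∀ φ : EuclideanSpace ℝ (S × A),
      MetaRL.metaObjective i γ lam M μ φ' - MetaRL.metaObjective i γ lam M μ φ
        ≤ h (‖gradient (MetaRL.metaObjective i γ lam M μ) φ‖ ^ 2))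
    -- the i.i.d. tasks sampled by the algorithm
    {Ω : Type*} [MeasurableSpace Ω] (Pr : Measure Ω) [IsProbabilityMeasure Pr]
    (τs : ℕ → Ω → Γ) (hτ_meas : ∀ t, Measurable (τs t))
    (hτ_indep : iIndepFun τs Pr) (hτ_law : ∀ t, Pr.map (τs t) = μ)
    -- number of iterations, initial parameter, generated meta-parameters
    (T : ℕ) (hT : 1 ≤ T) (φ₀ : EuclideanSpace ℝ (S × A))
    (φ : ℕ → Ω → EuclideanSpace ℝ (S × A))
    (hφ : ∀ t ω, φ t ω = MetaRL.metaIterate i γ lam (MetaRL.stepSize i γ rmax Amax lam T) M φ₀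
      (fun k => τs k ω) t)
    -- an optimal policy for every task
    (πstar : Γ → S → A → ℝ) (hπstar : ∀ τ, MetaRL.IsOptimal γ (M τ) Θ (πstar τ)) :
    (((1 / (T : ℝ)) * ∑ t ∈ Finset.Icc 1 T,
        ∫ ω, (∫ τ, (MetaRL.J γ (M τ) (πstar τ)
          - MetaRL.J γ (M τ) (MetaRL.alg i γ lam (M τ) (MetaRL.softmaxPolicy (φ t ω)))) ∂μ) ∂Pr
        : ℝ) : EReal)
      ≤ ((h (MetaRL.constK i γ rmax lam / T + MetaRL.constM i γ rmax Amax lam / Real.sqrt T)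
          : ℝ) : EReal)
        + ((2 * (1 + γ) * Amax / ((1 - γ) ^ 2 * ε) : ℝ) : EReal)
          * (MetaRL.taskVariance i γ M μ Θ : EReal) := by
  have hD : 0 < 1 - γ := by linarith
  set H := h (MetaRL.constK i γ rmax lam / T + MetaRL.constM i γ rmax Amax lam / Real.sqrt T)
  have hc : 2 * (1 + γ) * Amax / ((1 - γ) ^ 2 * ε) = (1 + γ) / (1 - γ) * lam := by
    rw [hlam, MetaRL.regWeight]; field_simp
  have hlam0 : 0 < lam := by rw [hlam, MetaRL.regWeight]; positivity
  rw [hc]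
  set c := (1 + γ) / (1 - γ) * lam
  have hc0 : 0 < c := by positivity
  set ℓ : ℝ := (1 / (T : ℝ)) * ∑ t ∈ Finset.Icc 1 T,
        ∫ ω, (∫ τ, (MetaRL.J γ (M τ) (πstar τ)
          - MetaRL.J γ (M τ) (MetaRL.alg i γ lam (M τ) (MetaRL.softmaxPolicy (φ t ω)))) ∂μ) ∂Pr
    with hℓ
  have hstepφ : ∀ t ω, φ (t + 1) ω = φ t ω + MetaRL.stepSize i γ rmax Amax lam T •
      gradient (MetaRL.adaptedReward i γ lam (M (τs t ω))) (φ t ω) := fun t ω => by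
    simp only [hφ]; rfl
  -- the bound solved for the task variance, so that the infima can be taken in `[0, ∞]`
  have hinf : ENNReal.ofReal ((ℓ - H) / c) ≤ MetaRL.taskVariance i γ M μ Θ := by
    refine le_iInf₂ fun θ hθ => le_iInf₂ fun f hf => ?_
    by_cases hI : ∫⁻ τ, MetaRL.sqDist i γ (M τ) (MetaRL.softmaxPolicy θ) (f τ) ∂μ = ⊤
    · rw [hI]; exact le_top
    -- all optimal policies of a task have the same reward
    have hJ : ∀ τ, MetaRL.J γ (M τ) (πstar τ) = MetaRL.J γ (M τ) (f τ) := fun τ =>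
      le_antisymm ((hf.2 τ).2 (hπstar τ).1) ((hπstar τ).2 (hf.2 τ).1)
    have hgap := MetaRL.average_gap_le hγ0 hγ1 hrmax hρ hP hr μ hAmax hadv hε hvisit hlam h_concave
      h_mono hgrad Pr hτ_meas hτ_indep hτ_law hT (fun ω => hφ 0 ω) hstepφ hθ hf.1 hf.2 hI
    simp only [← hJ] at hgap
    refine ENNReal.ofReal_le_of_le_toReal ?_
    rw [div_le_iff₀ hc0]
    have hgap' : ℓ ≤ H + c * (∫⁻ τ, MetaRL.sqDist i γ (M τ) (MetaRL.softmaxPolicy θ) (f τ)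
      ∂μ).toReal := hgap
    linarith
  by_cases hV : MetaRL.taskVariance i γ M μ Θ = ⊤
  · rw [hV, EReal.coe_ennreal_top, EReal.coe_mul_top_of_pos hc0, EReal.coe_add_top]
    exact le_top
  · have hcoe : (MetaRL.taskVariance i γ M μ Θ : EReal)
        = ((MetaRL.taskVariance i γ M μ Θ).toReal : ℝ) := by
      rw [← EReal.toReal_coe_ennreal,
        EReal.coe_toReal (by simpa using hV) (EReal.coe_ennreal_ne_bot _)]
    rw [hcoe]
    have h1 := ENNReal.toReal_mono hV hinf
    have h2 : (ℓ - H) / c ≤ (MetaRL.taskVariance i γ M μ Θ).toReal :=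
      (by rw [ENNReal.toReal_ofReal']; exact le_max_left _ _ :
        (ℓ - H) / c ≤ (ENNReal.ofReal ((ℓ - H) / c)).toReal).trans h1
    rw [div_le_iff₀ hc0] at h2
    have h3 : ℓ ≤ H + c * (MetaRL.taskVariance i γ M μ Θ).toReal := by linarith
    exact_mod_cast h3
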